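/- **Setting.** Let $d,q\ge 1$ and let $X\in\mathbb{R}^d$, $Y\in\mathbb{R}^q$ be random vectors whose joint law has a density $f_{XY}\ge 0$. Let $\mathcal{X},\mathcal{Y},\mathcal{S}$ be the supports of the laws of $X$, $Y$, $(X,Y)$. For $k\ge1$ and a compact convex set $K$ with interior $A\ne\emptyset$, let $C^k(K;\mathbb{R}^m)$ be the space of maps $g=(g_1,\dots,g_m)$ that are $(k-1)$ times differentiable in $A$, take on $\partial K$ the values of their continuous extension, and have finite norm $$\|g\|_{C^k(K;\mathbb{R}^m)}=\sum_{i=1}^m\Big[\max_{|\alpha|\le k-1}\sup_{a\in A}|D^\alpha g_i(a)|+\max_{|\alpha|=k-1}\sup_{a\ne b\in A}\frac{|D^\alpha g_i(a)-D^\alpha g_i(b)|}{|a-b|}\Big].$$ Assume: 1. $\mathcal{S}$ is compact and convex with nonempty interior, $f_{XY}\in C^k(\mathcal{S})$ with $k\in\mathbb{N}$, $k>(d+q)/2$, and $f_{XY}>0$ on $\mathcal{S}$. 2. $\kappa:\mathbb{R}^q\to[0,\infty)$ is a $C^\infty$ probability density supported in $[-1,1]^q$; put $\kappa_\varepsilon(y)=\varepsilon^{-q}\kappa(y/\varepsilon)$.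 3. $\rho:\mathbb{R}\to\mathbb{R}$ is $k$ times continuously differentiable and not a polynomial. Let $\mathscr{A}_\rho(d,q)$ be the set of all maps $\varphi:\mathbb{R}^d\times\mathbb{R}^q\to\mathbb{R}^q$, $\varphi_j(x,u)=\sum_{i=1}^r\phi_{i,j}(x)\psi_{i,j}(u)$, with $r\ge1$ and $\phi:\mathbb{R}^d\to\mathbb{R}^{r\times q}$, $\psi:\mathbb{R}^q\to\mathbb{R}^{r\times q}$ feedforward neural networks of arbitrary depth and widths, with activation $\rho$ in the hidden layers and an affine output layer. For $M\ge1$ let $$\mathscr{H}_M=\Big\{\varphi\in\mathscr{A}_\rho(d,q):\int_{[0,1]^q}\|\varphi(\cdot,u)\|_{C^k(\mathcal{X};\mathbb{R}^q)}\,du<M\Big\}.$$ Let $(x_i,y_i)_{i\ge1}$ be an iid sequence distributed as $(X,Y)$. For $\varepsilon,\delta\in(0,1)$ and $n\ge1$ put $$\mathscr{L}_n^{\delta,\varepsilon}(\varphi)=-\frac1n\sum_{i=1}^n\log\Big[\delta+\int_{[0,1]^q}\kappa_\varepsilon(y_i-\varphi(x_i,u))\,du\Big].$$ For $\hat\varphi_{\varepsilon,\delta,n}\in\mathscr{H}_M$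 let $\hat f_{\varepsilon,\delta,n,x}(y)=\int_{[0,1]^q}\kappa_\varepsilon(y-\hat\varphi_{\varepsilon,\delta,n}(x,u))\,du$, which is the density of $\hat\varphi_{\varepsilon,\delta,n}(x,U)+\varepsilon Z$ for independent $U\sim\mathcal{U}([0,1]^q)$ and $Z\sim\kappa$. Let $f_{Y|X}(y\,|\,x)=f_{XY}(x,y)/\int f_{XY}(x,y')\,dy'$. **Theorem (near asymptotic consistency).** There are constants $c_1,c_2>0$, independent of $\varepsilon$, $\delta$ and $M$, such that for all $\varepsilon,\delta\in(0,1)$ and all $M$ large enough (how large may depend on $\varepsilon$ and $\delta$), the following holds almost surely: for every sequence $\hat\varphi_{\varepsilon,\delta,n}\in\mathscr{H}_M$ with $$\mathscr{L}_n^{\delta,\varepsilon}(\hat\varphi_{\varepsilon,\delta,n})\le\inf_{\varphi\in\mathscr{H}_M}\mathscr{L}_n^{\delta,\varepsilon}(\varphi)+\frac1n\qquad(n\ge1),$$ one has $$\limsup_{n\to\infty}\Big(\mathbb{E}_X\big\|f_{Y|X}(\cdot\,|\,X)-\hat f_{\varepsilon,\delta,n,X}\big\|_{L^1(\mathcal{Y})}^2\Big)^{1/2}<c_1\sqrt{\delta}+c_2\sqrt{\varepsilon/\delta}.$$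 -/

import Mathlib

open MeasureTheory ProbabilityTheory Set
open scoped ENNReal

noncomputable section

namespace CPFN

/-! ### The spaces `C^k(K)`

`ℝ^ι` is `ι → ℝ` with Lebesgue measure; Euclidean distances are written out. -/

/-- Euclidean distance on `ℝ^ι`. -/
def euclDist {ι : Type} [Fintype ι] (a b : ι → ℝ) : ℝ :=
  Real.sqrt (∑ i, (a i - b i) ^ 2)

/-- The mixed partial derivative `∂_{s 0} ⋯ ∂_{s (m-1)} g (a)`. Every `D^α` with `|α| = m` is of this
form, and conversely. -/
def partialD {ι : Type} [Fintype ι] [DecidableEq ι] {m : ℕ} (s : Fin m → ι) (g : (ι → ℝ) → ℝ)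
    (a : ι → ℝ) : ℝ :=
  iteratedFDeriv ℝ m g a (fun j => Pi.single (s j) (1 : ℝ))

/-- The `C^k` norm of a scalar function over the interior `A` of `K`, with values in `[0, ∞]`:
`max_{|α| ≤ k-1} sup_A |D^α g| + max_{|α| = k-1} sup_{a ≠ b} |D^α g(a) - D^α g(b)| / |a - b|`. -/
def ckNorm {ι : Type} [Fintype ι] [DecidableEq ι] (k : ℕ) (K : Set (ι → ℝ)) (g : (ι → ℝ) → ℝ) :
    ℝ≥0∞ :=
  (⨆ m : ℕ, ⨆ _ : m ≤ k - 1, ⨆ s : Fin m → ι, ⨆ a ∈ interior K, ENNReal.ofReal |partialD s g a|) +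
  ⨆ s : Fin (k - 1) → ι, ⨆ a ∈ interior K, ⨆ b ∈ interior K, ⨆ _ : a ≠ b,
    ENNReal.ofReal (|partialD s g a - partialD s g b| / euclDist a b)

/-- The `C^k(K; ℝ^q)` norm of a vector-valued function: the sum over the components. -/
def ckNormVec {ι : Type} [Fintype ι] [DecidableEq ι] {q : ℕ} (k : ℕ) (K : Set (ι → ℝ))
    (g : (ι → ℝ) → (Fin q → ℝ)) : ℝ≥0∞ :=
  ∑ i, ckNorm k K (fun x => g x i)

/-- `g ∈ C^k(K)`: `g` is `(k-1)` times differentiable in the interior of `K` with finite `C^k` norm;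
on the boundary, `g` takes the values of its continuous extension. -/
def IsCk {ι : Type} [Fintype ι] [DecidableEq ι] (k : ℕ) (K : Set (ι → ℝ)) (g : (ι → ℝ) → ℝ) :
    Prop :=
  ContinuousOn g K ∧ ContDiffOn ℝ (k - 1 : ℕ) g (interior K) ∧ ckNorm k K g < ∞

/-- The identification `ℝ^{d+q} ≅ ℝ^d × ℝ^q`. -/
def splitCoords {d q : ℕ} (z : Fin d ⊕ Fin q → ℝ) : (Fin d → ℝ) × (Fin q → ℝ) :=
  (fun i => z (Sum.inl i), fun j => z (Sum.inr j))

/-! ### Densities -/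

/-- `f` is a (nonnegative, measurable) Lebesgue density of the law of `(X, Y)`. -/
def IsJointDensity {Ω : Type*} [MeasurableSpace Ω] (P : Measure Ω) {d q : ℕ}
    (X : Ω → (Fin d → ℝ)) (Y : Ω → (Fin q → ℝ)) (f : (Fin d → ℝ) × (Fin q → ℝ) → ℝ) : Prop :=
  Measurable f ∧ (∀ z, 0 ≤ f z) ∧
    P.map (fun ω => (X ω, Y ω)) = volume.withDensity (fun z => ENNReal.ofReal (f z))

/-- The conditional density `f_{Y|X}(y | x) = f_{XY}(x, y) / f_X(x)`, where
`f_X(x) = ∫ f_{XY}(x, y') dy'`. -/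
def condDensity {d q : ℕ} (f : (Fin d → ℝ) × (Fin q → ℝ) → ℝ) (x : Fin d → ℝ) (y : Fin q → ℝ) : ℝ :=
  f (x, y) / ∫ y', f (x, y')

/-- A smooth probability density on `ℝ^q` supported in `[-1,1]^q`. -/
structure IsKernel {q : ℕ} (κ : (Fin q → ℝ) → ℝ) : Prop where
  nonneg : ∀ z, 0 ≤ κ z
  smooth : ContDiff ℝ (⊤ : ℕ∞) κ
  support_subset : tsupport κ ⊆ Icc (fun _ => -1) (fun _ => 1)
  integral_eq_one : ∫ z, κ z = 1

/-- The scaled kernel `κ_ε(y) = ε^{-q} κ(y / ε)`. -/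
def scaledKernel {q : ℕ} (κ : (Fin q → ℝ) → ℝ) (ε : ℝ) (y : Fin q → ℝ) : ℝ :=
  (ε ^ q)⁻¹ * κ (ε⁻¹ • y)

/-- The unit cube `[0,1]^q`. -/
def cube (q : ℕ) : Set (Fin q → ℝ) := Icc (fun _ => 0) (fun _ => 1)

/-- The density `y ↦ ∫_{[0,1]^q} κ_ε(y - φ(x, u)) du` of `φ(x, U) + ε Z`, where
`U ~ Unif [0,1]^q` and `Z ~ κ` are independent. -/
def genDensity {d q : ℕ} (κ : (Fin q → ℝ) → ℝ) (ε : ℝ)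
    (φ : (Fin d → ℝ) → (Fin q → ℝ) → (Fin q → ℝ)) (x : Fin d → ℝ) (y : Fin q → ℝ) : ℝ :=
  ∫ u in cube q, scaledKernel κ ε (y - φ x u)

/-- `genDensity` is indeed the density of the law of `φ(x, U) + ε Z`. -/
theorem law_eq_withDensity_genDensity {d q : ℕ} {κ : (Fin q → ℝ) → ℝ} (hκ : IsKernel κ) {ε : ℝ}
    (hε : 0 < ε) (φ : (Fin d → ℝ) → (Fin q → ℝ) → (Fin q → ℝ)) (x : Fin d → ℝ)
    (hφ : Measurable (φ x)) :
    (((volume.restrict (cube q)).prod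
        (volume.withDensity (fun z => ENNReal.ofReal (κ z)))).map
          (fun p => φ x p.1 + ε • p.2)) =
      volume.withDensity (fun y => ENNReal.ofReal (genDensity κ ε φ x y)) := by
  have hκc : Continuous κ := hκ.smooth.continuous
  have hκm : Measurable κ := hκc.measurable
  have hcs : HasCompactSupport κ :=
    HasCompactSupport.of_support_subset_isCompact isCompact_Icc
      ((subset_tsupport κ).trans hκ.support_subset)
  have hvol : volume (cube q) < ⊤ := (isCompact_Icc).measure_lt_top
  have hint : Integrable κ := hκc.integrable_of_hasCompactSupport hcs
  have : IsFiniteMeasure (volume.restrict (cube q)) := ⟨by simpa using hvol⟩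
  have : IsFiniteMeasure (volume.withDensity (fun z => ENNReal.ofReal (κ z))) :=
    isFiniteMeasure_withDensity_ofReal hint.2
  obtain ⟨C, hC⟩ := hcs.exists_bound_of_continuous hκc
  have hkm : Measurable (fun p : (Fin q → ℝ) × (Fin q → ℝ) =>
      scaledKernel κ ε (p.2 - φ x p.1)) := by
    unfold scaledKernel
    have h0 : Measurable (fun p : (Fin q → ℝ) × (Fin q → ℝ) => ε⁻¹ • (p.2 - φ x p.1)) :=
      (measurable_snd.sub (hφ.comp measurable_fst)).const_smul ε⁻¹
    exact (hκm.comp h0).const_mul _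
  have hknn : ∀ y, 0 ≤ scaledKernel κ ε y := fun y =>
    mul_nonneg (inv_nonneg.2 (pow_nonneg hε.le _)) (hκ.nonneg _)
  ext s hs
  have hT : Measurable (fun p : (Fin q → ℝ) × (Fin q → ℝ) => φ x p.1 + ε • p.2) :=
    (hφ.comp measurable_fst).add (measurable_snd.const_smul ε)
  rw [Measure.map_apply hT hs, Measure.prod_apply (hT hs), withDensity_apply _ hs]
  have key : ∀ u, (volume.withDensity (fun z => ENNReal.ofReal (κ z)))
      (Prod.mk u ⁻¹' ((fun p : (Fin q → ℝ) × (Fin q → ℝ) => φ x p.1 + ε • p.2) ⁻¹' s)) =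
      ∫⁻ y in s, ENNReal.ofReal (scaledKernel κ ε (y - φ x u)) := by
    intro u
    have hm : MeasurableSet (Prod.mk u ⁻¹'
        ((fun p : (Fin q → ℝ) × (Fin q → ℝ) => φ x p.1 + ε • p.2) ⁻¹' s)) :=
      measurable_prodMk_left (hT hs)
    rw [withDensity_apply _ hm, ← lintegral_indicator hm, ← lintegral_indicator hs,
      ← lintegral_add_right_eq_self
        (s.indicator (fun y => ENNReal.ofReal (scaledKernel κ ε (y - φ x u)))) (φ x u)]
    set h : (Fin q → ℝ) → ℝ≥0∞ := fun y =>
      s.indicator (fun y => ENNReal.ofReal (scaledKernel κ ε (y - φ x u))) (y + φ x u) with hh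
    have hhm : Measurable h := by
      refine (Measurable.indicator ?_ hs).comp (measurable_id.add_const _)
      exact (hkm.comp (measurable_const.prodMk measurable_id)).ennreal_ofReal
    have h1 : ∫⁻ z, h (ε • z) = ENNReal.ofReal ((ε ^ q)⁻¹) * ∫⁻ z, h z := by
      rw [← lintegral_map hhm (measurable_const_smul ε), Measure.map_addHaar_smul _ hε.ne',
        lintegral_smul_measure, Module.finrank_fin_fun, abs_of_pos (by positivity), smul_eq_mul]
    have h2 : ENNReal.ofReal (ε ^ q) * ENNReal.ofReal ((ε ^ q)⁻¹) = 1 := by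
      rw [← ENNReal.ofReal_mul (by positivity), mul_inv_cancel₀ (by positivity), ENNReal.ofReal_one]
    have h3 : ∫⁻ z, h z = ENNReal.ofReal (ε ^ q) * ∫⁻ z, h (ε • z) := by
      rw [h1, ← mul_assoc, h2, one_mul]
    change _ = ∫⁻ z, h z
    have h4 : Measurable (fun z => h (ε • z)) := hhm.comp (measurable_const_smul ε)
    rw [h3, ← lintegral_const_mul _ h4]
    refine lintegral_congr (fun z => ?_)
    by_cases hz : φ x u + ε • z ∈ s
    · have hz' : ε • z + φ x u ∈ s := by rwa [add_comm]
      simp only [hh, Set.indicator, mem_preimage, hz, hz', if_true]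
      rw [← ENNReal.ofReal_mul (by positivity), scaledKernel, add_sub_cancel_right,
        inv_smul_smul₀ hε.ne', mul_inv_cancel_left₀ (by positivity)]
    · have hz' : ε • z + φ x u ∉ s := by rwa [add_comm]
      simp only [hh, Set.indicator, mem_preimage, hz, hz', if_false, mul_zero]
  simp_rw [key]
  rw [lintegral_lintegral_swap]
  · refine setLIntegral_congr_fun hs (fun y _ => ?_)
    unfold genDensity
    rw [ofReal_integral_eq_lintegral_ofReal]
    · refine Measure.integrableOn_of_bounded (M := (ε ^ q)⁻¹ * C) hvol.ne ?_ ?_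
      · exact (hkm.comp (measurable_id.prodMk measurable_const)).aestronglyMeasurable
      · refine Filter.Eventually.of_forall (fun u => ?_)
        rw [scaledKernel, norm_mul, Real.norm_of_nonneg (inv_nonneg.2 (pow_nonneg hε.le _))]
        exact mul_le_mul_of_nonneg_left (hC _) (inv_nonneg.2 (pow_nonneg hε.le _))
    · exact Filter.Eventually.of_forall (fun u => hknn _)
  · exact (hkm.ennreal_ofReal).aemeasurable

/-! ### Networks -/

/-- Feedforward networks `ℝ^a → ℝ^o` with activation `ρ` in all hidden layers (arbitrarily many,
of arbitrary widths) and an affine output layer. -/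
inductive IsFFN (ρ : ℝ → ℝ) {o : Type} : (a : ℕ) → ((Fin a → ℝ) → (o → ℝ)) → Prop
  | output {a : ℕ} (W : Matrix o (Fin a) ℝ) (b : o → ℝ) :
      IsFFN ρ a (fun v => W.mulVec v + b)
  | hidden {a m : ℕ} (W : Matrix (Fin m) (Fin a) ℝ) (b : Fin m → ℝ) {g : (Fin m → ℝ) → (o → ℝ)} :
      IsFFN ρ m g → IsFFN ρ a (fun v => g (fun i => ρ ((W.mulVec v + b) i)))

/-- The class `𝒜_ρ(d, q)`: maps `φ(x, u)_j = ∑_{i=1}^r Φ_{i,j}(x) Ψ_{i,j}(u)` with networks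
`Φ : ℝ^d → ℝ^{r×q}` and `Ψ : ℝ^q → ℝ^{r×q}`. -/
def IsCPFN (ρ : ℝ → ℝ) {d q : ℕ} (φ : (Fin d → ℝ) → (Fin q → ℝ) → (Fin q → ℝ)) : Prop :=
  ∃ r : ℕ, 1 ≤ r ∧ ∃ (Φ : (Fin d → ℝ) → (Fin r × Fin q → ℝ)) (Ψ : (Fin q → ℝ) → (Fin r × Fin q → ℝ)),
    IsFFN ρ d Φ ∧ IsFFN ρ q Ψ ∧ ∀ x u j, φ x u j = ∑ i, Φ x (i, j) * Ψ u (i, j)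

/-- The hypothesis class `ℋ_M`. -/
def hypClass (ρ : ℝ → ℝ) {d q : ℕ} (k : ℕ) (𝒳 : Set (Fin d → ℝ)) (M : ℝ) :
    Set ((Fin d → ℝ) → (Fin q → ℝ) → (Fin q → ℝ)) :=
  {φ | IsCPFN ρ φ ∧ ∫⁻ u in cube q, ckNormVec k 𝒳 (fun x => φ x u) < ENNReal.ofReal M}

/-! ### Empirical loss and quasi-minimizers -/

/-- The loss `-(1/n) ∑_{i=1}^n log (δ + ∫_{[0,1]^q} κ_ε(y_i - φ(x_i, u)) du)`
(the sample is indexed from `0`). -/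
def empLoss {d q : ℕ} (κ : (Fin q → ℝ) → ℝ) (ε δ : ℝ) (n : ℕ) (x : ℕ → (Fin d → ℝ))
    (y : ℕ → (Fin q → ℝ)) (φ : (Fin d → ℝ) → (Fin q → ℝ) → (Fin q → ℝ)) : ℝ :=
  -(1 / (n : ℝ)) * ∑ i ∈ Finset.range n,
    Real.log (δ + ∫ u in cube q, scaledKernel κ ε (y i - φ (x i) u))

/-- `φ ∈ ℋ` minimizes `L` over `ℋ` up to `τ`. -/
def IsQuasiMin {α : Type*} (L : α → ℝ) (ℋ : Set α) (τ : ℝ) (φ : α) : Prop :=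
  φ ∈ ℋ ∧ ∀ ψ ∈ ℋ, L φ ≤ L ψ + τ

/-- The error `(E_X ‖f_{Y|X} - g_X‖²_{L¹(𝒴)})^{1/2}`, where `E_X` is the expectation under the
law `μX` of `X`. -/
def l1Error {d q : ℕ} (μX : Measure (Fin d → ℝ)) (𝒴 : Set (Fin q → ℝ))
    (f : (Fin d → ℝ) × (Fin q → ℝ) → ℝ) (g : (Fin d → ℝ) → (Fin q → ℝ) → ℝ) : ℝ≥0∞ :=
  (∫⁻ x, (∫⁻ y in 𝒴, ENNReal.ofReal |condDensity f x y - g x y|) ^ 2 ∂μX) ^ (1 / 2 : ℝ)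

end CPFN

end

noncomputable section

namespace CPFN

open Filter Topology

section Smooth

open scoped ContDiff

/-! ### Nonpolynomial activations generate all powers -/

/-! Let `g` be the joint density set to zero off `S`, `p` the conditional density, `G_φ` the density
generated by `φ`, and `K(φ) = ∫ g log ((δ + p) / (δ + G_φ))` the `δ`-regularized relative entropy.
Up to a term independent of `φ`, `K` is the population version of the empirical loss. The theorem
combines three facts about `K`.

Entropy controls the error. Since `g ≥ m` on `S` and the marginal `f_X` is bounded, `p` is bounded
below wherever it is nonzero. Comparing the logarithm with the squared difference of `√(δ + p)` and
`√(δ + G)` then gives a Pinsker-type inequality: the mean squared `L¹` error is at most a constant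
times `K + δ |𝒴|`, the constant being the same for all `δ ≤ 1` (`sq_integral_abs_sub_le`,
`l1Error_le`).

Entropy of order `ε / δ` is attained by a network. By Jensen, smoothing `p` with the kernel costs
the average of `log (δ + p(y)) - log (δ + p(y - v))` over `|v| ≤ ε`. If `y - v` stays in the section
of `S`, the Lipschitz bound for `g` gives `ε / (δ f_X)`, and `f_X` cancels after integration in `y`.
The shifts leaving the section have measure `O(ε)` because sections are bounded and convex
(`volume_diff_translate_le`), and there the cost is at most `log (1 + B / f_X) + 1 / δ`. This is
integrable in `x` because `f_X` decays at most polynomially at the boundary of its convex support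
(`lintegral_log_lt_top`). The smoothed density is exactly the one generated by a bounded measurable
map `T` with `T(x, U)` distributed as `p(x, ·)` (`exists_generator`). Networks are dense in `L¹`:
the closed span of `ρ(c u + b)` contains all powers of `u` when `ρ` is not a polynomial, hence the
exponentials, and Stone–Weierstrass applies. An `L¹`-close network has nearly the same generated
density, since `κ_ε` is Lipschitz, and nearly the same entropy, since `log (δ + ·)` is Lipschitz
(`exists_isCPFN_entropy_le`).

The law of large numbers is uniform over the class. The `C^k` norm with `k ≥ 2` controls gradients,
so membership in `ℋ_M` makes the functions `log (δ + G_φ)` equibounded and equi-Lipschitz on the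
compact set `S`. Discretizing `S` reduces their empirical means to finitely many frequencies
(`uniform_law_of_large_numbers`). Once `M` admits the good network, a quasi-minimizer eventually
satisfies `K ≤ C ε / δ + δ`, and the first fact concludes. -/

theorem exists_polynomial_derivative_eq (p : Polynomial ℝ) :
    ∃ P : Polynomial ℝ, Polynomial.derivative P = p ∧
      ∀ n : ℕ, p.degree < n → P.degree < (n + 1 : ℕ) := by
  refine ⟨∑ i ∈ p.support, Polynomial.monomial (i + 1) (p.coeff i / (i + 1)), ?_, ?_⟩
  · conv_rhs => rw [p.as_sum_support]
    rw [Polynomial.derivative_sum]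
    refine Finset.sum_congr rfl fun i _ => ?_
    rw [Polynomial.derivative_monomial]
    have : (i : ℝ) + 1 ≠ 0 := by positivity
    simp only [Nat.add_sub_cancel]
    congr 1
    push_cast
    field_simp
  · intro n hn
    refine Polynomial.mem_degreeLT.1 (Submodule.sum_mem _ fun i hi => Polynomial.mem_degreeLT.2 ?_)
    · refine (Polynomial.degree_monomial_le _ _).trans_lt ?_
      have h1 : (i : WithBot ℕ) ≤ p.degree := Polynomial.le_degree_of_mem_supp i hi
      have h2 : i < n := by exact_mod_cast h1.trans_lt hn
      exact_mod_cast Nat.succ_lt_succ h2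

/-- The strict degree bound is what allows interpolation at `n` nodes to recover the polynomial. -/
theorem exists_polynomial_of_iteratedDeriv_eq_zero (n : ℕ) :
    ∀ g : ℝ → ℝ, ContDiff ℝ ∞ g → (∀ t, iteratedDeriv n g t = 0) →
      ∃ p : Polynomial ℝ, p.degree < n ∧ ∀ t, g t = p.eval t := by
  induction n with
  | zero =>
    intro g _ h
    exact ⟨0, by simp, fun t => by simpa using h t⟩
  | succ n ih =>
    intro g hg h
    have hg' : ContDiff ℝ ∞ (deriv g) := (contDiff_infty_iff_deriv.1 hg).2
    obtain ⟨p, hp, hpe⟩ := ih (deriv g) hg' (fun t => by rw [← iteratedDeriv_succ']; exact h t)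
    obtain ⟨P, hP, hPd⟩ := exists_polynomial_derivative_eq p
    have hdiff : Differentiable ℝ g := hg.differentiable (by simp)
    have hc : ∀ x y, (fun t => g t - P.eval t) x = (fun t => g t - P.eval t) y := by
      refine is_const_of_deriv_eq_zero (hdiff.sub P.differentiable) (fun t => ?_)
      have := (hdiff t).hasDerivAt.sub (P.hasDerivAt t)
      rw [show (fun t => g t - P.eval t) = g - (fun t => P.eval t) from rfl, this.deriv, hP, hpe,
        sub_self]
    refine ⟨P + Polynomial.C (g 0 - P.eval 0), ?_, fun t => ?_⟩
    · refine (Polynomial.degree_add_le _ _).trans_lt (max_lt (hPd n hp) ?_)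
      refine Polynomial.degree_C_le.trans_lt ?_
      exact_mod_cast Nat.succ_pos n
    · have := hc t 0
      simp only at this
      simp only [Polynomial.eval_add, Polynomial.eval_C]
      linarith

/-- The mollification of `ρ` by a bump function. -/
def mollify (φ : ContDiffBump (0 : ℝ)) (ρ : ℝ → ℝ) : ℝ → ℝ :=
  convolution (φ.normed volume) ρ (ContinuousLinearMap.lsmul ℝ ℝ) volume

theorem mollify_apply (φ : ContDiffBump (0 : ℝ)) (ρ : ℝ → ℝ) (t : ℝ) :
    mollify φ ρ t = ∫ s, φ.normed volume s * ρ (t - s) := by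
  simp [mollify, convolution_def]

theorem contDiff_mollify (φ : ContDiffBump (0 : ℝ)) {ρ : ℝ → ℝ} (hρ : Continuous ρ) :
    ContDiff ℝ ∞ (mollify φ ρ) :=
  HasCompactSupport.contDiff_convolution_left (n := ⊤) _ φ.hasCompactSupport_normed
    φ.contDiff_normed hρ.locallyIntegrable

/-- Otherwise every mollification would be a polynomial of degree below `n`, hence equal to its
Lagrange interpolant at the nodes `0, …, n - 1`. Interpolation depends only on finitely many values,
so it passes to the pointwise limit as the bumps shrink, and `ρ` would be a polynomial. -/
theorem exists_iteratedDeriv_mollify_ne_zero {ρ : ℝ → ℝ} (hρ : Continuous ρ)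
    (hnp : ¬ ∃ p : Polynomial ℝ, ∀ t, ρ t = p.eval t) (n : ℕ) :
    ∃ (φ : ContDiffBump (0 : ℝ)) (b : ℝ), iteratedDeriv n (mollify φ ρ) b ≠ 0 := by
  by_contra! hcon
  apply hnp
  let φ : ℕ → ContDiffBump (0 : ℝ) := fun i =>
    ⟨1 / ((i : ℝ) + 1) / 2, 1 / ((i : ℝ) + 1), by positivity, half_lt_self (by positivity)⟩
  have hφ : Tendsto (fun i => (φ i).rOut) atTop (𝓝 0) := tendsto_one_div_add_atTop_nhds_zero_nat
  have hlim : ∀ t, Tendsto (fun i => mollify (φ i) ρ t) atTop (𝓝 (ρ t)) := fun t =>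
    ContDiffBump.convolution_tendsto_right_of_continuous hφ hρ t
  choose p hp hpe using fun i => exists_polynomial_of_iteratedDeriv_eq_zero n (mollify (φ i) ρ)
    (contDiff_mollify _ hρ) (hcon (φ i))
  have hinj : Set.InjOn (fun i : ℕ => (i : ℝ)) (Finset.range n) := fun a _ b _ h => by
    simpa using h
  have hint : ∀ i, p i = Lagrange.interpolate (Finset.range n) (fun i : ℕ => (i : ℝ))
      (fun j => mollify (φ i) ρ j) := fun i =>
    Lagrange.eq_interpolate_of_eval_eq _ hinj (by simpa using hp i) (fun j _ => (hpe i j).symm)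
  refine ⟨Lagrange.interpolate (Finset.range n) (fun i : ℕ => (i : ℝ)) (fun j => ρ j), fun t => ?_⟩
  refine tendsto_nhds_unique (hlim t) ?_
  have : ∀ i, mollify (φ i) ρ t = ∑ j ∈ Finset.range n,
      mollify (φ i) ρ j * (Lagrange.basis (Finset.range n) (fun i : ℕ => (i : ℝ)) j).eval t := by
    intro i
    rw [hpe i t, hint i]
    simp [Lagrange.interpolate_apply, Polynomial.eval_finsetSum]
  simp_rw [this]
  rw [Lagrange.interpolate_apply, Polynomial.eval_finsetSum]
  simp only [Polynomial.eval_mul, Polynomial.eval_C]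
  exact tendsto_finsetSum _ fun j _ => (hlim j).mul_const _

/-! ### Ridge functions in closed subspaces of `C(K, ℝ)`. -/

section Ridge

variable {K : Type*} [TopologicalSpace K]

/-- The continuous function `x ↦ g (c u(x) + b)`. -/
def ridge (g : C(ℝ, ℝ)) (u : C(K, ℝ)) (c b : ℝ) : C(K, ℝ) :=
  g.comp (c • u + ContinuousMap.const K b)

@[simp] theorem ridge_apply (g : C(ℝ, ℝ)) (u : C(K, ℝ)) (c b : ℝ) (x : K) :
    ridge g u c b x = g (c * u x + b) := rfl

variable [CompactSpace K]

/-- The mollified ridge function is an integral of ridge functions of `ρ` with shifted bias `b - s`.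
The average of a `V`-valued integrand over an interval stays in the closed convex set `V`, and the
integral is a multiple of this average. -/
theorem ridge_mollify_mem {V : Submodule ℝ C(K, ℝ)} (hV : IsClosed (V : Set C(K, ℝ)))
    {ρ : ℝ → ℝ} (hρ : Continuous ρ) (u : C(K, ℝ))
    (hu : ∀ c b, ridge ⟨ρ, hρ⟩ u c b ∈ V) (φ : ContDiffBump (0 : ℝ)) (c b : ℝ) :
    ridge ⟨mollify φ ρ, (contDiff_mollify φ hρ).continuous⟩ u c b ∈ V := by
  set R := φ.rOut
  set T : Set ℝ := Icc (-R) R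
  have hR : 0 < R := φ.rOut_pos
  let F : ℝ → C(K, ℝ) := fun s => φ.normed volume s • ridge ⟨ρ, hρ⟩ u c (b - s)
  have hcurry : Continuous fun s : ℝ => ridge ⟨ρ, hρ⟩ u c (b - s) := by
    refine ContinuousMap.continuous_of_continuous_uncurry _ ?_
    simp only [Function.uncurry_def, ridge_apply, ContinuousMap.coe_mk]
    fun_prop
  have hF : Continuous F := (φ.continuous_normed).smul hcurry
  have hFT : IntegrableOn F T := hF.continuousOn.integrableOn_compact isCompact_Icc
  have hTv : volume T ≠ 0 := by
    simp only [T, Real.volume_Icc]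
    simp; linarith
  have havg := Convex.set_average_mem (μ := volume) (V.convex) hV hTv
    (by simp [T]) (Eventually.of_forall fun s => V.smul_mem _ (hu c (b - s))) hFT
  rw [setAverage_eq] at havg
  have hmem : ∫ s in T, F s ∈ V := by
    have := V.smul_mem (volume.real T) havg
    rwa [smul_inv_smul₀] at this
    simp only [T, Real.volume_real_Icc]
    rw [max_eq_left (by linarith)]
    linarith
  convert hmem using 1
  ext x
  rw [ContinuousMap.integral_apply hFT]
  simp only [ridge_apply, ContinuousMap.coe_mk, F, ContinuousMap.smul_apply, smul_eq_mul]
  rw [mollify_apply, setIntegral_eq_integral_of_forall_compl_eq_zero]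
  · refine integral_congr_ae (Eventually.of_forall fun s => ?_)
    simp only [add_sub_assoc]
  · intro s hs
    have : φ.normed volume s = 0 := by
      rw [← Function.notMem_support, φ.support_normed_eq, Metric.mem_ball, Real.dist_eq, sub_zero]
      intro h
      exact hs ⟨(abs_lt.1 h).1.le, (abs_lt.1 h).2.le⟩
    rw [this, zero_mul]

/-- A Taylor remainder uniform on `[-A, A]`; it makes difference quotients in the parameter `c`
converge uniformly on `K`. -/
theorem abs_sub_sub_mul_deriv_le {g : ℝ → ℝ} (hg : ContDiff ℝ ∞ g) (A : ℝ) :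
    ∃ L, 0 ≤ L ∧ ∀ t s, |t| ≤ A → |s| ≤ A → |g s - g t - (s - t) * deriv g t| ≤
      L * (s - t) ^ 2 := by
  have hd : Differentiable ℝ g := hg.differentiable (by simp)
  have hg' : ContDiff ℝ ∞ (deriv g) := (contDiff_infty_iff_deriv.1 hg).2
  have hd' : Differentiable ℝ (deriv g) := hg'.differentiable (by simp)
  have hc'' : Continuous (deriv (deriv g)) := (contDiff_infty_iff_deriv.1 hg').2.continuous
  obtain ⟨L, hL⟩ := isCompact_Icc.exists_bound_of_continuousOn
    (s := Icc (-A) A) hc''.continuousOn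
  refine ⟨max L 0, le_max_right _ _, fun t s ht hs => ?_⟩
  have htm : t ∈ Icc (-A) A := abs_le.1 ht
  have hsm : s ∈ Icc (-A) A := abs_le.1 hs
  have hlip : ∀ x ∈ Icc (-A) A, ∀ y ∈ Icc (-A) A, |deriv g y - deriv g x| ≤ max L 0 * |y - x| := by
    intro x hx y hy
    exact (convex_Icc (-A) A).norm_image_sub_le_of_norm_deriv_le (fun z _ => hd' z)
      (fun z hz => (hL z hz).trans (le_max_left _ _)) hx hy
  have key : ∀ z ∈ uIcc t s, |z - t| ≤ |s - t| := by
    intro z hz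
    exact abs_sub_left_of_mem_uIcc hz
  have hsub : uIcc t s ⊆ Icc (-A) A := uIcc_subset_Icc htm hsm
  have hmv := (convex_uIcc t s).norm_image_sub_le_of_norm_hasDerivWithin_le
    (f := fun z => g z - z * deriv g t) (f' := fun z => deriv g z - 1 * deriv g t)
    (C := max L 0 * |s - t|)
    (fun z _ => ((hd z).hasDerivAt.sub ((hasDerivAt_id z).mul_const _)).hasDerivWithinAt)
    (fun z hz => by
      rw [one_mul, Real.norm_eq_abs]
      exact (hlip t htm z (hsub hz)).trans
        (mul_le_mul_of_nonneg_left (key z hz) (le_max_right _ _)))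
    left_mem_uIcc right_mem_uIcc
  simp only [Real.norm_eq_abs] at hmv
  calc |g s - g t - (s - t) * deriv g t|
      = |g s - s * deriv g t - (g t - t * deriv g t)| := by ring_nf
    _ ≤ max L 0 * |s - t| * |s - t| := hmv
    _ = max L 0 * (s - t) ^ 2 := by rw [mul_assoc, abs_mul_abs_self]; ring

/-- Each derivative in `c` of `g(c u + b)` brings out a factor `u`, and the difference quotients
converge in the supremum norm, so the limit does not leave the closed subspace. -/
theorem pow_mul_ridge_iteratedDeriv_mem {V : Submodule ℝ C(K, ℝ)}
    (hV : IsClosed (V : Set C(K, ℝ))) {g : ℝ → ℝ} (hg : ContDiff ℝ ∞ g) (u : C(K, ℝ))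
    (hu : ∀ c b, ridge ⟨g, hg.continuous⟩ u c b ∈ V) (n : ℕ) (c b : ℝ) :
    u ^ n * ridge ⟨iteratedDeriv n g,
      hg.continuous_iteratedDeriv n (mod_cast le_top)⟩ u c b ∈ V := by
  induction n generalizing c b with
  | zero => simpa using hu c b
  | succ n ih =>
    set G := iteratedDeriv n g with hG
    have hGs : ContDiff ℝ ∞ G := by
      rw [hG, iteratedDeriv_eq_iterate]
      exact hg.iterate_deriv n
    have hGc := hGs.continuous
    -- This bounds `|(c + h) u + b|` on `K` for all `0 ≤ h < 1`.
    set A : ℝ := (|c| + 1) * ‖u‖ + |b|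
    obtain ⟨L, hL0, hL⟩ := abs_sub_sub_mul_deriv_le hGs A
    let D : ℝ → C(K, ℝ) := fun h => h⁻¹ • (u ^ n * ridge ⟨G, hGc⟩ u (c + h) b
      - u ^ n * ridge ⟨G, hGc⟩ u c b)
    have hDm : ∀ h, D h ∈ V := fun h => V.smul_mem _ (V.sub_mem (ih _ _) (ih _ _))
    refine hV.mem_of_tendsto (b := 𝓝[>] (0 : ℝ)) (f := D) ?_ (Eventually.of_forall hDm)
    rw [tendsto_iff_norm_sub_tendsto_zero]
    have hbound : ∀ᶠ h in 𝓝[>] (0 : ℝ), ‖D h - u ^ (n + 1) * ridge ⟨iteratedDeriv (n + 1) g,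
        hg.continuous_iteratedDeriv (n + 1) (mod_cast le_top)⟩ u c b‖ ≤
          h * (‖u‖ ^ n * L * ‖u‖ ^ 2) := by
      filter_upwards [Ioo_mem_nhdsGT (zero_lt_one' ℝ)] with h hh
      have hh0 : 0 < h := hh.1
      rw [ContinuousMap.norm_le _ (by positivity)]
      intro x
      have hux : |u x| ≤ ‖u‖ := u.norm_coe_le_norm x
      have h1 : |c * u x + b| ≤ A := by
        refine (abs_add_le _ _).trans ?_
        rw [abs_mul]
        change _ ≤ (|c| + 1) * ‖u‖ + |b|
        gcongr
        linarith
      have h2 : |(c + h) * u x + b| ≤ A := by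
        refine (abs_add_le _ _).trans ?_
        rw [abs_mul]
        change _ ≤ (|c| + 1) * ‖u‖ + |b|
        gcongr
        refine (abs_add_le _ _).trans ?_
        rw [abs_of_pos hh0]
        linarith [hh.2]
      have h3 := hL _ _ h1 h2
      have e1 : (c + h) * u x + b - (c * u x + b) = h * u x := by ring
      rw [e1] at h3
      simp only [D, ContinuousMap.sub_apply, ContinuousMap.smul_apply, ContinuousMap.mul_apply,
        ContinuousMap.pow_apply, ridge_apply, ContinuousMap.coe_mk, smul_eq_mul, Real.norm_eq_abs]
      rw [iteratedDeriv_succ, ← hG]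
      have e2 : h⁻¹ * (u x ^ n * G ((c + h) * u x + b) - u x ^ n * G (c * u x + b)) -
          u x ^ (n + 1) * deriv G (c * u x + b) = u x ^ n * h⁻¹ *
          (G ((c + h) * u x + b) - G (c * u x + b) - h * u x * deriv G (c * u x + b)) := by
        field_simp
        ring
      rw [e2, abs_mul, abs_mul, abs_pow, abs_of_pos (inv_pos.2 hh0)]
      calc |u x| ^ n * h⁻¹ * |G ((c + h) * u x + b) - G (c * u x + b)
              - h * u x * deriv G (c * u x + b)|
          ≤ |u x| ^ n * h⁻¹ * (L * (h * u x) ^ 2) := by gcongr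
        _ = h * (|u x| ^ n * L * |u x| ^ 2) := by rw [sq_abs]; field_simp
        _ ≤ h * (‖u‖ ^ n * L * ‖u‖ ^ 2) := by gcongr
    refine squeeze_zero' (Eventually.of_forall fun _ => norm_nonneg _) hbound ?_
    have : Tendsto (fun h : ℝ => h * (‖u‖ ^ n * L * ‖u‖ ^ 2)) (𝓝 0)
      (𝓝 (0 * (‖u‖ ^ n * L * ‖u‖ ^ 2))) := tendsto_id.mul_const _
    rw [zero_mul] at this
    exact this.mono_left nhdsWithin_le_nhds

/-- At `c = 0` the ridge factor of `u ^ n` is the constant `iteratedDeriv n (mollify φ ρ) b`, and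
`φ`, `b` are chosen so that it is nonzero. -/
theorem pow_mem_of_ridge_mem {V : Submodule ℝ C(K, ℝ)} (hV : IsClosed (V : Set C(K, ℝ)))
    {ρ : ℝ → ℝ} (hρ : Continuous ρ) (hnp : ¬ ∃ p : Polynomial ℝ, ∀ t, ρ t = p.eval t)
    (u : C(K, ℝ)) (hu : ∀ c b, ridge ⟨ρ, hρ⟩ u c b ∈ V) (n : ℕ) : u ^ n ∈ V := by
  obtain ⟨φ, b, hb⟩ := exists_iteratedDeriv_mollify_ne_zero hρ hnp n
  have h := pow_mul_ridge_iteratedDeriv_mem hV (contDiff_mollify φ hρ) u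
    (fun c b => ridge_mollify_mem hV hρ u hu φ c b) n 0 b
  have h2 := V.smul_mem (iteratedDeriv n (mollify φ ρ) b)⁻¹ h
  convert h2 using 1
  ext x
  simp only [ContinuousMap.pow_apply, ContinuousMap.smul_apply, ContinuousMap.mul_apply,
    ridge_apply, ContinuousMap.coe_mk, zero_mul, zero_add, smul_eq_mul]
  field_simp

/-- The closed span of the ridge functions `ρ (c u + b)` contains `exp u`. -/
theorem exp_comp_mem_of_ridge_mem {V : Submodule ℝ C(K, ℝ)} (hV : IsClosed (V : Set C(K, ℝ)))
    {ρ : ℝ → ℝ} (hρ : Continuous ρ) (hnp : ¬ ∃ p : Polynomial ℝ, ∀ t, ρ t = p.eval t)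
    (u : C(K, ℝ)) (hu : ∀ c b, ridge ⟨ρ, hρ⟩ u c b ∈ V) :
    (⟨fun x => Real.exp (u x), by fun_prop⟩ : C(K, ℝ)) ∈ V := by
  refine hV.closure_subset (Metric.mem_closure_iff.2 fun ε hε => ?_)
  obtain ⟨p, hp⟩ := exists_polynomial_near_of_continuousOn (-‖u‖) ‖u‖ Real.exp
    Real.continuous_exp.continuousOn (ε / 2) (half_pos hε)
  refine ⟨Polynomial.aeval u p, ?_, ?_⟩
  · rw [Polynomial.aeval_eq_sum_range]
    exact V.sum_mem fun i _ => V.smul_mem _ (pow_mem_of_ridge_mem hV hρ hnp u hu i)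
  · refine lt_of_le_of_lt ((ContinuousMap.dist_le (half_pos hε).le).2 fun x => ?_) (half_lt_self hε)
    rw [Polynomial.aeval_continuousMap_apply, dist_comm, Real.dist_eq]
    exact (hp _ (abs_le.1 (u.norm_coe_le_norm x))).le

end Ridge

/-! ### Density of the network class -/

section Density

variable {ρ : ℝ → ℝ} {a d q : ℕ}

/-- Linear combinations of the ridge functions `x ↦ ρ (w · x + b)`. -/
def ridgeSpan (ρ : ℝ → ℝ) (a : ℕ) : Submodule ℝ ((Fin a → ℝ) → ℝ) :=
  Submodule.span ℝ (range fun p : (Fin a → ℝ) × ℝ => fun x => ρ (p.1 ⬝ᵥ x + p.2))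

theorem ridge_mem_ridgeSpan (w : Fin a → ℝ) (b : ℝ) :
    (fun x => ρ (w ⬝ᵥ x + b)) ∈ ridgeSpan ρ a :=
  Submodule.subset_span ⟨(w, b), rfl⟩

/-- One hidden layer suffices: its neurons are all the ridge functions that occur in some output
coordinate, and the output layer holds the coefficients. -/
theorem isFFN_of_mem_ridgeSpan {o : Type} [Finite o] {g : o → (Fin a → ℝ) → ℝ}
    (hg : ∀ j, g j ∈ ridgeSpan ρ a) : IsFFN ρ a (fun x j => g j x) := by
  classical
  have := Fintype.ofFinite o
  choose c hc using fun j => Finsupp.mem_span_range_iff_exists_finsupp.1 (hg j)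
  set s : Finset ((Fin a → ℝ) × ℝ) := Finset.univ.biUnion fun j => (c j).support with hs
  let e := s.equivFin
  convert IsFFN.hidden (ρ := ρ) (Matrix.of fun i => (e.symm i).1.1) (fun i => (e.symm i).1.2)
    (IsFFN.output (ρ := ρ) (Matrix.of fun j i => c j (e.symm i).1) (0 : o → ℝ)) using 3 with x j
  rw [← hc j, Finsupp.sum_of_support_subset (s := s)]
  · simp only [Finset.sum_apply, Pi.smul_apply, smul_eq_mul, add_zero, Matrix.mulVec, dotProduct,
      Matrix.of_apply]
    rw [← Finset.sum_coe_sort s, ← Equiv.sum_comp e.symm]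
    rfl
  · intro p hp
    exact Finset.mem_biUnion.2 ⟨j, Finset.mem_univ _, hp⟩
  · simp

/-- The span of the products `a(x) b(u)` of linear combinations of ridge functions. -/
def prodSpan (ρ : ℝ → ℝ) (d q : ℕ) : Submodule ℝ ((Fin d → ℝ) × (Fin q → ℝ) → ℝ) :=
  Submodule.span ℝ {h | ∃ g₁ ∈ ridgeSpan ρ d, ∃ g₂ ∈ ridgeSpan ρ q, h = fun z => g₁ z.1 * g₂ z.2}

/-- The factors are indexed by all of `ℕ` and vanish from `r` on, so that expansions of different
coordinates can be padded to a common number of terms. -/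
theorem exists_sum_of_mem_prodSpan {h : (Fin d → ℝ) × (Fin q → ℝ) → ℝ} (hh : h ∈ prodSpan ρ d q) :
    ∃ (r : ℕ) (g₁ : ℕ → (Fin d → ℝ) → ℝ) (g₂ : ℕ → (Fin q → ℝ) → ℝ),
      (∀ i, g₁ i ∈ ridgeSpan ρ d) ∧ (∀ i, g₂ i ∈ ridgeSpan ρ q) ∧ (∀ i, r ≤ i → g₁ i = 0) ∧
      ∀ z, h z = ∑ i ∈ Finset.range r, g₁ i z.1 * g₂ i z.2 := by
  induction hh using Submodule.span_induction with
  | mem h hh =>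
    obtain ⟨g₁, h₁, g₂, h₂, rfl⟩ := hh
    refine ⟨1, fun i => if i = 0 then g₁ else 0, fun _ => g₂, fun i => ?_, fun _ => h₂, ?_, ?_⟩
    · dsimp only
      split_ifs
      exacts [h₁, Submodule.zero_mem _]
    · intro i hi
      exact if_neg (by omega)
    · simp
  | zero => exact ⟨0, 0, 0, fun _ => Submodule.zero_mem _, fun _ => Submodule.zero_mem _,
      fun _ _ => rfl, by simp⟩
  | add h h' _ _ ih ih' =>
    obtain ⟨r, g₁, g₂, h1, h2, h3, h4⟩ := ih
    obtain ⟨r', g₁', g₂', h1', h2', h3', h4'⟩ := ih'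
    refine ⟨r + r', fun i => if i < r then g₁ i else g₁' (i - r),
      fun i => if i < r then g₂ i else g₂' (i - r), fun i => ?_, fun i => ?_, fun i hi => ?_, ?_⟩
    · dsimp only
      split_ifs
      exacts [h1 _, h1' _]
    · dsimp only
      split_ifs
      exacts [h2 _, h2' _]
    · exact (if_neg (by omega)).trans (h3' _ (by omega))
    · intro z
      rw [Pi.add_apply, h4, h4', Finset.sum_range_add]
      congr 1
      · refine Finset.sum_congr rfl fun i hi => ?_
        simp [Finset.mem_range.1 hi]
      · simp
  | smul c h _ ih =>
    obtain ⟨r, g₁, g₂, h1, h2, h3, h4⟩ := ih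
    refine ⟨r, fun i => c • g₁ i, g₂, fun i => Submodule.smul_mem _ _ (h1 i), h2, fun i hi => ?_,
      ?_⟩
    · simp [h3 i hi]
    · intro z
      rw [Pi.smul_apply, h4, Finset.smul_sum]
      simp [mul_assoc]

theorem exists_isCPFN_of_mem_prodSpan {h : Fin q → (Fin d → ℝ) × (Fin q → ℝ) → ℝ}
    (hh : ∀ j, h j ∈ prodSpan ρ d q) :
    ∃ φ : (Fin d → ℝ) → (Fin q → ℝ) → (Fin q → ℝ), IsCPFN ρ φ ∧ ∀ x u j, φ x u j = h j (x, u) := by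
  choose r g₁ g₂ h1 h2 h3 h4 using fun j => exists_sum_of_mem_prodSpan (hh j)
  -- A rank common to all coordinates; the `+ 1` guarantees the required rank of at least one.
  set R := Finset.univ.sup r + 1
  refine ⟨fun x u j => h j (x, u), ⟨R, by omega, fun x p => g₁ p.2 p.1 x, fun u p => g₂ p.2 p.1 u,
    isFFN_of_mem_ridgeSpan (g := fun p : Fin R × Fin q => g₁ p.2 p.1) fun p => h1 _ _,
    isFFN_of_mem_ridgeSpan (g := fun p : Fin R × Fin q => g₂ p.2 p.1) fun p => h2 _ _,
    fun x u j => ?_⟩, fun _ _ _ => rfl⟩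
  dsimp only
  rw [h4 j, Fin.sum_univ_eq_sum_range (fun i => g₁ j i x * g₂ j i u) R]
  refine Finset.sum_subset (fun i hi => ?_) (fun i _ hi => ?_)
  · have : r j ≤ Finset.univ.sup r := Finset.le_sup (Finset.mem_univ j)
    rw [Finset.mem_range] at hi ⊢
    omega
  · rw [h3 j i (by simpa using hi)]
    simp

/-! ### Exponentials and the Stone–Weierstrass theorem. -/

variable {K : Set ((Fin d → ℝ) × (Fin q → ℝ))}

/-- The exponential `z ↦ exp (w · z.1 + v · z.2)` on `K`. -/
def expLin (K : Set ((Fin d → ℝ) × (Fin q → ℝ))) (p : (Fin d → ℝ) × (Fin q → ℝ)) : C(K, ℝ) :=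
  ⟨fun z => Real.exp (p.1 ⬝ᵥ z.1.1 + p.2 ⬝ᵥ z.1.2), by
    simp only [dotProduct]; fun_prop⟩

theorem expLin_add (p p' : (Fin d → ℝ) × (Fin q → ℝ)) :
    expLin K (p + p') = expLin K p * expLin K p' := by
  ext z
  simp only [expLin, ContinuousMap.coe_mk, ContinuousMap.mul_apply, ← Real.exp_add, Prod.fst_add,
    Prod.snd_add, add_dotProduct]
  ring_nf

theorem expLin_zero : expLin K 0 = 1 := by
  ext z
  simp [expLin]

/-- Exponentials are closed under multiplication, so the algebra they generate is already their
linear span. Stone–Weierstrass, a statement about algebras, thereby applies to sums of products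
without multiplying networks. -/
theorem toSubmodule_adjoin_expLin :
    Subalgebra.toSubmodule (Algebra.adjoin ℝ (range (expLin K))) =
      Submodule.span ℝ (range (expLin K)) := by
  let M : Submonoid C(K, ℝ) :=
    { carrier := range (expLin K)
      one_mem' := ⟨0, expLin_zero⟩
      mul_mem' := by
        rintro _ _ ⟨p, rfl⟩ ⟨p', rfl⟩
        exact ⟨p + p', expLin_add p p'⟩ }
  rw [Algebra.adjoin_eq_span]
  have : Submonoid.closure (range (expLin K)) = M := Submonoid.closure_eq M
  rw [this]
  rfl

theorem adjoin_expLin_separatesPoints :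
    (Algebra.adjoin ℝ (range (expLin K))).SeparatesPoints := by
  intro z z' hzz'
  by_contra! hcon
  have key : ∀ p, expLin K p z = expLin K p z' := fun p =>
    hcon _ ⟨expLin K p, Algebra.subset_adjoin ⟨p, rfl⟩, rfl⟩
  apply hzz'
  refine Subtype.ext (Prod.ext (funext fun i => ?_) (funext fun i => ?_))
  · simpa [expLin] using key (Pi.single i 1, 0)
  · simpa [expLin] using key (0, Pi.single i 1)

/-- The continuous functions on `K` which are restrictions of elements of `prodSpan`. -/
def prodSpanOn (ρ : ℝ → ℝ) (K : Set ((Fin d → ℝ) × (Fin q → ℝ))) : Submodule ℝ C(K, ℝ) :=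
  ((prodSpan ρ d q).map (LinearMap.funLeft ℝ ℝ (Subtype.val : K → _))).comap
    (ContinuousMap.coeFnLinearMap ℝ)

theorem mem_prodSpanOn {h : C(K, ℝ)} :
    h ∈ prodSpanOn ρ K ↔ ∃ g ∈ prodSpan ρ d q, ∀ z : K, h z = g z := by
  simp only [prodSpanOn, Submodule.mem_comap, Submodule.mem_map]
  refine exists_congr fun g => and_congr_right fun _ => ?_
  rw [eq_comm, funext_iff]
  rfl

/-- The one-variable result is applied to the preimage of `W` under multiplication by `h`, again a
closed subspace. This exchanges a single factor of a product. -/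
theorem mul_exp_comp_mem_of_mul_ridge_mem {Z : Type*} [TopologicalSpace Z] [CompactSpace Z]
    {W : Submodule ℝ C(Z, ℝ)} (hW : IsClosed (W : Set C(Z, ℝ))) (hρ : Continuous ρ)
    (hnp : ¬ ∃ p : Polynomial ℝ, ∀ t, ρ t = p.eval t) (h u : C(Z, ℝ))
    (hu : ∀ c b, h * ridge ⟨ρ, hρ⟩ u c b ∈ W) :
    h * (⟨fun x => Real.exp (u x), by fun_prop⟩ : C(Z, ℝ)) ∈ W := by
  let V : Submodule ℝ C(Z, ℝ) := W.comap (LinearMap.mulLeft ℝ h)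
  have hV : IsClosed (V : Set C(Z, ℝ)) := hW.preimage (continuous_const.mul continuous_id)
  exact exp_comp_mem_of_ridge_mem hV hρ hnp u hu

theorem ridge_mul_ridge_mem_prodSpanOn (hρ : Continuous ρ) (w : Fin d → ℝ) (v : Fin q → ℝ)
    {u₁ u₂ : C(K, ℝ)} (h₁ : ∀ z, u₁ z = w ⬝ᵥ z.1.1) (h₂ : ∀ z, u₂ z = v ⬝ᵥ z.1.2) (c b c' b' : ℝ) :
    ridge ⟨ρ, hρ⟩ u₁ c b * ridge ⟨ρ, hρ⟩ u₂ c' b' ∈ prodSpanOn ρ K := by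
  refine mem_prodSpanOn.2 ⟨_, Submodule.subset_span
    ⟨_, ridge_mem_ridgeSpan (c • w) b, _, ridge_mem_ridgeSpan (c' • v) b', rfl⟩, fun z => ?_⟩
  simp [h₁, h₂]

variable [CompactSpace K]

/-- The exponential splits into a function of `x` times a function of `u`. Starting from a product
of two ridge functions, the factors are exchanged for exponentials one after the other. -/
theorem expLin_mem_topologicalClosure (hρ : Continuous ρ)
    (hnp : ¬ ∃ p : Polynomial ℝ, ∀ t, ρ t = p.eval t) (p : (Fin d → ℝ) × (Fin q → ℝ)) :
    expLin K p ∈ (prodSpanOn ρ K).topologicalClosure := by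
  have hWc : IsClosed ((prodSpanOn ρ K).topologicalClosure : Set C(K, ℝ)) :=
    Submodule.isClosed_topologicalClosure _
  obtain ⟨u₁, hu₁⟩ : ∃ u : C(K, ℝ), ∀ z, u z = p.1 ⬝ᵥ z.1.1 :=
    ⟨⟨fun z => p.1 ⬝ᵥ z.1.1, by simp only [dotProduct]; fun_prop⟩, fun _ => rfl⟩
  obtain ⟨u₂, hu₂⟩ : ∃ u : C(K, ℝ), ∀ z, u z = p.2 ⬝ᵥ z.1.2 :=
    ⟨⟨fun z => p.2 ⬝ᵥ z.1.2, by simp only [dotProduct]; fun_prop⟩, fun _ => rfl⟩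
  have h2 := fun c b => mul_exp_comp_mem_of_mul_ridge_mem hWc hρ hnp _ u₂ fun c' b' =>
    Submodule.le_topologicalClosure _ (ridge_mul_ridge_mem_prodSpanOn hρ p.1 p.2 hu₁ hu₂ c b c' b')
  have h3 := mul_exp_comp_mem_of_mul_ridge_mem hWc hρ hnp
    (⟨fun x => Real.exp (u₂ x), by fun_prop⟩ : C(K, ℝ)) u₁
    (fun c b => by rw [mul_comm]; exact h2 c b)
  have h4 : expLin K p = (⟨fun x => Real.exp (u₂ x), by fun_prop⟩ : C(K, ℝ)) *
      (⟨fun x => Real.exp (u₁ x), by fun_prop⟩ : C(K, ℝ)) := by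
    ext z
    simp [expLin, hu₁, hu₂, Real.exp_add, mul_comm]
  rw [h4]
  exact h3

theorem topologicalClosure_prodSpanOn (hρ : Continuous ρ)
    (hnp : ¬ ∃ p : Polynomial ℝ, ∀ t, ρ t = p.eval t) :
    (prodSpanOn ρ K).topologicalClosure = ⊤ := by
  have h1 := ContinuousMap.subalgebra_topologicalClosure_eq_top_of_separatesPoints _
    (adjoin_expLin_separatesPoints (K := K))
  have h2 : Subalgebra.toSubmodule (Algebra.adjoin ℝ (range (expLin K))) ≤
      (prodSpanOn ρ K).topologicalClosure := by
    rw [toSubmodule_adjoin_expLin, Submodule.span_le]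
    rintro _ ⟨p, rfl⟩
    exact expLin_mem_topologicalClosure hρ hnp p
  rw [eq_top_iff]
  intro h _
  have h3 : h ∈ (Algebra.adjoin ℝ (range (expLin K))).topologicalClosure := by
    rw [h1]; trivial
  exact closure_minimal h2 (Submodule.isClosed_topologicalClosure _) h3

end Density

/-- Networks approximate continuous functions uniformly on compact sets. -/
theorem exists_mem_prodSpan_forall_abs_sub_le {ρ : ℝ → ℝ} {d q : ℕ} (hρ : Continuous ρ)
    (hnp : ¬ ∃ p : Polynomial ℝ, ∀ t, ρ t = p.eval t) {K : Set ((Fin d → ℝ) × (Fin q → ℝ))}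
    (hK : IsCompact K) {h : (Fin d → ℝ) × (Fin q → ℝ) → ℝ} (hh : Continuous h) {η : ℝ}
    (hη : 0 < η) :
    ∃ g ∈ prodSpan ρ d q, ∀ z ∈ K, |h z - g z| ≤ η := by
  have := isCompact_iff_compactSpace.1 hK
  let H : C(K, ℝ) := ⟨fun z => h z, by fun_prop⟩
  have hH : H ∈ (prodSpanOn ρ K).topologicalClosure := by
    rw [topologicalClosure_prodSpanOn hρ hnp]; trivial
  obtain ⟨G, hG, hdist⟩ := Metric.mem_closure_iff.1 hH η hη
  obtain ⟨g, hg, hGg⟩ := mem_prodSpanOn.1 hG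
  refine ⟨g, hg, fun z hz => ?_⟩
  have := (ContinuousMap.dist_apply_le_dist (f := H) (g := G) ⟨z, hz⟩).trans hdist.le
  rwa [Real.dist_eq, hGg] at this

/-- Networks approximate bounded measurable maps in `L¹` of a finite compactly supported measure. -/
theorem exists_isCPFN_integral_abs_sub_le {ρ : ℝ → ℝ} {d q : ℕ} (hρ : Continuous ρ)
    (hnp : ¬ ∃ p : Polynomial ℝ, ∀ t, ρ t = p.eval t) {K : Set ((Fin d → ℝ) × (Fin q → ℝ))}
    (hK : IsCompact K) (m : Measure ((Fin d → ℝ) × (Fin q → ℝ))) [IsFiniteMeasure m]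
    (hm : ∀ᵐ z ∂m, z ∈ K) {T : (Fin d → ℝ) × (Fin q → ℝ) → Fin q → ℝ}
    (hT : ∀ j, Integrable (fun z => T z j) m) {η : ℝ} (hη : 0 < η) :
    ∃ φ : (Fin d → ℝ) → (Fin q → ℝ) → (Fin q → ℝ), IsCPFN ρ φ ∧
      ∀ j, Integrable (fun z => φ z.1 z.2 j) m ∧ ∫ z, |T z j - φ z.1 z.2 j| ∂m ≤ η := by
  have key : ∀ j, ∃ g ∈ prodSpan ρ d q, Integrable g m ∧ ∫ z, |T z j - g z| ∂m ≤ η := by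
    intro j
    -- Half of the tolerance goes to a continuous approximation in `L¹`, the other half to its
    -- uniform approximation on `K`. The latter is scaled by the total mass `c`, with `+ 1` in case
    -- `m = 0`.
    obtain ⟨h, -, hint, hc, hhi⟩ := (hT j).exists_hasCompactSupport_integral_sub_le (half_pos hη)
    set c : ℝ := m.real univ
    have hc0 : 0 ≤ c := measureReal_nonneg
    obtain ⟨g, hg, hgK⟩ := exists_mem_prodSpan_forall_abs_sub_le hρ hnp hK hc
      (η := η / 2 / (c + 1)) (by positivity)
    have hgm : Continuous g := by
      obtain ⟨r, g₁, g₂, h1, h2, -, h4⟩ := exists_sum_of_mem_prodSpan hg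
      have hcont : ∀ (a : ℕ) (g : (Fin a → ℝ) → ℝ), g ∈ ridgeSpan ρ a → Continuous g := by
        intro a g hg
        induction hg using Submodule.span_induction with
        | mem g hg =>
          obtain ⟨p, rfl⟩ := hg
          simp only [dotProduct]
          fun_prop
        | zero => exact continuous_zero
        | add _ _ _ _ h h' => exact h.add h'
        | smul c _ _ h => exact h.const_smul c
      rw [funext h4]
      exact continuous_finsetSum _ fun i _ => ((hcont _ _ (h1 i)).comp continuous_fst).mul
        ((hcont _ _ (h2 i)).comp continuous_snd)
    have hdi : Integrable (fun z => h z - g z) m :=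
      Integrable.of_bound (hc.sub hgm).aestronglyMeasurable (η / 2 / (c + 1))
        (hm.mono fun z hz => hgK z hz)
    have hgi : Integrable g m := by
      have := hhi.sub hdi
      refine this.congr (Eventually.of_forall fun z => ?_)
      simp
    refine ⟨g, hg, hgi, ?_⟩
    calc ∫ z, |T z j - g z| ∂m ≤ ∫ z, (‖T z j - h z‖ + |h z - g z|) ∂m := by
          refine integral_mono ((hT j).sub hgi).abs (((hT j).sub hhi).norm.add hdi.abs) fun z => ?_
          exact abs_sub_le _ _ _
      _ = ∫ z, ‖T z j - h z‖ ∂m + ∫ z, |h z - g z| ∂m :=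
          integral_add ((hT j).sub hhi).norm hdi.abs
      _ ≤ η / 2 + ∫ z, η / 2 / (c + 1) ∂m := by
          refine add_le_add hint (integral_mono_ae hdi.abs (integrable_const _) ?_)
          exact hm.mono fun z hz => hgK z hz
      _ ≤ η / 2 + η / 2 := by
          rw [integral_const, smul_eq_mul, mul_div_assoc']
          change η / 2 + c * (η / 2) / (c + 1) ≤ η / 2 + η / 2
          have h2 : c * (η / 2) ≤ η / 2 * (c + 1) := by nlinarith
          have h3 : c * (η / 2) / (c + 1) ≤ η / 2 := (div_le_iff₀ (by positivity)).2 h2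
          linarith
      _ = η := by ring
  choose g hg hgi hgη using key
  obtain ⟨φ, hφ, hφe⟩ := exists_isCPFN_of_mem_prodSpan hg
  exact ⟨φ, hφ, fun j => by simpa only [hφe] using ⟨hgi j, hgη j⟩⟩

/-! ### The `C^k` norm -/

section CkNorm

variable {ι : Type} [Fintype ι]

theorem abs_sub_le_euclDist (a b : ι → ℝ) (i : ι) : |a i - b i| ≤ euclDist a b := by
  rw [euclDist, ← Real.sqrt_sq_eq_abs]
  exact Real.sqrt_le_sqrt (Finset.single_le_sum (f := fun i => (a i - b i) ^ 2)
    (fun i _ => sq_nonneg _) (Finset.mem_univ i))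

theorem euclDist_nonneg (a b : ι → ℝ) : 0 ≤ euclDist a b := Real.sqrt_nonneg _

theorem norm_sub_le_euclDist (a b : ι → ℝ) : ‖a - b‖ ≤ euclDist a b :=
  (pi_norm_le_iff_of_nonneg (euclDist_nonneg a b)).2 fun i => abs_sub_le_euclDist a b i

variable [DecidableEq ι]

theorem norm_apply_single_le {m : ℕ}
    (L : ContinuousMultilinearMap ℝ (fun _ : Fin m => ι → ℝ) ℝ) (s : Fin m → ι) :
    |L (fun j => Pi.single (s j) (1 : ℝ))| ≤ ‖L‖ := by
  refine (L.le_opNorm _).trans ?_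
  simp [Pi.norm_single]

theorem partialD_sum_mul {r m : ℕ} {g : Fin r → (ι → ℝ) → ℝ} (hg : ∀ i, ContDiff ℝ m (g i))
    (c : Fin r → ℝ) (s : Fin m → ι) (a : ι → ℝ) :
    partialD s (fun x => ∑ i, g i x * c i) a = ∑ i, partialD s (g i) a * c i := by
  have h1 : (fun x => ∑ i, g i x * c i) = fun x => ∑ i, (c i • g i) x := by
    ext x
    simp [mul_comm]
  unfold partialD
  rw [h1, iteratedFDeriv_fun_sum_apply (f := fun i => c i • g i) fun i _ =>
    ((hg i).const_smul (c i)).contDiffAt]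
  simp only [sum_apply]
  refine Finset.sum_congr rfl fun i _ => ?_
  rw [iteratedFDeriv_const_smul_apply (hg i).contDiffAt]
  simp [mul_comm]

/-- Uniform bounds for the derivatives of a `C^k` function on a bounded convex set. -/
theorem exists_bound_partialD {k : ℕ} (hk : 1 ≤ k) {g : (ι → ℝ) → ℝ} (hg : ContDiff ℝ k g)
    {K : Set (ι → ℝ)} (hK : IsCompact K) (hKc : Convex ℝ K) :
    ∃ C, 0 ≤ C ∧ (∀ m ≤ k - 1, ∀ s : Fin m → ι, ∀ a ∈ K, |partialD s g a| ≤ C) ∧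
      ∀ s : Fin (k - 1) → ι, ∀ a ∈ K, ∀ b ∈ K,
        |partialD s g a - partialD s g b| ≤ C * euclDist a b := by
  have h1 : ∀ m : ℕ, ∃ C, m ≤ k - 1 → ∀ a ∈ K, ‖iteratedFDeriv ℝ m g a‖ ≤ C := by
    intro m
    by_cases hm : m ≤ k - 1
    · obtain ⟨C, hC⟩ := hK.exists_bound_of_continuousOn
        (hg.continuous_iteratedFDeriv (m := m)
          (by exact_mod_cast hm.trans (Nat.sub_le _ _))).continuousOn
      exact ⟨C, fun _ => hC⟩
    · exact ⟨0, fun h => absurd h hm⟩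
  choose C hC using h1
  have h2 : ContDiff ℝ 1 (iteratedFDeriv ℝ (k - 1) g) := by
    refine hg.iteratedFDeriv_right ?_
    have : 1 + (k - 1) = k := by omega
    exact_mod_cast this.le
  obtain ⟨L, hL⟩ := hK.exists_bound_of_continuousOn
    (h2.continuous_fderiv (by simp)).continuousOn
  have hsum : ∀ m ≤ k - 1, C m ≤ ∑ i ∈ Finset.range k, |C i| := fun m hm =>
    (le_abs_self _).trans (Finset.single_le_sum (f := fun i => |C i|) (fun i _ => abs_nonneg _)
      (Finset.mem_range.2 (by omega)))
  have hsum0 : 0 ≤ ∑ i ∈ Finset.range k, |C i| := Finset.sum_nonneg fun i _ => abs_nonneg _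
  refine ⟨∑ i ∈ Finset.range k, |C i| + |L|, by positivity, fun m hm s a ha => ?_,
    fun s a ha b hb => ?_⟩
  · refine (norm_apply_single_le _ s).trans ((hC m hm a ha).trans ((hsum m hm).trans ?_))
    linarith [abs_nonneg L]
  · have h3 := hKc.norm_image_sub_le_of_norm_fderiv_le
      (fun x _ => h2.differentiable (by simp) x) hL hb ha
    have h4 : partialD s g a - partialD s g b =
        (iteratedFDeriv ℝ (k - 1) g a - iteratedFDeriv ℝ (k - 1) g b)
          (fun j => Pi.single (s j) (1 : ℝ)) := by
      simp [partialD]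
    rw [h4]
    refine (norm_apply_single_le _ s).trans (h3.trans ?_)
    refine mul_le_mul ?_ (norm_sub_le_euclDist a b) (norm_nonneg _) (by positivity)
    linarith [le_abs_self L]

/-- Linear combinations with bounded coefficients of `C^k` functions are bounded in `C^k(K)`. -/
theorem exists_ckNorm_sum_mul_le {k r : ℕ} (hk : 1 ≤ k) {g : Fin r → (ι → ℝ) → ℝ}
    (hg : ∀ i, ContDiff ℝ k (g i)) {K : Set (ι → ℝ)} (hK : IsCompact K) (hKc : Convex ℝ K)
    (B : ℝ) :
    ∃ C : ℝ≥0∞, C < ⊤ ∧ ∀ c : Fin r → ℝ, (∀ i, |c i| ≤ B) →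
      ckNorm k K (fun x => ∑ i, g i x * c i) ≤ C := by
  choose C hC0 hC1 hC2 using fun i => exists_bound_partialD hk (hg i) hK hKc
  refine ⟨ENNReal.ofReal (∑ i, C i * B) + ENNReal.ofReal (∑ i, C i * B),
    ENNReal.add_lt_top.2 ⟨ENNReal.ofReal_lt_top, ENNReal.ofReal_lt_top⟩, fun c hc => ?_⟩
  have hle : ∀ m : ℕ, m ≤ k - 1 → ((m : ℕ) : ℕ∞ω) ≤ k := fun m hm => by
    exact_mod_cast hm.trans (Nat.sub_le _ _)
  refine add_le_add ?_ ?_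
  · refine iSup_le fun m => iSup_le fun hm => iSup_le fun s => iSup₂_le fun a ha => ?_
    refine ENNReal.ofReal_le_ofReal ?_
    rw [partialD_sum_mul fun i => (hg i).of_le (hle m hm)]
    refine (Finset.abs_sum_le_sum_abs _ _).trans (Finset.sum_le_sum fun i _ => ?_)
    rw [abs_mul]
    exact mul_le_mul (hC1 i m hm s a (interior_subset ha)) (hc i) (abs_nonneg _) (hC0 i)
  · refine iSup_le fun s => iSup₂_le fun a ha => iSup₂_le fun b hb => iSup_le fun hab => ?_
    refine ENNReal.ofReal_le_ofReal ?_
    have hpos : 0 < euclDist a b := by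
      refine lt_of_lt_of_le ?_ (norm_sub_le_euclDist a b)
      rwa [norm_pos_iff, sub_ne_zero]
    rw [div_le_iff₀ hpos, partialD_sum_mul fun i => (hg i).of_le (hle _ le_rfl),
      partialD_sum_mul fun i => (hg i).of_le (hle _ le_rfl), ← Finset.sum_sub_distrib,
      Finset.sum_mul]
    refine (Finset.abs_sum_le_sum_abs _ _).trans (Finset.sum_le_sum fun i _ => ?_)
    rw [← sub_mul, abs_mul, mul_right_comm]
    exact mul_le_mul (hC2 i s a (interior_subset ha) b (interior_subset hb)) (hc i) (abs_nonneg _)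
      (mul_nonneg (hC0 i) hpos.le)

/-- Functions with finite `C^k` norm, `k ≥ 2`, are Lipschitz on convex sets. -/
theorem edist_le_ckNorm_mul {k : ℕ} (hk : 2 ≤ k) {K : Set (ι → ℝ)} (hKc : Convex ℝ K)
    (hKi : (interior K).Nonempty) {g : (ι → ℝ) → ℝ} (hg : ContinuousOn g K)
    (hgd : DifferentiableOn ℝ g (interior K)) {a b : ι → ℝ} (ha : a ∈ K) (hb : b ∈ K) :
    edist (g a) (g b) ≤ Fintype.card ι * ckNorm k K g * edist a b := by
  by_cases hab : a = b
  · simp [hab]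
  by_cases hN : ckNorm k K g = ⊤
  -- For an infinite norm the right side is `∞` only because both other factors are nonzero; `a ≠ b`
  -- also forces `ι` to be nonempty.
  · have : Nonempty ι := by
      by_contra hne
      rw [not_nonempty_iff] at hne
      exact hab (Subsingleton.elim _ _)
    rw [hN, ENNReal.mul_top (by simp), ENNReal.top_mul (by simpa using hab)]
    exact le_top
  set N : ℝ := (ckNorm k K g).toReal
  have hN0 : 0 ≤ N := ENNReal.toReal_nonneg
  have hNe : ckNorm k K g = ENNReal.ofReal N := (ENNReal.ofReal_toReal hN).symm
  have h1 : ∀ x ∈ interior K, ∀ i, |fderiv ℝ g x (Pi.single i 1)| ≤ N := by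
    intro x hx i
    have h2 : ENNReal.ofReal |partialD (fun _ : Fin 1 => i) g x| ≤ ckNorm k K g := by
      refine le_trans ?_ (le_add_right le_rfl)
      -- First derivatives appear in the norm because `1 ≤ k - 1`.
      exact le_iSup_of_le 1 (le_iSup_of_le (by omega) (le_iSup_of_le (fun _ : Fin 1 => i)
        (le_iSup₂_of_le x hx le_rfl)))
    rw [hNe, ENNReal.ofReal_le_ofReal_iff hN0] at h2
    rwa [partialD, iteratedFDeriv_one_apply] at h2
  have h3 : ∀ x ∈ interior K, ‖fderiv ℝ g x‖ ≤ Fintype.card ι * N := by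
    intro x hx
    refine ContinuousLinearMap.opNorm_le_bound _ (by positivity) fun v => ?_
    have hv : v = ∑ i, v i • (Pi.single i (1 : ℝ) : ι → ℝ) := (pi_eq_sum_univ' v)
    conv_lhs => rw [hv]
    rw [map_sum]
    refine (norm_sum_le _ _).trans ?_
    have : ∀ i ∈ Finset.univ, ‖fderiv ℝ g x (v i • (Pi.single i (1 : ℝ) : ι → ℝ))‖ ≤ N * ‖v‖ := by
      intro i _
      rw [map_smul, norm_smul, mul_comm]
      exact mul_le_mul (h1 x hx i) (norm_le_pi_norm v i) (norm_nonneg _) hN0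
    refine (Finset.sum_le_sum this).trans ?_
    simp [mul_assoc]
  have hL : LipschitzOnWith (Real.toNNReal (Fintype.card ι * N)) g (interior K) := by
    refine LipschitzOnWith.of_dist_le_mul fun x hx y hy => ?_
    rw [Real.coe_toNNReal _ (by positivity), dist_eq_norm, dist_eq_norm]
    exact hKc.interior.norm_image_sub_le_of_norm_fderiv_le
      (fun z hz => hgd.differentiableAt (isOpen_interior.mem_nhds hz)) h3 hy hx
  -- The interior of a convex body is dense in it, so the Lipschitz bound extends to the boundary by
  -- continuity.
  have hsub : K ⊆ closure (interior K) := by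
    rw [hKc.closure_interior_eq_closure_of_nonempty_interior hKi]
    exact subset_closure
  have hL2 : LipschitzOnWith (Real.toNNReal (Fintype.card ι * N)) g K := by
    intro x hx y hy
    have hlim : ∀ z ∈ K, (𝓝[interior K] z).NeBot ∧ Tendsto g (𝓝[interior K] z) (𝓝 (g z)) :=
      fun z hz => ⟨mem_closure_iff_nhdsWithin_neBot.1 (hsub hz),
        (hg z hz).mono_left (nhdsWithin_mono _ interior_subset)⟩
    obtain ⟨hx1, hx2⟩ := hlim x hx
    obtain ⟨hy1, hy2⟩ := hlim y hy
    have ht : Tendsto (fun p : (ι → ℝ) × (ι → ℝ) => edist (g p.1) (g p.2))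
        (𝓝[interior K] x ×ˢ 𝓝[interior K] y) (𝓝 (edist (g x) (g y))) :=
      (hx2.comp tendsto_fst).edist (hy2.comp tendsto_snd)
    have ht2 : Tendsto (fun p : (ι → ℝ) × (ι → ℝ) =>
        (Real.toNNReal (Fintype.card ι * N) : ℝ≥0∞) * edist p.1 p.2)
        (𝓝[interior K] x ×ˢ 𝓝[interior K] y)
        (𝓝 ((Real.toNNReal (Fintype.card ι * N) : ℝ≥0∞) * edist x y)) :=
      ENNReal.Tendsto.const_mul (((tendsto_id.mono_left nhdsWithin_le_nhds).comp tendsto_fst).edist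
        ((tendsto_id.mono_left nhdsWithin_le_nhds).comp tendsto_snd)) (Or.inr ENNReal.coe_ne_top)
    refine le_of_tendsto_of_tendsto ht ht2 ?_
    filter_upwards [prod_mem_prod (self_mem_nhdsWithin (a := x) (s := interior K))
      (self_mem_nhdsWithin (a := y) (s := interior K))] with p hp
    exact hL hp.1 hp.2
  refine (hL2 ha hb).trans (mul_le_mul_left ?_ _)
  rw [hNe, ← ENNReal.ofReal_natCast, ← ENNReal.ofReal_mul (by positivity)]
  rfl

end CkNorm

/-! ### Regularity of networks -/

section Networks

variable {ρ : ℝ → ℝ} {d q k : ℕ}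

theorem IsFFN.contDiff {o : Type} [Fintype o] {n : ℕ∞ω} (hρ : ContDiff ℝ n ρ) {a : ℕ}
    {g : (Fin a → ℝ) → (o → ℝ)} (hg : IsFFN ρ a g) : ContDiff ℝ n g := by
  induction hg with
  | output W b => exact (Matrix.mulVecLin W).toContinuousLinearMap.contDiff.add contDiff_const
  | hidden W b _ ih =>
    refine ih.comp (contDiff_pi.2 fun i => hρ.comp ?_)
    exact (contDiff_pi.1 ((Matrix.mulVecLin W).toContinuousLinearMap.contDiff.add
      (contDiff_const (c := b)))) i

theorem IsCPFN.continuous {φ : (Fin d → ℝ) → (Fin q → ℝ) → (Fin q → ℝ)} (hφ : IsCPFN ρ φ)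
    (hρ : Continuous ρ) : Continuous fun z : (Fin d → ℝ) × (Fin q → ℝ) => φ z.1 z.2 := by
  obtain ⟨r, -, Φ, Ψ, hΦ, hΨ, h⟩ := hφ
  have h1 : Continuous Φ := (hΦ.contDiff (n := 0) (contDiff_zero.2 hρ)).continuous
  have h2 : Continuous Ψ := (hΨ.contDiff (n := 0) (contDiff_zero.2 hρ)).continuous
  refine continuous_pi fun j => ?_
  simp only [h]
  refine continuous_finsetSum _ fun i _ => ?_
  exact (((continuous_apply _).comp h1).comp continuous_fst).mul
    (((continuous_apply _).comp h2).comp continuous_snd)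

theorem IsCPFN.contDiff_left {φ : (Fin d → ℝ) → (Fin q → ℝ) → (Fin q → ℝ)} (hφ : IsCPFN ρ φ)
    {n : ℕ∞ω} (hρ : ContDiff ℝ n ρ) (u : Fin q → ℝ) (j : Fin q) :
    ContDiff ℝ n fun x => φ x u j := by
  obtain ⟨r, -, Φ, Ψ, hΦ, hΨ, h⟩ := hφ
  simp only [h]
  exact ContDiff.sum fun i _ => (contDiff_pi.1 (hΦ.contDiff hρ) _).mul contDiff_const

theorem volume_cube : volume (cube q) = 1 := by
  simp [cube, Real.volume_Icc_pi]

instance : IsProbabilityMeasure (volume.restrict (cube q)) :=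
  ⟨by simp [volume_cube]⟩

/-- Every network has finite norm, hence belongs to `hypClass` for large `M`. -/
theorem IsCPFN.lintegral_ckNormVec_lt_top {φ : (Fin d → ℝ) → (Fin q → ℝ) → (Fin q → ℝ)}
    (hφ : IsCPFN ρ φ) (hk : 1 ≤ k) (hρ : ContDiff ℝ k ρ) {K : Set (Fin d → ℝ)} (hK : IsCompact K)
    (hKc : Convex ℝ K) : ∫⁻ u in cube q, ckNormVec k K (fun x => φ x u) < ⊤ := by
  obtain ⟨r, -, Φ, Ψ, hΦ, hΨ, h⟩ := hφ
  obtain ⟨B, hB⟩ := (isCompact_Icc : IsCompact (cube q)).exists_bound_of_continuousOn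
    (hΨ.contDiff hρ).continuous.continuousOn
  choose C hC1 hC2 using fun j : Fin q => exists_ckNorm_sum_mul_le (r := r) hk
    (fun i => contDiff_pi.1 (hΦ.contDiff hρ) (i, j)) hK hKc B
  have hb : ∀ u ∈ cube q, ckNormVec k K (fun x => φ x u) ≤ ∑ j, C j := by
    intro u hu
    refine Finset.sum_le_sum fun j _ => ?_
    simp only [h]
    exact hC2 j _ fun i => (norm_le_pi_norm (Ψ u) (i, j)).trans (hB u hu)
  calc ∫⁻ u in cube q, ckNormVec k K (fun x => φ x u) ≤ ∫⁻ u in cube q, ∑ j, C j :=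
        setLIntegral_mono measurable_const hb
    _ < ⊤ := by
        rw [setLIntegral_const, volume_cube, mul_one]
        exact ENNReal.sum_lt_top.2 fun j _ => hC1 j

/-- Members of `hypClass` are Lipschitz in `x`, on average over `u`. -/
theorem lintegral_edist_le_of_mem_hypClass {φ : (Fin d → ℝ) → (Fin q → ℝ) → (Fin q → ℝ)}
    (hk : 2 ≤ k) (hρ : ContDiff ℝ k ρ) {K : Set (Fin d → ℝ)} (hKc : Convex ℝ K)
    (hKi : (interior K).Nonempty) {M : ℝ} (hφ : φ ∈ hypClass ρ k K M) {x x' : Fin d → ℝ}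
    (hx : x ∈ K) (hx' : x' ∈ K) :
    ∫⁻ u in cube q, edist (φ x u) (φ x' u) ≤ d * ENNReal.ofReal M * edist x x' := by
  have hpt : ∀ u, edist (φ x u) (φ x' u) ≤
      d * edist x x' * ckNormVec k K (fun x => φ x u) := by
    intro u
    refine edist_pi_le_iff.2 fun j => ?_
    have hc := hφ.1.contDiff_left hρ u j
    have h1 := edist_le_ckNorm_mul hk hKc hKi hc.continuous.continuousOn
      ((hc.differentiable (by exact_mod_cast (by omega : k ≠ 0))).differentiableOn) hx hx'
    refine h1.trans ?_
    rw [Fintype.card_fin, mul_right_comm]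
    gcongr
    exact Finset.single_le_sum (f := fun j => ckNorm k K (fun x => φ x u j)) (fun _ _ => zero_le)
      (Finset.mem_univ j)
  calc ∫⁻ u in cube q, edist (φ x u) (φ x' u)
      ≤ ∫⁻ u in cube q, d * edist x x' * ckNormVec k K (fun x => φ x u) := lintegral_mono hpt
    -- Since the constant is finite, it leaves the integral without any measurability of the `C^k`
    -- norm in `u`.
    _ = d * edist x x' * ∫⁻ u in cube q, ckNormVec k K (fun x => φ x u) :=
        lintegral_const_mul' _ _ (ENNReal.mul_ne_top (ENNReal.natCast_ne_top d) (edist_ne_top _ _))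
    _ ≤ d * edist x x' * ENNReal.ofReal M := by
        gcongr
        exact hφ.2.le
    _ = d * ENNReal.ofReal M * edist x x' := by ring

end Networks

end Smooth

/-! ### A uniform law of large numbers for bounded Lipschitz functions -/

section UniformLaw

variable {Z : Type*} [MeasurableSpace Z] {Ω : Type*} [MeasurableSpace Ω] {P : Measure Ω}
    [IsProbabilityMeasure P]
  {z : ℕ → Ω → Z} {W : Ω → Z}

theorem ae_tendsto_frequency (hW : Measurable W) (hindep : iIndepFun z P)
    (hident : ∀ i, IdentDistrib (z i) W P P) {A : Set Z} (hA : MeasurableSet A) :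
    ∀ᵐ ω ∂P, Tendsto
      (fun n : ℕ => (∑ i ∈ Finset.range n, A.indicator (fun _ => (1 : ℝ)) (z i ω)) / n)
      atTop (𝓝 ((P.map W).real A)) := by
  have hm : Measurable (A.indicator fun _ => (1 : ℝ)) := measurable_const.indicator hA
  have hid : ∀ i, IdentDistrib (fun ω => A.indicator (fun _ => (1 : ℝ)) (z i ω))
      (fun ω => A.indicator (fun _ => (1 : ℝ)) (W ω)) P P := fun i => (hident i).comp hm
  have h := strong_law_ae_real (fun i ω => A.indicator (fun _ => (1 : ℝ)) (z i ω))
    ((hid 0).integrable_iff.2 (Integrable.of_bound (hm.comp hW).aestronglyMeasurable 1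
      (Eventually.of_forall fun ω => by
        simp only [indicator]; split_ifs <;> simp)))
    (fun i j hij => (hindep.indepFun hij).comp hm hm)
    (fun i => (hid i).trans (hid 0).symm)
  have hE : P[fun ω => A.indicator (fun _ => (1 : ℝ)) (z 0 ω)] = (P.map W).real A := by
    rw [(hid 0).integral_eq, ← integral_map hW.aemeasurable hm.aestronglyMeasurable,
      integral_indicator hA]
    simp
  rwa [hE] at h

variable [MetricSpace Z] [BorelSpace Z]

/-- A nearest-point map to a finite net. Its values lie in `S` even at points outside `S`, so bounds
valid on `S` hold for every composition with it. -/
theorem exists_simpleFunc_dist_le {S : Set Z} (hS : IsCompact S) (hne : S.Nonempty) {e : ℝ}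
    (he : 0 < e) : ∃ π : SimpleFunc Z Z, (∀ z, π z ∈ S) ∧ ∀ z ∈ S, dist (π z) z ≤ e := by
  obtain ⟨t, htS, htf, hcov⟩ := hS.finite_cover_balls he
  have htne : t.Nonempty := by
    obtain ⟨z, hz⟩ := hne
    obtain ⟨x, hx, -⟩ := mem_iUnion₂.1 (hcov hz)
    exact ⟨x, hx⟩
  obtain ⟨f, hf⟩ := htf.countable.exists_eq_range htne
  choose! k hk using fun x (hx : x ∈ t) => (hf ▸ hx : x ∈ range f)
  obtain ⟨N, hN⟩ := (htf.image k).bddAbove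
  refine ⟨SimpleFunc.nearestPt f N, fun z => htS ?_, fun z hz => ?_⟩
  · rw [hf]
    exact ⟨_, rfl⟩
  · obtain ⟨x, hx, hzx⟩ := mem_iUnion₂.1 (hcov hz)
    have h1 := SimpleFunc.edist_nearestPt_le f z (hN (mem_image_of_mem k hx))
    rw [hk x hx, edist_dist, edist_dist, ENNReal.ofReal_le_ofReal_iff dist_nonneg] at h1
    exact h1.trans ((dist_comm x z).trans_le (Metric.mem_ball.1 hzx).le)

/-- Replacing `l` by `l ∘ π` for a fine net changes both means by at most `τ / 3`, thanks to the
common Lipschitz constant. After that only finitely many cell frequencies matter, with coefficients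
bounded by `|B|`, so their convergence is uniform in `l`. -/
theorem uniform_law_of_large_numbers (hW : Measurable W) (hindep : iIndepFun z P)
    (hident : ∀ i, IdentDistrib (z i) W P P) {S : Set Z} (hS : IsCompact S)
    (hWS : ∀ᵐ w ∂(P.map W), w ∈ S) :
    ∀ᵐ ω ∂P, ∀ L B τ : ℝ, 0 < τ → ∃ N : ℕ, ∀ n ≥ N, ∀ l : Z → ℝ, Measurable l →
      (∀ w ∈ S, |l w| ≤ B) → (∀ w ∈ S, ∀ w' ∈ S, |l w - l w'| ≤ L * dist w w') →
      |1 / (n : ℝ) * ∑ i ∈ Finset.range n, l (z i ω) - ∫ w, l w ∂(P.map W)| ≤ τ := by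
  have : IsProbabilityMeasure (P.map W) := Measure.isProbabilityMeasure_map hW.aemeasurable
  have hne : S.Nonempty := by
    obtain ⟨w, hw⟩ := hWS.exists
    exact ⟨w, hw⟩
  choose π hπS hπd using fun m : ℕ => exists_simpleFunc_dist_le hS hne
    (e := 1 / ((m : ℝ) + 1)) (by positivity)
  have hzS : ∀ᵐ ω ∂P, ∀ i, z i ω ∈ S := by
    refine ae_all_iff.2 fun i => ?_
    have h := hWS
    rw [← (hident i).map_eq] at h
    exact ae_of_ae_map (hident i).aemeasurable_fst h
  -- Only countably many cells occur over all scales, so a single null set serves all `L`, `B`, `τ`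
  -- and `l`.
  have hfreq : ∀ᵐ ω ∂P, ∀ m, ∀ c ∈ (π m).range, Tendsto (fun n : ℕ =>
      (∑ i ∈ Finset.range n, (π m ⁻¹' {c}).indicator (fun _ => (1 : ℝ)) (z i ω)) / n)
      atTop (𝓝 ((P.map W).real (π m ⁻¹' {c}))) :=
    ae_all_iff.2 fun m => (ae_ball_iff (Finset.countable_toSet (π m).range)).2 fun c _ =>
      ae_tendsto_frequency hW hindep hident ((π m).measurableSet_fiber c)
  filter_upwards [hzS, hfreq] with ω hω hfr L B τ hτ
  obtain ⟨m, hm⟩ : ∃ m : ℕ, |L| * (1 / ((m : ℝ) + 1)) ≤ τ / 3 := by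
    obtain ⟨m, hm⟩ := exists_nat_gt (|L| / (τ / 3))
    refine ⟨m, ?_⟩
    rw [mul_one_div, div_le_iff₀ (by positivity)]
    rw [div_lt_iff₀ (by positivity)] at hm
    nlinarith
  set r := (π m).range
  -- Chosen so that `r.card` frequency errors with weights at most `|B|` add up to at most `τ / 3`.
  set η : ℝ := τ / 3 / ((|B| + 1) * (r.card + 1)) with hη
  have hη0 : 0 < η := by positivity
  have hev : ∀ᶠ n : ℕ in atTop, ∀ c ∈ r, |(∑ i ∈ Finset.range n,
      (π m ⁻¹' {c}).indicator (fun _ => (1 : ℝ)) (z i ω)) / n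
      - (P.map W).real (π m ⁻¹' {c})| ≤ η := by
    refine (Finset.eventually_all _).2 fun c hc => ?_
    have := (Metric.tendsto_nhds.1 (hfr m c hc)) η hη0
    exact this.mono fun n hn => by rw [Real.dist_eq] at hn; exact hn.le
  obtain ⟨N, hN⟩ := eventually_atTop.1 hev
  refine ⟨max N 1, fun n hn l hl hlB hlL => ?_⟩
  have hn1 : (0 : ℝ) < n := by
    have : 0 < n := lt_of_lt_of_le one_pos ((le_max_right _ _).trans hn)
    exact_mod_cast this
  have hdec : ∀ w, l (π m w) = ∑ c ∈ r, l c * (π m ⁻¹' {c}).indicator (fun _ => (1 : ℝ)) w := by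
    intro w
    rw [Finset.sum_eq_single_of_mem (π m w) (SimpleFunc.mem_range_self _ _)]
    · simp
    · intro c _ hc
      rw [indicator_of_notMem, mul_zero]
      exact fun h => hc (by simpa using h.symm)
  have hclose : ∀ w ∈ S, |l w - l (π m w)| ≤ τ / 3 := by
    intro w hw
    refine (hlL w hw _ (hπS m w)).trans (le_trans ?_ hm)
    refine mul_le_mul (le_abs_self L) ?_ dist_nonneg (abs_nonneg L)
    rw [dist_comm]
    exact hπd m w hw
  have hsum : |1 / (n : ℝ) * ∑ i ∈ Finset.range n, l (z i ω)
      - 1 / (n : ℝ) * ∑ i ∈ Finset.range n, l (π m (z i ω))| ≤ τ / 3 := by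
    rw [← mul_sub, ← Finset.sum_sub_distrib, abs_mul, abs_of_pos (by positivity : 0 < 1 / (n : ℝ))]
    calc 1 / (n : ℝ) * |∑ i ∈ Finset.range n, (l (z i ω) - l (π m (z i ω)))|
        ≤ 1 / (n : ℝ) * ∑ i ∈ Finset.range n, τ / 3 := by
          gcongr
          exact (Finset.abs_sum_le_sum_abs _ _).trans
            (Finset.sum_le_sum fun i _ => hclose _ (hω i))
      _ = τ / 3 := by
          rw [Finset.sum_const, Finset.card_range, nsmul_eq_mul]
          field_simp
  have hπm : Measurable fun w => l (π m w) := hl.comp (π m).measurable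
  have hint : Integrable l (P.map W) :=
    Integrable.of_bound hl.aestronglyMeasurable B (hWS.mono fun w hw => hlB w hw)
  have hintπ : Integrable (fun w => l (π m w)) (P.map W) :=
    Integrable.of_bound hπm.aestronglyMeasurable B (Eventually.of_forall fun w => hlB _ (hπS m w))
  have hE : |∫ w, l (π m w) ∂(P.map W) - ∫ w, l w ∂(P.map W)| ≤ τ / 3 := by
    rw [← integral_sub hintπ hint]
    have := norm_integral_le_of_norm_le_const (μ := P.map W)
      (f := fun w => l (π m w) - l w) (C := τ / 3)
      (hWS.mono fun w hw => by rw [Real.norm_eq_abs, abs_sub_comm]; exact hclose w hw)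
    simpa using this
  have hmid : |1 / (n : ℝ) * ∑ i ∈ Finset.range n, l (π m (z i ω))
      - ∫ w, l (π m w) ∂(P.map W)| ≤ τ / 3 := by
    have e1 : 1 / (n : ℝ) * ∑ i ∈ Finset.range n, l (π m (z i ω)) = ∑ c ∈ r, l c *
        ((∑ i ∈ Finset.range n, (π m ⁻¹' {c}).indicator (fun _ => (1 : ℝ)) (z i ω)) / n) := by
      simp_rw [hdec]
      rw [Finset.sum_comm, Finset.mul_sum]
      refine Finset.sum_congr rfl fun c _ => ?_
      rw [← Finset.mul_sum]
      ring
    have e2 : ∫ w, l (π m w) ∂(P.map W) = ∑ c ∈ r, l c * (P.map W).real (π m ⁻¹' {c}) := by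
      simp_rw [hdec]
      rw [integral_finsetSum]
      · refine Finset.sum_congr rfl fun c _ => ?_
        rw [integral_const_mul, integral_indicator ((π m).measurableSet_fiber c)]
        simp
      · intro c _
        exact ((integrable_const _).indicator ((π m).measurableSet_fiber c)).const_mul _
    rw [e1, e2, ← Finset.sum_sub_distrib]
    calc |∑ c ∈ r, (l c * ((∑ i ∈ Finset.range n, (π m ⁻¹' {c}).indicator
          (fun _ => (1 : ℝ)) (z i ω)) / n) - l c * (P.map W).real (π m ⁻¹' {c}))|
        ≤ ∑ c ∈ r, |B| * η := by
          refine (Finset.abs_sum_le_sum_abs _ _).trans (Finset.sum_le_sum fun c hc => ?_)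
          rw [← mul_sub, abs_mul]
          obtain ⟨w, rfl⟩ := SimpleFunc.mem_range.1 hc
          exact mul_le_mul ((hlB _ (hπS m w)).trans (le_abs_self B))
            (hN n ((le_max_left _ _).trans hn) _ hc) (abs_nonneg _) (abs_nonneg _)
      _ = r.card * |B| * η := by
          rw [Finset.sum_const, nsmul_eq_mul, mul_assoc]
      _ ≤ ((|B| + 1) * (r.card + 1)) * η := by
          have : (0 : ℝ) ≤ r.card := Nat.cast_nonneg _
          refine mul_le_mul_of_nonneg_right ?_ hη0.le
          nlinarith [abs_nonneg B]
      _ = τ / 3 := by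
          rw [hη]
          field_simp
  have := abs_sub_le (1 / (n : ℝ) * ∑ i ∈ Finset.range n, l (z i ω))
    (1 / (n : ℝ) * ∑ i ∈ Finset.range n, l (π m (z i ω))) (∫ w, l (π m w) ∂(P.map W))
  have := abs_sub_le (1 / (n : ℝ) * ∑ i ∈ Finset.range n, l (z i ω))
    (∫ w, l (π m w) ∂(P.map W)) (∫ w, l w ∂(P.map W))
  linarith

end UniformLaw

/-! ### A Pinsker-type inequality for the perturbed Kullback–Leibler divergence -/

/-- With `a = √(δ + p)` and `b = √(δ + G)`, the bound `log (a / b) ≥ 1 - b / a` and the identity `2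
p (1 - b / a) = p / (δ + p) · ((p - G) + (a - b)²)` give a Hellinger term. The weight `p / (δ + p)`
is at least `m / (m + 1)`, and dropping it from the linear term costs at most `δ`. -/
theorem mul_log_ratio_ge {p G δ m : ℝ} (hG : 0 ≤ G) (hδ : 0 < δ) (hδ1 : δ ≤ 1) (hm : 0 < m)
    (hpm : m ≤ p) :
    (p - G) - δ + m / (m + 1) * (Real.sqrt (δ + p) - Real.sqrt (δ + G)) ^ 2 ≤
      p * Real.log ((δ + p) / (δ + G)) := by
  have hp : 0 < p := hm.trans_le hpm
  set a := Real.sqrt (δ + p) with ha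
  set b := Real.sqrt (δ + G) with hb
  have ha0 : 0 < a := Real.sqrt_pos.2 (by linarith)
  have hb0 : 0 < b := Real.sqrt_pos.2 (by linarith)
  have ha2 : a ^ 2 = δ + p := Real.sq_sqrt (by linarith)
  have hb2 : b ^ 2 = δ + G := Real.sq_sqrt (by linarith)
  have hlog : 2 * (1 - b / a) ≤ Real.log ((δ + p) / (δ + G)) := by
    rw [← ha2, ← hb2, ← div_pow, Real.log_pow]
    have := Real.one_sub_inv_le_log_of_pos (div_pos ha0 hb0)
    rw [inv_div] at this
    push_cast
    linarith
  have h1 : p * (2 * (1 - b / a)) = p / (δ + p) * ((p - G) + (a - b) ^ 2) := by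
    have : (p - G) + (a - b) ^ 2 = 2 * a ^ 2 - 2 * a * b := by nlinarith
    rw [this, ← ha2]
    field_simp
  have h2 : m / (m + 1) ≤ p / (δ + p) := by
    rw [div_le_div_iff₀ (by positivity) (by positivity)]
    nlinarith
  have h3 : (p - G) - δ ≤ p / (δ + p) * (p - G) := by
    rw [div_mul_eq_mul_div, le_div_iff₀ (by positivity)]
    nlinarith
  calc (p - G) - δ + m / (m + 1) * (a - b) ^ 2
      ≤ p / (δ + p) * (p - G) + p / (δ + p) * (a - b) ^ 2 :=
        add_le_add h3 (mul_le_mul_of_nonneg_right h2 (sq_nonneg _))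
    _ = p * (2 * (1 - b / a)) := by rw [h1]; ring
    _ ≤ p * Real.log ((δ + p) / (δ + G)) := mul_le_mul_of_nonneg_left hlog hp.le

/-- Factor `P - Q` as a difference of squares and apply the weighted arithmetic–geometric
inequality. Optimizing `t` after integration takes the place of Cauchy–Schwarz. -/
theorem abs_sub_le_sqrt_sub_sq {P Q t : ℝ} (hP : 0 ≤ P) (hQ : 0 ≤ Q) (ht : 0 < t) :
    |P - Q| ≤ t * (Real.sqrt P - Real.sqrt Q) ^ 2 + (P + Q) / (2 * t) := by
  set a := Real.sqrt P with ha
  set b := Real.sqrt Q with hb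
  have ha0 : 0 ≤ a := Real.sqrt_nonneg _
  have hb0 : 0 ≤ b := Real.sqrt_nonneg _
  have ha2 : a ^ 2 = P := Real.sq_sqrt hP
  have hb2 : b ^ 2 = Q := Real.sq_sqrt hQ
  rw [← ha2, ← hb2, sq_sub_sq, abs_mul, abs_of_nonneg (add_nonneg ha0 hb0), ← sq_abs (a - b)]
  set s := |a - b|
  have h1 : (a + b) ^ 2 / (4 * t) ≤ (a ^ 2 + b ^ 2) / (2 * t) := by
    rw [div_le_div_iff₀ (by positivity) (by positivity)]
    nlinarith [mul_nonneg ht.le (sq_nonneg (a - b))]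
  have h2 : (a + b) * s ≤ t * s ^ 2 + (a + b) ^ 2 / (4 * t) := by
    rw [← sub_nonneg]
    have : t * s ^ 2 + (a + b) ^ 2 / (4 * t) - (a + b) * s
        = (2 * t * s - (a + b)) ^ 2 / (4 * t) := by
      field_simp
      ring
    rw [this]
    positivity
  linarith

/-- The squared `L¹` distance between a density `p`, bounded below where it is positive, and a
subprobability density `G` is controlled by the `δ`-perturbed divergence. -/
theorem sq_integral_abs_sub_le {Z : Type*} [MeasurableSpace Z] {ν : Measure Z} [IsFiniteMeasure ν]
    {p G : Z → ℝ} (hpm : Measurable p) (hGm : Measurable G) (hpi : Integrable p ν)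
    (hGi : Integrable G ν) (hp0 : ∀ y, 0 ≤ p y) (hG0 : ∀ y, 0 ≤ G y) {m : ℝ} (hm : 0 < m)
    (hpm' : ∀ y, p y = 0 ∨ m ≤ p y) (hp1 : ∫ y, p y ∂ν = 1) (hG1 : ∫ y, G y ∂ν ≤ 1)
    {δ : ℝ} (hδ : 0 < δ) (hδ1 : δ ≤ 1)
    (hlog : Integrable (fun y => p y * Real.log ((δ + p y) / (δ + G y))) ν) :
    (∫ y, |p y - G y| ∂ν) ^ 2 ≤ 4 * (1 + ν.real univ) * ((m + 1) / m) *
      (∫ y, p y * Real.log ((δ + p y) / (δ + G y)) ∂ν + δ * ν.real univ) := by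
  classical
  set V := ν.real univ with hV
  have hV0 : 0 ≤ V := measureReal_nonneg
  -- Where `p` vanishes the entropy integrand is zero and cannot control `G`. There the linear term
  -- `p - G = -G` pays for `e = G`, since the weight `m / (m + 1)` is at most one.
  let e : Z → ℝ := fun y => if p y = 0 then G y else
    (Real.sqrt (δ + p y) - Real.sqrt (δ + G y)) ^ 2
  have hem : Measurable e := Measurable.ite (hpm (measurableSet_singleton 0)) hGm
    (((measurable_const.add hpm).sqrt.sub (measurable_const.add hGm).sqrt).pow_const 2)
  have he0 : ∀ y, 0 ≤ e y := by
    intro y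
    simp only [e]
    split_ifs
    exacts [hG0 y, sq_nonneg _]
  have hRi : Integrable (fun y => (δ + p y) + (δ + G y)) ν :=
    ((integrable_const δ).add hpi).add ((integrable_const δ).add hGi)
  have heR : ∀ y, e y ≤ (δ + p y) + (δ + G y) := by
    intro y
    have h1 := hp0 y
    have h2 := hG0 y
    simp only [e]
    split_ifs
    · linarith
    · have ha := Real.sq_sqrt (by linarith : 0 ≤ δ + p y)
      have hb := Real.sq_sqrt (by linarith : 0 ≤ δ + G y)
      nlinarith [mul_nonneg (Real.sqrt_nonneg (δ + p y)) (Real.sqrt_nonneg (δ + G y))]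
  have hei : Integrable e ν := hRi.mono' hem.aestronglyMeasurable
    (Eventually.of_forall fun y => by rw [Real.norm_of_nonneg (he0 y)]; exact heR y)
  have hc : m / (m + 1) ≤ 1 := by
    rw [div_le_one (by positivity)]
    linarith
  have hlow : ∀ y, (p y - G y) - δ + m / (m + 1) * e y ≤
      p y * Real.log ((δ + p y) / (δ + G y)) := by
    intro y
    simp only [e]
    split_ifs with h
    · rw [h]
      nlinarith [hG0 y, mul_nonneg (sub_nonneg.2 hc) (hG0 y)]
    · exact mul_log_ratio_ge (hG0 y) hδ hδ1 hm ((hpm' y).resolve_left h)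
  -- The linear term integrates to `1 - ∫ G ≥ 0` and can be discarded.
  have hE : m / (m + 1) * ∫ y, e y ∂ν ≤
      ∫ y, p y * Real.log ((δ + p y) / (δ + G y)) ∂ν + δ * V := by
    have i1 : Integrable (fun y => p y - G y) ν := hpi.sub hGi
    have i2 : Integrable (fun y => p y - G y - δ) ν := i1.sub (integrable_const δ)
    have h1 := integral_mono (i2.add (hei.const_mul (m / (m + 1)))) hlog hlow
    simp only [Pi.add_def] at h1
    rw [integral_add i2 (hei.const_mul _), integral_sub i1 (integrable_const δ),
      integral_sub hpi hGi, integral_const,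
      integral_const_mul, hp1, smul_eq_mul] at h1
    change 1 - ∫ y, G y ∂ν - V * δ + _ ≤ _ at h1
    linarith
  have hR : ∫ y, ((δ + p y) + (δ + G y)) ∂ν ≤ 2 * (1 + V) := by
    have i1 : Integrable (fun y => δ + p y) ν := (integrable_const δ).add hpi
    have i2 : Integrable (fun y => δ + G y) ν := (integrable_const δ).add hGi
    rw [integral_add i1 i2, integral_add (integrable_const δ) hpi,
      integral_add (integrable_const δ) hGi, hp1,
      integral_const, smul_eq_mul]
    change V * δ + 1 + (V * δ + _) ≤ _
    nlinarith
  have hD : ∀ t, 0 < t → ∫ y, |p y - G y| ∂ν ≤ t * ∫ y, e y ∂ν + 2 * (1 + V) / (2 * t) := by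
    intro t ht
    have h1 : ∀ y, |p y - G y| ≤ t * e y + ((δ + p y) + (δ + G y)) / (2 * t) := by
      intro y
      have hp := hp0 y
      have hG := hG0 y
      simp only [e]
      split_ifs with h
      · rw [h, zero_sub, abs_neg, abs_of_nonneg hG, ← sub_nonneg]
        have : t * G y + (δ + 0 + (δ + G y)) / (2 * t) - G y =
            (G y * ((2 * t - 1) ^ 2 + 1) + 4 * δ) / (4 * t) := by
          field_simp
          ring
        rw [this]
        positivity
      · have := abs_sub_le_sqrt_sub_sq (P := δ + p y) (Q := δ + G y) (by linarith) (by linarith) ht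
        rwa [add_sub_add_left_eq_sub] at this
    have h2 := integral_mono (hpi.sub hGi).abs ((hei.const_mul t).add (hRi.div_const (2 * t))) h1
    simp only [Pi.sub_def, Pi.add_def] at h2
    rw [integral_add (hei.const_mul t) (hRi.div_const (2 * t)), integral_const_mul,
      integral_div] at h2
    refine h2.trans (add_le_add le_rfl ?_)
    exact div_le_div_of_nonneg_right hR (by positivity)
  set D := ∫ y, |p y - G y| ∂ν
  set E := ∫ y, e y ∂ν
  have hD0 : 0 ≤ D := integral_nonneg fun y => abs_nonneg _
  have hDE : D ^ 2 ≤ 4 * (1 + V) * E := by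
    rcases hD0.eq_or_lt with h0 | hpos
    · rw [← h0, zero_pow two_ne_zero]
      have : 0 ≤ E := integral_nonneg he0
      positivity
    -- This `t` turns the second term of `hD` into `D / 2`, which the left side absorbs.
    · have h1 := hD (2 * (1 + V) / D) (by positivity)
      have h2 : 2 * (1 + V) / (2 * (2 * (1 + V) / D)) = D / 2 := by
        field_simp
      rw [h2] at h1
      have h3 : D * (D / 2) ≤ D * (2 * (1 + V) / D * E) :=
        mul_le_mul_of_nonneg_left (by linarith) hD0
      have h4 : D * (2 * (1 + V) / D * E) = 2 * (1 + V) * E := by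
        field_simp
      nlinarith
  refine hDE.trans ?_
  rw [mul_assoc (4 * (1 + V))]
  refine mul_le_mul_of_nonneg_left ?_ (by positivity)
  have h5 : E = (m + 1) / m * (m / (m + 1) * E) := by
    field_simp
  rw [h5]
  exact mul_le_mul_of_nonneg_left hE (by positivity)

/-! ### Convex sets: translates and sections -/

section Convex

/-- A translate of a bounded convex set misses little of it. -/
theorem volume_diff_translate_le {q : ℕ} {D : Set (Fin q → ℝ)} (hD : Convex ℝ D)
    (hDm : MeasurableSet D) {R : ℝ} (hR : D ⊆ Metric.closedBall 0 R) {ε : ℝ} (hε : 0 < ε)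
    (hε1 : ε ≤ 1) {v : Fin q → ℝ} (hv : ‖v‖ ≤ ε) :
    volume {y | y ∈ D ∧ y - v ∉ D} ≤
      ENNReal.ofReal ε * volume (Metric.closedBall (0 : Fin q → ℝ) (R + 2)) := by
  set E : Set (Fin q → ℝ) := {y | y ∈ D ∧ y - v ∉ D} with hE
  have hEm : MeasurableSet E := hDm.inter ((measurable_id.sub_const v) hDm).compl
  -- These are the translates `E + k v`. They are disjoint: if `y - k v` and `y - l v` lie in `D`
  -- with `k < l`, then by convexity so does `y - (k + 1) v`, a point on the segment joining them,
  -- which contradicts `y - k v ∈ E`.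
  let f : ℕ → Set (Fin q → ℝ) := fun k => (fun y => y + (-(k : ℝ) • v)) ⁻¹' E
  have hfm : ∀ k, MeasurableSet (f k) := fun k => (measurable_id.add_const _) hEm
  have hfv : ∀ k, volume (f k) = volume E := fun k => measure_preimage_add_right _ _ _
  have hdisj : ∀ k l, k < l → Disjoint (f k) (f l) := by
    intro k l hkl
    refine Set.disjoint_left.2 fun y hyk hyl => ?_
    have h1 : y + (-(k : ℝ) • v) ∈ E := hyk
    have h2 : y + (-(l : ℝ) • v) ∈ E := hyl
    have hlk : (0 : ℝ) < (l : ℝ) - k := sub_pos.2 (by exact_mod_cast hkl)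
    have hlk1 : (1 : ℝ) ≤ (l : ℝ) - k := by
      have : ((k : ℝ) + 1) ≤ l := by exact_mod_cast hkl
      linarith
    refine h1.2 ?_
    have h3 := hD h1.1 h2.1 (a := 1 - ((l : ℝ) - k)⁻¹) (b := ((l : ℝ) - k)⁻¹)
      (sub_nonneg.2 (inv_le_one_of_one_le₀ hlk1)) (by positivity) (by ring)
    convert h3 using 1
    ext i
    simp only [Pi.add_apply, Pi.sub_apply, Pi.smul_apply, smul_eq_mul]
    field_simp
    ring
  have hpw : Pairwise (Function.onFun Disjoint f) := by
    intro k l hkl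
    rcases lt_or_gt_of_ne hkl with h | h
    · exact hdisj k l h
    · exact (hdisj l k h).symm
  -- About `1 / ε` disjoint copies of `E` fit into one ball; since `N ε ≤ 1 + ε ≤ 2`, the radius `R
  -- + 2` is enough.
  set N := ⌈ε⁻¹⌉₊ with hN
  have hN1 : ε⁻¹ ≤ N := Nat.le_ceil _
  have hN2 : (N : ℝ) * ε ≤ 2 := by
    have := (Nat.ceil_lt_add_one (inv_nonneg.2 hε.le)).le
    calc (N : ℝ) * ε ≤ (ε⁻¹ + 1) * ε := by gcongr
      _ = 1 + ε := by field_simp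
      _ ≤ 2 := by linarith
  have hsub : ⋃ k ∈ Finset.range N, f k ⊆ Metric.closedBall (0 : Fin q → ℝ) (R + 2) := by
    refine iUnion₂_subset fun k hk y hy => ?_
    have h1 : ‖y + (-(k : ℝ) • v)‖ ≤ R := by
      simpa using hR (show y + (-(k : ℝ) • v) ∈ E from hy).1
    rw [mem_closedBall_zero_iff]
    have h2 : ‖(k : ℝ) • v‖ ≤ 2 := by
      rw [norm_smul, Real.norm_of_nonneg (Nat.cast_nonneg k)]
      refine le_trans ?_ hN2
      have : (k : ℝ) ≤ N := by exact_mod_cast (Finset.mem_range.1 hk).le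
      gcongr
    calc ‖y‖ = ‖(y + (-(k : ℝ) • v)) + (k : ℝ) • v‖ := by congr 1; simp
      _ ≤ R + 2 := (norm_add_le _ _).trans (add_le_add h1 h2)
  have hcount : (N : ℝ≥0∞) * volume E ≤ volume (Metric.closedBall (0 : Fin q → ℝ) (R + 2)) := by
    calc (N : ℝ≥0∞) * volume E = ∑ k ∈ Finset.range N, volume (f k) := by
          simp [hfv]
      _ = volume (⋃ k ∈ Finset.range N, f k) :=
          (measure_biUnion_finset (fun k _ l _ hkl => hpw hkl) fun k _ => hfm k).symm
      _ ≤ _ := measure_mono hsub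
  have h1 : (1 : ℝ≥0∞) ≤ ENNReal.ofReal ε * N := by
    rw [← ENNReal.ofReal_natCast, ← ENNReal.ofReal_mul hε.le, ENNReal.one_le_ofReal]
    calc (1 : ℝ) = ε * ε⁻¹ := (mul_inv_cancel₀ hε.ne').symm
      _ ≤ ε * N := by gcongr
  calc volume E = 1 * volume E := (one_mul _).symm
    _ ≤ ENNReal.ofReal ε * N * volume E := mul_le_mul_left h1 _
    _ = ENNReal.ofReal ε * (N * volume E) := mul_assoc _ _ _
    _ ≤ _ := mul_le_mul_right hcount _

/-- A function growing at most logarithmically near the boundary of a compact convex set is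
integrable. -/
theorem setLIntegral_lt_top_of_homothety {d : ℕ} {D : Set (Fin d → ℝ)} (hD : IsCompact D)
    (hDc : Convex ℝ D) {x₀ : Fin d → ℝ} (hx₀ : x₀ ∈ D) {w : (Fin d → ℝ) → ℝ≥0∞} {A : ℝ≥0∞}
    (hA : A ≠ ⊤) (hA0 : A ≠ 0)
    (hw : ∀ J : ℕ, ∀ x ∈ AffineMap.homothety x₀ (1 - (1 / 2 : ℝ) ^ J) '' D, w x ≤ A * (1 + J)) :
    ∫⁻ x in D, w x < ⊤ := by
  classical
  set L : ℕ → Set (Fin d → ℝ) := fun J => AffineMap.homothety x₀ (1 - (1 / 2 : ℝ) ^ J) '' D with hL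
  have ht0 : ∀ J : ℕ, 0 < (1 / 2 : ℝ) ^ J := fun J => by positivity
  have ht1 : ∀ J : ℕ, (1 / 2 : ℝ) ^ J ≤ 1 := fun J => pow_le_one₀ (by norm_num) (by norm_num)
  have hLm : ∀ J, MeasurableSet (L J) := fun J =>
    (hD.image (AffineMap.homothety_continuous x₀ _)).measurableSet
  have hLD : ∀ J, L J ⊆ D := by
    rintro J _ ⟨x, hx, rfl⟩
    rw [AffineMap.homothety_apply]
    have := hDc hx hx₀ (a := 1 - (1 / 2 : ℝ) ^ J) (b := (1 / 2 : ℝ) ^ J)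
      (sub_nonneg.2 (ht1 J)) (ht0 J).le (by ring)
    convert this using 1
    ext i
    simp only [vsub_eq_sub, vadd_eq_add, Pi.add_apply, Pi.smul_apply, Pi.sub_apply, smul_eq_mul]
    ring
  -- The homothety scales volume by `(1 - t) ^ d`, which is at least `1 - d t` by Bernoulli.
  have hvol : ∀ J, volume (D \ L J) ≤ (d * volume D) * (2⁻¹ : ℝ≥0∞) ^ J := by
    intro J
    have hfin : volume D ≠ ⊤ := hD.measure_lt_top.ne
    rw [measure_sdiff (hLD J) (hLm J).nullMeasurableSet (measure_ne_top_of_subset (hLD J) hfin),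
      hL, Measure.addHaar_image_homothety, Module.finrank_fin_fun, tsub_le_iff_right]
    set t := (1 / 2 : ℝ) ^ J with ht
    have hbern : 1 ≤ d * t + (1 - t) ^ d := by
      have := one_add_mul_le_pow (a := -t) (by linarith [ht1 J]) d
      rw [← sub_eq_add_neg] at this
      linarith
    have h2 : (2⁻¹ : ℝ≥0∞) ^ J = ENNReal.ofReal t := by
      rw [ht, one_div, ENNReal.ofReal_pow (by norm_num), ENNReal.ofReal_inv_of_pos (by norm_num)]
      simp
    have ht1' : 0 ≤ 1 - t := sub_nonneg.2 (ht1 J)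
    rw [h2, abs_of_nonneg (by positivity)]
    calc volume D = ENNReal.ofReal 1 * volume D := by simp
      _ ≤ ENNReal.ofReal (d * t + (1 - t) ^ d) * volume D := by gcongr
      _ = d * volume D * ENNReal.ofReal t + ENNReal.ofReal ((1 - t) ^ d) * volume D := by
          rw [ENNReal.ofReal_add (mul_nonneg (Nat.cast_nonneg d) (ht0 J).le) (by positivity),
            ENNReal.ofReal_mul (Nat.cast_nonneg d), ENNReal.ofReal_natCast]
          ring
  -- For the first `J` with `x ∈ L J`, the sum counts at least the `J` earlier sets that miss `x`.
  -- If no such `J` exists the sum is infinite, and so is the bound because `A ≠ 0`.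
  have hpt : ∀ x ∈ D, w x ≤ A + A * ∑' j, (D \ L j).indicator (fun _ => (1 : ℝ≥0∞)) x := by
    intro x hx
    by_cases hex : ∃ J, x ∈ L J
    · have hmem := Nat.find_spec hex
      have hmin : ∀ j < Nat.find hex, x ∉ L j := fun j hj => Nat.find_min hex hj
      set J := Nat.find hex
      have hsum : (J : ℝ≥0∞) ≤ ∑' j, (D \ L j).indicator (fun _ => (1 : ℝ≥0∞)) x := by
        calc (J : ℝ≥0∞) = ∑ j ∈ Finset.range J, (D \ L j).indicator (fun _ => (1 : ℝ≥0∞)) x := by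
              rw [Finset.sum_congr rfl fun j hj => indicator_of_mem
                (show x ∈ D \ L j from ⟨hx, hmin j (Finset.mem_range.1 hj)⟩) _]
              simp
          _ ≤ _ := ENNReal.sum_le_tsum _
      calc w x ≤ A * (1 + J) := hw J x hmem
        _ = A + A * J := by ring
        _ ≤ _ := by gcongr
    · push Not at hex
      have : ∑' j, (D \ L j).indicator (fun _ => (1 : ℝ≥0∞)) x = ⊤ := by
        rw [tsum_congr fun j => indicator_of_mem (show x ∈ D \ L j from ⟨hx, hex j⟩) _]
        exact ENNReal.tsum_const_eq_top_of_ne_zero one_ne_zero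
      rw [this, ENNReal.mul_top hA0]
      simp
  have hind : ∀ j, Measurable ((D \ L j).indicator fun _ => (1 : ℝ≥0∞)) := fun j =>
    measurable_const.indicator (hD.measurableSet.diff (hLm j))
  calc ∫⁻ x in D, w x
      ≤ ∫⁻ x in D, (A + A * ∑' j, (D \ L j).indicator (fun _ => (1 : ℝ≥0∞)) x) :=
        setLIntegral_mono (measurable_const.add
          ((Measurable.tsum hind).const_mul A)) hpt
    _ = A * volume D + A * ∑' j, ∫⁻ x in D, (D \ L j).indicator (fun _ => (1 : ℝ≥0∞)) x := by
        rw [lintegral_add_left measurable_const, setLIntegral_const,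
          lintegral_const_mul _ (Measurable.tsum hind),
          lintegral_tsum fun j => (hind j).aemeasurable]
    _ ≤ A * volume D + A * ∑' j : ℕ, (d * volume D) * (2⁻¹ : ℝ≥0∞) ^ j := by
        gcongr with j
        refine (setLIntegral_le_lintegral _ _).trans ?_
        rw [lintegral_indicator (hD.measurableSet.diff (hLm j)), setLIntegral_const, one_mul]
        exact hvol j
    _ < ⊤ := by
        rw [ENNReal.tsum_mul_left, ENNReal.tsum_geometric, ENNReal.one_sub_inv_two, inv_inv]
        have := hD.measure_lt_top (μ := (volume : Measure (Fin d → ℝ)))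
        refine ENNReal.add_lt_top.2 ⟨ENNReal.mul_lt_top hA.lt_top this,
          ENNReal.mul_lt_top hA.lt_top (ENNReal.mul_lt_top (ENNReal.mul_lt_top ?_ this) ?_)⟩
        · exact ENNReal.natCast_lt_top d
        · exact ENNReal.ofNat_lt_top

end Convex

/-! ### Densities bounded below on a convex body -/

/-- `g` is supported on the convex body `S`, where it is Lipschitz and bounded away from `0` and
`∞`. -/
structure IsRegularDensity {d q : ℕ} (S : Set ((Fin d → ℝ) × (Fin q → ℝ)))
    (g : (Fin d → ℝ) × (Fin q → ℝ) → ℝ) (m B L R r : ℝ) (z₀ : (Fin d → ℝ) × (Fin q → ℝ)) :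
    Prop where
  compact : IsCompact S
  convex : Convex ℝ S
  ball_subset : Metric.closedBall z₀ r ⊆ S
  subset_ball : S ⊆ Metric.closedBall 0 R
  r_pos : 0 < r
  m_pos : 0 < m
  measurable : Measurable g
  ge_on : ∀ z ∈ S, m ≤ g z
  le_on : ∀ z ∈ S, g z ≤ B
  eq_zero : ∀ z ∉ S, g z = 0
  L_nonneg : 0 ≤ L
  lipschitz : ∀ z ∈ S, ∀ z' ∈ S, |g z - g z'| ≤ L * dist z z'

/-- The marginal density of the first component. -/
def marginal {d q : ℕ} (g : (Fin d → ℝ) × (Fin q → ℝ) → ℝ) (x : Fin d → ℝ) : ℝ :=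
  ∫ y, g (x, y)

theorem condDensity_eq {d q : ℕ} (g : (Fin d → ℝ) × (Fin q → ℝ) → ℝ) (x : Fin d → ℝ)
    (y : Fin q → ℝ) : condDensity g x y = g (x, y) / marginal g x := rfl

theorem integrable_indicator_closedBall {q : ℕ} (R B : ℝ) :
    Integrable ((Metric.closedBall (0 : Fin q → ℝ) R).indicator fun _ => B) :=
  (integrable_indicator_iff measurableSet_closedBall).2
    (integrableOn_const (isCompact_closedBall _ _).measure_lt_top.ne)

theorem integral_condDensity_eq_one {d q : ℕ} {g : (Fin d → ℝ) × (Fin q → ℝ) → ℝ} {x : Fin d → ℝ}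
    (hx : 0 < marginal g x) : ∫ y, condDensity g x y = 1 := by
  simp only [condDensity_eq]
  rw [integral_div]
  exact div_self hx.ne'

namespace IsRegularDensity

variable {d q : ℕ} {S : Set ((Fin d → ℝ) × (Fin q → ℝ))} {g : (Fin d → ℝ) × (Fin q → ℝ) → ℝ}
  {m B L R r : ℝ} {z₀ : (Fin d → ℝ) × (Fin q → ℝ)} (H : IsRegularDensity S g m B L R r z₀)
include H

theorem center_mem : z₀ ∈ S := H.ball_subset (Metric.mem_closedBall_self H.r_pos.le)

theorem B_pos : 0 < B := H.m_pos.trans_le ((H.ge_on _ H.center_mem).trans (H.le_on _ H.center_mem))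

theorem R_nonneg : 0 ≤ R := dist_nonneg.trans (H.subset_ball H.center_mem)

theorem nonneg (z) : 0 ≤ g z := by
  by_cases hz : z ∈ S
  · exact H.m_pos.le.trans (H.ge_on z hz)
  · rw [H.eq_zero z hz]

theorem le (z) : g z ≤ B := by
  by_cases hz : z ∈ S
  · exact H.le_on z hz
  · rw [H.eq_zero z hz]
    exact H.B_pos.le

theorem norm_le_of_mem {x : Fin d → ℝ} {y : Fin q → ℝ} (h : (x, y) ∈ S) : ‖y‖ ≤ R := by
  have := H.subset_ball h
  rw [mem_closedBall_zero_iff] at this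
  exact (_root_.norm_snd_le (x, y)).trans this

theorem measurable_right (x : Fin d → ℝ) : Measurable fun y => g (x, y) :=
  H.measurable.comp measurable_prodMk_left

theorem le_indicator (x : Fin d → ℝ) (y : Fin q → ℝ) :
    g (x, y) ≤ (Metric.closedBall 0 R).indicator (fun _ => B) y := by
  by_cases hz : (x, y) ∈ S
  · rw [indicator_of_mem (by simpa using H.norm_le_of_mem hz)]
    exact H.le_on _ hz
  · rw [H.eq_zero _ hz]
    exact indicator_nonneg (fun _ _ => H.B_pos.le) _

theorem integrable_right (x : Fin d → ℝ) : Integrable fun y => g (x, y) :=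
  (integrable_indicator_closedBall R B).mono' (H.measurable_right x).aestronglyMeasurable
    (Eventually.of_forall fun y => by
      rw [Real.norm_of_nonneg (H.nonneg _)]
      exact H.le_indicator x y)

theorem measurable_marginal : Measurable (marginal g) :=
  (H.measurable.stronglyMeasurable.integral_prod_right (f := fun x y => g (x, y))).measurable

theorem marginal_nonneg (x : Fin d → ℝ) : 0 ≤ marginal g x := integral_nonneg fun _ => H.nonneg _

theorem marginal_le (x : Fin d → ℝ) :
    marginal g x ≤ B * volume.real (Metric.closedBall (0 : Fin q → ℝ) R) := by
  refine (integral_mono (H.integrable_right x) (integrable_indicator_closedBall R B)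
      (H.le_indicator x)).trans ?_
  rw [integral_indicator measurableSet_closedBall, setIntegral_const, smul_eq_mul, mul_comm]

theorem marginal_eq_zero {x : Fin d → ℝ} (hx : x ∉ Prod.fst '' S) : marginal g x = 0 := by
  have : ∀ y, g (x, y) = 0 := fun y => H.eq_zero _ fun h => hx ⟨_, h, rfl⟩
  simp [marginal, this]

theorem measurable_condDensity :
    Measurable fun z : (Fin d → ℝ) × (Fin q → ℝ) => condDensity g z.1 z.2 := by
  simp only [condDensity_eq]
  exact H.measurable.div (H.measurable_marginal.comp measurable_fst)

theorem condDensity_nonneg (x : Fin d → ℝ) (y : Fin q → ℝ) : 0 ≤ condDensity g x y :=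
  div_nonneg (H.nonneg _) (H.marginal_nonneg x)

theorem condDensity_le (x : Fin d → ℝ) (y : Fin q → ℝ) : condDensity g x y ≤ B / marginal g x :=
  div_le_div_of_nonneg_right (H.le _) (H.marginal_nonneg x)

theorem integrable_condDensity (x : Fin d → ℝ) : Integrable (condDensity g x) :=
  (H.integrable_right x).div_const _

theorem isCompact_fst : IsCompact (Prod.fst '' S) := H.compact.image continuous_fst

theorem convex_fst : Convex ℝ (Prod.fst '' S) := H.convex.linear_image (LinearMap.fst ℝ _ _)

theorem convex_section (x : Fin d → ℝ) : Convex ℝ (Prod.mk x ⁻¹' S) := by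
  intro y hy y' hy' a b ha hb hab
  have := H.convex (show (x, y) ∈ S from hy) (show (x, y') ∈ S from hy') ha hb hab
  rwa [Prod.smul_mk, Prod.smul_mk, Prod.mk_add_mk, ← add_smul, hab, one_smul] at this

theorem measurableSet_section (x : Fin d → ℝ) : MeasurableSet (Prod.mk x ⁻¹' S) :=
  measurable_prodMk_left H.compact.measurableSet

theorem section_subset (x : Fin d → ℝ) : Prod.mk x ⁻¹' S ⊆ Metric.closedBall 0 R := fun y hy => by
  simpa using H.norm_le_of_mem hy

/-- The marginal density decays at most polynomially at the boundary. -/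
theorem le_marginal_of_homothety {t : ℝ} (ht : 0 < t) (ht1 : t ≤ 1) {x : Fin d → ℝ}
    (hx : x ∈ AffineMap.homothety z₀.1 (1 - t) '' (Prod.fst '' S)) :
    m * (2 * (t * r)) ^ q ≤ marginal g x := by
  obtain ⟨_, ⟨⟨x', y'⟩, hS, rfl⟩, rfl⟩ := hx
  set x := AffineMap.homothety z₀.1 (1 - t) x' with hxdef
  set c := (1 - t) • y' + t • z₀.2
  -- The convex hull of `(x', y')` and the ball about `z₀` contains, over `x`, a ball of radius `t
  -- r`: its points are `(1 - t) (x', y') + t (z₀.1, y'')` with `y''` in the `r`-ball about `z₀.2`.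
  have hsub : Metric.closedBall c (t * r) ⊆ Prod.mk x ⁻¹' S := by
    intro y hy
    set y'' := z₀.2 + t⁻¹ • (y - c) with hy''
    have hmem : (z₀.1, y'') ∈ S := by
      refine H.ball_subset ?_
      rw [Metric.mem_closedBall, Prod.dist_eq]
      refine max_le (by simpa using H.r_pos.le) ?_
      rw [dist_eq_norm, hy'', add_sub_cancel_left, norm_smul, Real.norm_of_nonneg (by positivity),
        inv_mul_le_iff₀ ht, ← dist_eq_norm]
      exact hy
    have := H.convex hS hmem (a := 1 - t) (b := t) (sub_nonneg.2 ht1) ht.le (by ring)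
    suffices heq : (x, y) = (1 - t) • (x', y') + t • (z₀.1, y'') by
      rw [mem_preimage, heq]
      exact this
    refine Prod.ext ?_ ?_
    · ext i
      simp only [hxdef, AffineMap.homothety_apply, vsub_eq_sub, vadd_eq_add, Pi.add_apply,
        Pi.smul_apply, Pi.sub_apply, smul_eq_mul, Prod.fst_add, Prod.smul_fst]
      ring
    · ext i
      simp only [Prod.snd_add, Prod.smul_snd, Pi.add_apply, Pi.smul_apply, smul_eq_mul, hy'',
        Pi.sub_apply, c]
      field_simp
      ring
  have hvol : volume.real (Metric.closedBall c (t * r)) = (2 * (t * r)) ^ q := by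
    rw [measureReal_def, Real.volume_pi_closedBall _ (mul_nonneg ht.le H.r_pos.le),
      Fintype.card_fin,
      ENNReal.toReal_ofReal]
    have := H.r_pos
    positivity
  calc m * (2 * (t * r)) ^ q = ∫ y in Metric.closedBall c (t * r), m := by
        rw [setIntegral_const, hvol, smul_eq_mul, mul_comm]
    _ ≤ ∫ y in Metric.closedBall c (t * r), g (x, y) :=
        setIntegral_mono_on (integrableOn_const (isCompact_closedBall _ _).measure_lt_top.ne)
          (H.integrable_right x).integrableOn measurableSet_closedBall
          fun y hy => H.ge_on _ (hsub hy)
    _ ≤ marginal g x := setIntegral_le_integral (H.integrable_right x)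
        (Eventually.of_forall fun y => H.nonneg _)

/-- On the `J`-th homothetic copy the marginal is at least of order `2 ^ (-J q)`, so the logarithm
grows at most linearly in `J`, whereas the volume left outside decays geometrically. -/
theorem lintegral_log_lt_top :
    ∫⁻ x in Prod.fst '' S, ENNReal.ofReal (Real.log (1 + B / marginal g x)) < ⊤ := by
  have hB := H.B_pos
  have hr := H.r_pos
  have hm := H.m_pos
  set c : ℝ := m * (2 * r) ^ q with hc
  have hc0 : 0 < c := by positivity
  set A : ℝ := Real.log (1 + B / c) + q + 1 with hA
  have hlog0 : 0 ≤ Real.log (1 + B / c) := Real.log_nonneg (by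
    have : 0 < B / c := by positivity
    linarith)
  have hA0 : 0 < A := by positivity
  refine setLIntegral_lt_top_of_homothety H.isCompact_fst H.convex_fst (x₀ := z₀.1)
    ⟨z₀, H.center_mem, rfl⟩ (A := ENNReal.ofReal A) ENNReal.ofReal_ne_top (by simpa using hA0)
    fun J x hx => ?_
  set t : ℝ := (1 / 2 : ℝ) ^ J with ht
  have ht0 : 0 < t := by positivity
  have ht1 : t ≤ 1 := pow_le_one₀ (by norm_num) (by norm_num)
  have h1 : c * t ^ q ≤ marginal g x := by
    refine le_trans (le_of_eq ?_) (H.le_marginal_of_homothety ht0 ht1 hx)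
    rw [hc, mul_pow, mul_pow, mul_pow]
    ring
  have h2 : 1 + B / marginal g x ≤ (1 + B / c) * (2 : ℝ) ^ (J * q) := by
    have e1 : (t ^ q)⁻¹ = (2 : ℝ) ^ (J * q) := by
      rw [ht, ← pow_mul, one_div, inv_pow, inv_inv]
    have e2 : B / marginal g x ≤ B / c * (2 : ℝ) ^ (J * q) := by
      rw [← e1, ← div_eq_mul_inv, div_div]
      exact div_le_div_of_nonneg_left hB.le (by positivity) h1
    have e3 : (1 : ℝ) ≤ (2 : ℝ) ^ (J * q) := one_le_pow₀ (by norm_num)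
    linarith
  have h3 : Real.log (1 + B / marginal g x) ≤ A * (1 + J) := by
    have hpos : 0 < 1 + B / marginal g x := by
      have := div_nonneg hB.le (H.marginal_nonneg x)
      linarith
    refine (Real.log_le_log hpos h2).trans ?_
    rw [Real.log_mul (by positivity) (by positivity), Real.log_pow]
    have hl2 : Real.log 2 ≤ 1 := by
      have := Real.log_two_lt_d9
      linarith
    have hJ : (0 : ℝ) ≤ J := Nat.cast_nonneg J
    have hq : (0 : ℝ) ≤ q := Nat.cast_nonneg q
    have h4 : ((J * q : ℕ) : ℝ) * Real.log 2 ≤ J * q := by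
      push_cast
      nlinarith [mul_nonneg hJ hq]
    have h5 : A * (1 + J) = Real.log (1 + B / c) + q + 1 + Real.log (1 + B / c) * J +
        q * J + J := by
      rw [hA]
      ring
    rw [h5]
    nlinarith [mul_nonneg hlog0 hJ]
  calc ENNReal.ofReal (Real.log (1 + B / marginal g x)) ≤ ENNReal.ofReal (A * (1 + J)) :=
        ENNReal.ofReal_le_ofReal h3
    _ = ENNReal.ofReal A * (1 + J) := by
        rw [ENNReal.ofReal_mul hA0.le, ENNReal.ofReal_add zero_le_one (Nat.cast_nonneg J),
          ENNReal.ofReal_one, ENNReal.ofReal_natCast]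

end IsRegularDensity

/-! ### The scaled kernel -/

section ScaledKernel

variable {q : ℕ} {κ : (Fin q → ℝ) → ℝ} {ε : ℝ}

theorem IsKernel.hasCompactSupport (hκ : IsKernel κ) : HasCompactSupport κ :=
  HasCompactSupport.of_support_subset_isCompact isCompact_Icc
    ((subset_tsupport κ).trans hκ.support_subset)

theorem scaledKernel_nonneg (hκ : IsKernel κ) (hε : 0 < ε) (v : Fin q → ℝ) :
    0 ≤ scaledKernel κ ε v :=
  mul_nonneg (inv_nonneg.2 (pow_nonneg hε.le _)) (hκ.nonneg _)

theorem continuous_scaledKernel (hκ : IsKernel κ) : Continuous (scaledKernel κ ε) :=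
  continuous_const.mul (hκ.smooth.continuous.comp (continuous_const_smul _))

theorem norm_le_of_scaledKernel_ne_zero (hκ : IsKernel κ) (hε : 0 < ε) {v : Fin q → ℝ}
    (hv : scaledKernel κ ε v ≠ 0) : ‖v‖ ≤ ε := by
  have h1 : κ (ε⁻¹ • v) ≠ 0 := right_ne_zero_of_mul hv
  have h2 := hκ.support_subset (subset_tsupport κ h1)
  refine (pi_norm_le_iff_of_nonneg hε.le).2 fun i => ?_
  have h3 := h2.1 i
  have h4 := h2.2 i
  simp only [Pi.smul_apply, smul_eq_mul] at h3 h4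
  rw [inv_mul_eq_div] at h3 h4
  rw [Real.norm_eq_abs, abs_le]
  exact ⟨by rw [le_div_iff₀ hε] at h3; linarith, by rw [div_le_iff₀ hε] at h4; linarith⟩

theorem integrable_scaledKernel (hκ : IsKernel κ) (hε : 0 < ε) :
    Integrable (scaledKernel κ ε) :=
  ((hκ.smooth.continuous.integrable_of_hasCompactSupport hκ.hasCompactSupport).comp_smul
    (inv_ne_zero hε.ne')).const_mul _

theorem integral_scaledKernel (hκ : IsKernel κ) (hε : 0 < ε) : ∫ v, scaledKernel κ ε v = 1 := by
  simp only [scaledKernel]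
  rw [integral_const_mul, Measure.integral_comp_inv_smul, Module.finrank_fin_fun,
    hκ.integral_eq_one, abs_of_pos (by positivity), smul_eq_mul, mul_one,
    inv_mul_cancel₀ (by positivity)]

theorem lintegral_scaledKernel (hκ : IsKernel κ) (hε : 0 < ε) :
    ∫⁻ v, ENNReal.ofReal (scaledKernel κ ε v) = 1 := by
  rw [← ofReal_integral_eq_lintegral_ofReal (integrable_scaledKernel hκ hε)
    (Eventually.of_forall (scaledKernel_nonneg hκ hε)), integral_scaledKernel hκ hε,
    ENNReal.ofReal_one]

theorem exists_bound_scaledKernel (hκ : IsKernel κ) (hε : 0 < ε) :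
    ∃ C, 0 ≤ C ∧ (∀ v, scaledKernel κ ε v ≤ C) ∧
      ∀ v w, |scaledKernel κ ε v - scaledKernel κ ε w| ≤ C * ‖v - w‖ := by
  obtain ⟨C, hC⟩ := hκ.hasCompactSupport.exists_bound_of_continuous hκ.smooth.continuous
  obtain ⟨Λ, hΛ⟩ := ContDiff.lipschitzWith_of_hasCompactSupport hκ.hasCompactSupport
    hκ.smooth (by simp)
  have hC0 : 0 ≤ C := (norm_nonneg _).trans (hC 0)
  refine ⟨(ε ^ q)⁻¹ * C + (ε ^ q)⁻¹ * (Λ * ε⁻¹), by positivity, fun v => ?_, fun v w => ?_⟩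
  · have h1 : scaledKernel κ ε v ≤ (ε ^ q)⁻¹ * C :=
      mul_le_mul_of_nonneg_left ((le_abs_self _).trans (hC _)) (by positivity)
    have h2 : 0 ≤ (ε ^ q)⁻¹ * (Λ * ε⁻¹) := by positivity
    linarith
  · have h1 := hΛ.dist_le_mul (ε⁻¹ • v) (ε⁻¹ • w)
    rw [dist_eq_norm, dist_eq_norm, ← smul_sub, norm_smul, Real.norm_eq_abs,
      Real.norm_of_nonneg (inv_nonneg.2 hε.le)] at h1
    calc |scaledKernel κ ε v - scaledKernel κ ε w|
        = (ε ^ q)⁻¹ * |κ (ε⁻¹ • v) - κ (ε⁻¹ • w)| := by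
          rw [scaledKernel, scaledKernel, ← mul_sub, abs_mul, abs_of_pos (by positivity)]
      _ ≤ (ε ^ q)⁻¹ * (Λ * (ε⁻¹ * ‖v - w‖)) := by gcongr
      _ = (ε ^ q)⁻¹ * (Λ * ε⁻¹) * ‖v - w‖ := by ring
      _ ≤ _ := by
          gcongr
          have : 0 ≤ (ε ^ q)⁻¹ * C := by positivity
          linarith

end ScaledKernel

/-! ### Smoothing a density bounded below on a convex body -/

/-- The conditional density smoothed by the scaled kernel. -/
def smoothedDensity {d q : ℕ} (κ : (Fin q → ℝ) → ℝ) (ε : ℝ) (g : (Fin d → ℝ) × (Fin q → ℝ) → ℝ)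
    (x : Fin d → ℝ) (y : Fin q → ℝ) : ℝ :=
  ∫ v, scaledKernel κ ε v * condDensity g x (y - v)

namespace IsRegularDensity

variable {d q : ℕ} {S : Set ((Fin d → ℝ) × (Fin q → ℝ))} {g : (Fin d → ℝ) × (Fin q → ℝ) → ℝ}
  {m B L R r : ℝ} {z₀ : (Fin d → ℝ) × (Fin q → ℝ)} (H : IsRegularDensity S g m B L R r z₀)
  {κ : (Fin q → ℝ) → ℝ} {ε δ : ℝ}
include H

theorem smoothedDensity_nonneg (hκ : IsKernel κ) (hε : 0 < ε) (x : Fin d → ℝ) (y : Fin q → ℝ) :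
    0 ≤ smoothedDensity κ ε g x y :=
  integral_nonneg fun v => mul_nonneg (scaledKernel_nonneg hκ hε v) (H.condDensity_nonneg _ _)

theorem integrable_scaledKernel_mul_condDensity (hκ : IsKernel κ) (hε : 0 < ε) (x : Fin d → ℝ)
    (y : Fin q → ℝ) : Integrable fun v => scaledKernel κ ε v * condDensity g x (y - v) := by
  refine (integrable_scaledKernel hκ hε).mul_bdd (c := B / marginal g x) ?_
    (Eventually.of_forall fun v => ?_)
  · exact (H.measurable_condDensity.comp (measurable_const.prodMk
      (measurable_const.sub measurable_id))).aestronglyMeasurable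
  · rw [Real.norm_of_nonneg (H.condDensity_nonneg _ _)]
    exact H.condDensity_le _ _

/-- Inside the section, `p` has Lipschitz constant `L / f_X` and `log (δ + ·)` has `1 / δ`. A shift
out of the section leaves at least `log δ ≥ -1 / δ`, against an upper bound `log (1 + B / f_X)` at
`y`. -/
theorem log_condDensity_sub_le (hδ : 0 < δ) (hδ1 : δ ≤ 1) (hε : 0 < ε) {x : Fin d → ℝ}
    {y v : Fin q → ℝ} (hS : (x, y) ∈ S) (hx : 0 < marginal g x) (hv : ‖v‖ ≤ ε) :
    Real.log (δ + condDensity g x y) - (L * ε / marginal g x / δ +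
      (Real.log (1 + B / marginal g x) + 1 / δ) *
        {w | (x, y - w) ∉ S}.indicator (fun _ => (1 : ℝ)) v) ≤
      Real.log (δ + condDensity g x (y - v)) := by
  have hp := H.condDensity_nonneg x y
  have hp' := H.condDensity_nonneg x (y - v)
  have hL := H.L_nonneg
  have hB := H.B_pos
  by_cases hin : (x, y - v) ∈ S
  · rw [indicator_of_notMem (by simpa using hin), mul_zero, add_zero, sub_le_iff_le_add',
      ← sub_le_iff_le_add, ← Real.log_div (by positivity) (by positivity)]
    have h1 : condDensity g x y - condDensity g x (y - v) ≤ L * ε / marginal g x := by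
      rw [condDensity_eq, condDensity_eq, ← sub_div]
      refine div_le_div_of_nonneg_right ((le_abs_self _).trans
        ((H.lipschitz _ hS _ hin).trans ?_)) hx.le
      refine mul_le_mul_of_nonneg_left ?_ hL
      rw [Prod.dist_eq, dist_self, dist_eq_norm]
      simpa using hv
    calc Real.log ((δ + condDensity g x y) / (δ + condDensity g x (y - v)))
        ≤ (δ + condDensity g x y) / (δ + condDensity g x (y - v)) - 1 :=
          Real.log_le_sub_one_of_pos (by positivity)
      _ = (condDensity g x y - condDensity g x (y - v)) / (δ + condDensity g x (y - v)) := by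
          field_simp
          ring
      _ ≤ L * ε / marginal g x / (δ + condDensity g x (y - v)) :=
          div_le_div_of_nonneg_right h1 (by positivity)
      _ ≤ L * ε / marginal g x / δ :=
          div_le_div_of_nonneg_left (by positivity) hδ (by linarith)
  · rw [indicator_of_mem (by simpa using hin), mul_one]
    have h1 : Real.log δ ≤ Real.log (δ + condDensity g x (y - v)) :=
      Real.log_le_log hδ (by linarith)
    have h2 : Real.log (δ + condDensity g x y) ≤ Real.log (1 + B / marginal g x) := by
      refine Real.log_le_log (by positivity) ?_
      linarith [H.condDensity_le x y]
    have h3 : -Real.log δ ≤ 1 / δ := by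
      rw [← Real.log_inv, one_div]
      exact (Real.log_le_sub_one_of_pos (by positivity)).trans (by linarith)
    have h4 : 0 ≤ L * ε / marginal g x / δ := by positivity
    linarith

/-- Jensen's inequality for the concave logarithm, carried out with the tangent line at the smoothed
value `F`; the linear terms cancel because the kernel averages `p` to `F`. -/
theorem log_ratio_smoothedDensity_le (hκ : IsKernel κ) (hδ : 0 < δ) (hδ1 : δ ≤ 1) (hε : 0 < ε)
    {x : Fin d → ℝ} {y : Fin q → ℝ} (hS : (x, y) ∈ S) (hx : 0 < marginal g x) :
    Real.log ((δ + condDensity g x y) / (δ + smoothedDensity κ ε g x y)) ≤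
      L * ε / marginal g x / δ + (Real.log (1 + B / marginal g x) + 1 / δ) *
        ∫ v, scaledKernel κ ε v * {w | (x, y - w) ∉ S}.indicator (fun _ => (1 : ℝ)) v := by
  set a := L * ε / marginal g x / δ
  set b := Real.log (1 + B / marginal g x) + 1 / δ
  set I : (Fin q → ℝ) → ℝ := {w | (x, y - w) ∉ S}.indicator (fun _ => (1 : ℝ)) with hI
  set F := smoothedDensity κ ε g x y with hF
  have hF0 : 0 ≤ F := H.smoothedDensity_nonneg hκ hε x y
  have hIm : Measurable I := measurable_const.indicator
    ((measurable_const.prodMk (measurable_const.sub measurable_id)) H.compact.measurableSet).compl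
  have hk := integrable_scaledKernel hκ hε
  have hkI : Integrable fun v => scaledKernel κ ε v * I v :=
    hk.mul_bdd (c := 1) hIm.aestronglyMeasurable (Eventually.of_forall fun v => by
      simp only [I, indicator]
      split_ifs <;> simp)
  have hkp := H.integrable_scaledKernel_mul_condDensity hκ hε x y
  have hpt : ∀ v, scaledKernel κ ε v * (Real.log (δ + condDensity g x y) - a) -
      b * (scaledKernel κ ε v * I v) ≤ scaledKernel κ ε v * (Real.log (δ + F) - F / (δ + F)) +
        scaledKernel κ ε v * condDensity g x (y - v) / (δ + F) := by
    intro v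
    by_cases hv : scaledKernel κ ε v = 0
    · simp [hv]
    have h1 := H.log_condDensity_sub_le hδ hδ1 hε hS hx (norm_le_of_scaledKernel_ne_zero hκ hε hv)
    have hp' := H.condDensity_nonneg x (y - v)
    have h2 : Real.log (δ + condDensity g x (y - v)) ≤
        Real.log (δ + F) + (condDensity g x (y - v) - F) / (δ + F) := by
      rw [← sub_le_iff_le_add', ← Real.log_div (by positivity) (by positivity)]
      refine (Real.log_le_sub_one_of_pos (by positivity)).trans (le_of_eq ?_)
      field_simp
      ring
    have h3 := mul_le_mul_of_nonneg_left (h1.trans h2) (scaledKernel_nonneg hκ hε v)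
    calc scaledKernel κ ε v * (Real.log (δ + condDensity g x y) - a) -
          b * (scaledKernel κ ε v * I v)
        = scaledKernel κ ε v * (Real.log (δ + condDensity g x y) - (a + b * I v)) := by ring
      _ ≤ scaledKernel κ ε v * (Real.log (δ + F) + (condDensity g x (y - v) - F) / (δ + F)) := h3
      _ = _ := by ring
  have hmono := integral_mono ((hk.mul_const _).sub (hkI.const_mul b))
    ((hk.mul_const _).add (hkp.div_const (δ + F))) hpt
  simp only [Pi.sub_apply, Pi.add_apply] at hmono
  rw [integral_sub (hk.mul_const _) (hkI.const_mul b), integral_mul_const, integral_const_mul,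
    integral_add (hk.mul_const _) (hkp.div_const (δ + F)), integral_mul_const, integral_div,
    integral_scaledKernel hκ hε] at hmono
  change _ ≤ 1 * (Real.log (δ + F) - F / (δ + F)) + F / (δ + F) at hmono
  have hp := H.condDensity_nonneg x y
  rw [Real.log_div (by positivity) (by positivity)]
  linarith

/-- After exchanging the integrals, `v` is fixed with `‖v‖ ≤ ε`, and the `y` whose shift leaves the
convex section have volume `O(ε)`, uniformly in `x`. -/
theorem lintegral_mul_kernel_compl_le (hκ : IsKernel κ) (hε : 0 < ε) (hε1 : ε ≤ 1)
    (x : Fin d → ℝ) :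
    ∫⁻ y, ENNReal.ofReal (g (x, y)) * ∫⁻ v, ENNReal.ofReal (scaledKernel κ ε v) *
        {w | (x, y - w) ∉ S}.indicator (fun _ => (1 : ℝ≥0∞)) v ≤
      ENNReal.ofReal B * (ENNReal.ofReal ε *
        volume (Metric.closedBall (0 : Fin q → ℝ) (R + 2))) := by
  classical
  have hkm : Measurable fun v : Fin q → ℝ => ENNReal.ofReal (scaledKernel κ ε v) :=
    (continuous_scaledKernel hκ).measurable.ennreal_ofReal
  have hSm := H.measurableSet_section x
  have hset : MeasurableSet {p : (Fin q → ℝ) × (Fin q → ℝ) | (x, p.1) ∈ S ∧ (x, p.1 - p.2) ∉ S} :=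
    (measurable_fst hSm).inter ((measurable_fst.sub measurable_snd) hSm).compl
  let J : (Fin q → ℝ) → (Fin q → ℝ) → ℝ≥0∞ := fun y v =>
    {p : (Fin q → ℝ) × (Fin q → ℝ) | (x, p.1) ∈ S ∧ (x, p.1 - p.2) ∉ S}.indicator
      (fun _ => (1 : ℝ≥0∞)) (y, v)
  have hJm : Measurable (Function.uncurry J) := measurable_const.indicator hset
  have hpt : ∀ y, ENNReal.ofReal (g (x, y)) * (∫⁻ v, ENNReal.ofReal (scaledKernel κ ε v) *
        {w | (x, y - w) ∉ S}.indicator (fun _ => (1 : ℝ≥0∞)) v) ≤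
      ENNReal.ofReal B * ∫⁻ v, ENNReal.ofReal (scaledKernel κ ε v) * J y v := by
    intro y
    by_cases hy : (x, y) ∈ S
    · refine mul_le_mul' (ENNReal.ofReal_le_ofReal (H.le _)) (lintegral_mono fun v => ?_)
      simp [J, indicator, hy]
    · simp [H.eq_zero _ hy]
  have hJm2 : Measurable (Function.uncurry fun y v =>
      ENNReal.ofReal (scaledKernel κ ε v) * J y v) :=
    (hkm.comp measurable_snd).mul hJm
  calc _ ≤ ∫⁻ y, ENNReal.ofReal B * ∫⁻ v, ENNReal.ofReal (scaledKernel κ ε v) * J y v :=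
        lintegral_mono hpt
    _ = ENNReal.ofReal B * ∫⁻ v, ∫⁻ y, ENNReal.ofReal (scaledKernel κ ε v) * J y v := by
        rw [lintegral_const_mul' _ _ ENNReal.ofReal_ne_top, lintegral_lintegral_swap
          hJm2.aemeasurable]
    _ ≤ ENNReal.ofReal B * ∫⁻ v, ENNReal.ofReal (scaledKernel κ ε v) *
          (ENNReal.ofReal ε * volume (Metric.closedBall (0 : Fin q → ℝ) (R + 2))) := by
        gcongr with v
        rw [lintegral_const_mul' _ _ ENNReal.ofReal_ne_top]
        by_cases hv : scaledKernel κ ε v = 0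
        · simp [hv]
        gcongr
        have : ∀ y, J y v = {y | (x, y) ∈ S ∧ (x, y - v) ∉ S}.indicator (fun _ => (1 : ℝ≥0∞)) y :=
          fun y => rfl
        simp_rw [this]
        have hset' : MeasurableSet {y | (x, y) ∈ S ∧ (x, y - v) ∉ S} := measurable_prodMk_right hset
        rw [lintegral_indicator_const hset', one_mul]
        exact volume_diff_translate_le (H.convex_section x) hSm (H.section_subset x) hε hε1
          (norm_le_of_scaledKernel_ne_zero hκ hε hv)
    _ = _ := by
        rw [lintegral_mul_const _ hkm, lintegral_scaledKernel hκ hε, one_mul]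

/-- The `δ`-perturbed divergence between a density and its smoothing is of order `ε / δ`. -/
theorem exists_lintegral_log_ratio_smoothedDensity_le :
    ∃ C : ℝ, 0 ≤ C ∧ ∀ (κ : (Fin q → ℝ) → ℝ) (ε δ : ℝ), IsKernel κ → 0 < ε → ε ≤ 1 → 0 < δ →
      δ ≤ 1 → ∫⁻ z, ENNReal.ofReal (g z * Real.log
        ((δ + condDensity g z.1 z.2) / (δ + smoothedDensity κ ε g z.1 z.2))) ≤
          ENNReal.ofReal (C * (ε / δ)) := by
  classical
  have hL := H.L_nonneg
  have hB := H.B_pos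
  set 𝒳 : Set (Fin d → ℝ) := Prod.fst '' S
  have h𝒳 : MeasurableSet 𝒳 := H.isCompact_fst.measurableSet
  have h𝒳v : volume 𝒳 < ⊤ := H.isCompact_fst.measure_lt_top
  set V := volume (Metric.closedBall (0 : Fin q → ℝ) (R + 2))
  have hV : V < ⊤ := (isCompact_closedBall _ _).measure_lt_top
  set I := ∫⁻ x in 𝒳, ENNReal.ofReal (Real.log (1 + B / marginal g x))
  have hI : I < ⊤ := H.lintegral_log_lt_top
  -- The first term comes from the Lipschitz error inside the sections, the second from shifts
  -- across their boundary.
  set C : ℝ≥0∞ := ENNReal.ofReal L * volume 𝒳 + ENNReal.ofReal B * V * (I + volume 𝒳) with hC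
  have hCt : C ≠ ⊤ := by
    refine (ENNReal.add_lt_top.2 ⟨ENNReal.mul_lt_top ENNReal.ofReal_lt_top h𝒳v,
      ENNReal.mul_lt_top (ENNReal.mul_lt_top ENNReal.ofReal_lt_top hV)
        (ENNReal.add_lt_top.2 ⟨hI, h𝒳v⟩)⟩).ne
  refine ⟨C.toReal, ENNReal.toReal_nonneg, fun κ ε δ hκ hε hε1 hδ hδ1 => ?_⟩
  let lam : (Fin d → ℝ) × (Fin q → ℝ) → ℝ≥0∞ := fun z =>
    ∫⁻ v, ENNReal.ofReal (scaledKernel κ ε v) *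
      {w | (z.1, z.2 - w) ∉ S}.indicator (fun _ => (1 : ℝ≥0∞)) v
  let a : (Fin d → ℝ) → ℝ≥0∞ := fun x => ENNReal.ofReal (L * ε / marginal g x / δ)
  let b : (Fin d → ℝ) → ℝ≥0∞ := fun x =>
    ENNReal.ofReal (Real.log (1 + B / marginal g x)) + ENNReal.ofReal (1 / δ)
  have hlamm : Measurable lam := by
    have hset : MeasurableSet {p : ((Fin d → ℝ) × (Fin q → ℝ)) × (Fin q → ℝ) |
        (p.1.1, p.1.2 - p.2) ∉ S} :=
      (((measurable_fst.comp measurable_fst).prodMk ((measurable_snd.comp measurable_fst).sub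
        measurable_snd)) H.compact.measurableSet).compl
    have : Measurable fun p : ((Fin d → ℝ) × (Fin q → ℝ)) × (Fin q → ℝ) =>
        ENNReal.ofReal (scaledKernel κ ε p.2) *
        {p : ((Fin d → ℝ) × (Fin q → ℝ)) × (Fin q → ℝ) |
          (p.1.1, p.1.2 - p.2) ∉ S}.indicator (fun _ => (1 : ℝ≥0∞)) p :=
      ((continuous_scaledKernel hκ).measurable.ennreal_ofReal.comp measurable_snd).mul
        (measurable_const.indicator hset)
    exact this.lintegral_prod_right'
  have hmm := H.measurable_marginal
  have ham : Measurable a := ((measurable_const.div hmm).div_const δ).ennreal_ofReal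
  have hbm : Measurable b := ((Real.measurable_log.comp
    (measurable_const.add (measurable_const.div hmm))).ennreal_ofReal).add measurable_const
  have hgm : Measurable fun z => ENNReal.ofReal (g z) := H.measurable.ennreal_ofReal
  have hpt : ∀ z : (Fin d → ℝ) × (Fin q → ℝ), ENNReal.ofReal (g z * Real.log
        ((δ + condDensity g z.1 z.2) / (δ + smoothedDensity κ ε g z.1 z.2))) ≤
      a z.1 * ENNReal.ofReal (g z) + b z.1 * (ENNReal.ofReal (g z) * lam z) := by
    rintro ⟨x, y⟩
    by_cases hS : (x, y) ∈ S
    swap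
    · simp [H.eq_zero _ hS]
    -- Where the marginal vanishes, division by zero makes `p` and its smoothing zero, and the ratio
    -- is one.
    rcases (H.marginal_nonneg x).eq_or_lt with h0 | hx
    · have hp : ∀ y, condDensity g x y = 0 := fun y => by rw [condDensity_eq, ← h0, div_zero]
      have hF : smoothedDensity κ ε g x y = 0 := by simp [smoothedDensity, hp]
      simp only [hp, hF]
      rw [div_self (by linarith), Real.log_one, mul_zero, ENNReal.ofReal_zero]
      exact zero_le
    have h1 := H.log_ratio_smoothedDensity_le hκ hδ hδ1 hε hS hx
    have hlog : 0 ≤ Real.log (1 + B / marginal g x) := Real.log_nonneg (by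
      have : 0 < B / marginal g x := by positivity
      linarith)
    have h2 : ENNReal.ofReal (∫ v, scaledKernel κ ε v *
        {w | (x, y - w) ∉ S}.indicator (fun _ => (1 : ℝ)) v) = lam (x, y) := by
      rw [ofReal_integral_eq_lintegral_ofReal]
      · refine lintegral_congr fun v => ?_
        rw [ENNReal.ofReal_mul (scaledKernel_nonneg hκ hε v)]
        congr 1
        simp only [indicator]
        split_ifs <;> simp
      · refine (integrable_scaledKernel hκ hε).mul_bdd (c := 1) ?_
          (Eventually.of_forall fun v => by
            simp only [indicator]
            split_ifs <;> simp)
        exact (measurable_const.indicator ((measurable_const.prodMk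
          (measurable_const.sub measurable_id)) H.compact.measurableSet).compl).aestronglyMeasurable
      · exact Eventually.of_forall fun v => mul_nonneg (scaledKernel_nonneg hκ hε v)
          (indicator_nonneg (fun _ _ => zero_le_one) _)
    rw [ENNReal.ofReal_mul (H.nonneg _)]
    calc _ ≤ ENNReal.ofReal (g (x, y)) * (a x + b x * lam (x, y)) := by
          gcongr
          refine (ENNReal.ofReal_le_ofReal h1).trans ?_
          refine ENNReal.ofReal_add_le.trans ?_
          rw [ENNReal.ofReal_mul (by positivity), h2, ENNReal.ofReal_add hlog (by positivity)]
      _ = _ := by ring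
  have hx : ∀ x, ∫⁻ y, (a x * ENNReal.ofReal (g (x, y)) +
      b x * (ENNReal.ofReal (g (x, y)) * lam (x, y))) ≤
      𝒳.indicator (fun x => ENNReal.ofReal (L * ε / δ) +
        b x * (ENNReal.ofReal B * (ENNReal.ofReal ε * V))) x := by
    intro x
    have hgx : Measurable fun y => ENNReal.ofReal (g (x, y)) := hgm.comp measurable_prodMk_left
    have hlx : Measurable fun y => lam (x, y) := hlamm.comp measurable_prodMk_left
    have hglx : Measurable fun y => ENNReal.ofReal (g (x, y)) * lam (x, y) := hgx.mul hlx
    by_cases hx : x ∈ 𝒳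
    · rw [indicator_of_mem hx, lintegral_add_left (hgx.const_mul _), lintegral_const_mul _ hgx,
        lintegral_const_mul _ hglx]
      refine add_le_add ?_ (mul_le_mul_right (H.lintegral_mul_kernel_compl_le hκ hε hε1 x) _)
      rw [← ofReal_integral_eq_lintegral_ofReal (H.integrable_right x)
        (Eventually.of_forall fun y => H.nonneg _)]
      -- The factor `1 / f_X` cancels here, so its own integrability is never needed.
      change ENNReal.ofReal (L * ε / marginal g x / δ) * ENNReal.ofReal (marginal g x) ≤ _
      rw [← ENNReal.ofReal_mul' (H.marginal_nonneg x)]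
      refine ENNReal.ofReal_le_ofReal ?_
      rcases (H.marginal_nonneg x).eq_or_lt with h0 | hx
      · rw [← h0, mul_zero]
        positivity
      · refine le_of_eq ?_
        field_simp
    · have : ∀ y, g (x, y) = 0 := fun y => H.eq_zero _ fun h => hx ⟨_, h, rfl⟩
      simp [this]
  have hεδ : ENNReal.ofReal ε ≤ ENNReal.ofReal (ε / δ) :=
    ENNReal.ofReal_le_ofReal ((le_div_iff₀ hδ).2 (by nlinarith))
  calc ∫⁻ z, ENNReal.ofReal (g z * Real.log
        ((δ + condDensity g z.1 z.2) / (δ + smoothedDensity κ ε g z.1 z.2)))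
      ≤ ∫⁻ z : (Fin d → ℝ) × (Fin q → ℝ),
          (a z.1 * ENNReal.ofReal (g z) + b z.1 * (ENNReal.ofReal (g z) * lam z)) :=
        lintegral_mono hpt
    _ = ∫⁻ x, ∫⁻ y, (a x * ENNReal.ofReal (g (x, y)) +
          b x * (ENNReal.ofReal (g (x, y)) * lam (x, y))) := by
        rw [Measure.volume_eq_prod, lintegral_prod]
        exact (((ham.comp measurable_fst).mul hgm).add
          ((hbm.comp measurable_fst).mul (hgm.mul hlamm))).aemeasurable
    _ ≤ ∫⁻ x in 𝒳, (ENNReal.ofReal (L * ε / δ) +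
          b x * (ENNReal.ofReal B * (ENNReal.ofReal ε * V))) := by
        rw [← lintegral_indicator h𝒳]
        exact lintegral_mono hx
    _ = ENNReal.ofReal (L * ε / δ) * volume 𝒳 + (I + ENNReal.ofReal (1 / δ) * volume 𝒳) *
          (ENNReal.ofReal B * (ENNReal.ofReal ε * V)) := by
        rw [lintegral_add_left measurable_const, setLIntegral_const, lintegral_mul_const _ hbm,
          lintegral_add_right _ measurable_const, setLIntegral_const]
    _ = ENNReal.ofReal (ε / δ) * (ENNReal.ofReal L * volume 𝒳) + ENNReal.ofReal B * V *
          (ENNReal.ofReal ε * I + ENNReal.ofReal (ε / δ) * volume 𝒳) := by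
        rw [mul_div_assoc, ENNReal.ofReal_mul hL]
        have : ENNReal.ofReal (ε / δ) = ENNReal.ofReal (1 / δ) * ENNReal.ofReal ε := by
          rw [← ENNReal.ofReal_mul (by positivity)]
          congr 1
          ring
        rw [this]
        ring
    _ ≤ ENNReal.ofReal (ε / δ) * (ENNReal.ofReal L * volume 𝒳) + ENNReal.ofReal B * V *
          (ENNReal.ofReal (ε / δ) * I + ENNReal.ofReal (ε / δ) * volume 𝒳) := by
        gcongr
    _ = C * ENNReal.ofReal (ε / δ) := by rw [hC]; ring
    _ = ENNReal.ofReal (C.toReal * (ε / δ)) := by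
        rw [ENNReal.ofReal_mul ENNReal.toReal_nonneg, ENNReal.ofReal_toReal hCt]

end IsRegularDensity

/-! ### The divergence controls the `L¹` error -/

theorem abs_log_add_le {δ t T : ℝ} (hδ : 0 < δ) (hδ1 : δ ≤ 1) (ht : 0 ≤ t) (htT : t ≤ T) :
    |Real.log (δ + t)| ≤ |Real.log δ| + T := by
  have h1 : Real.log δ ≤ Real.log (δ + t) := Real.log_le_log hδ (by linarith)
  have h2 : Real.log (δ + t) ≤ T :=
    (Real.log_le_sub_one_of_pos (by linarith)).trans (by linarith)
  rw [abs_le]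
  constructor
  · linarith [neg_abs_le (Real.log δ)]
  · linarith [abs_nonneg (Real.log δ)]

namespace IsRegularDensity

variable {d q : ℕ} {S : Set ((Fin d → ℝ) × (Fin q → ℝ))} {g : (Fin d → ℝ) × (Fin q → ℝ) → ℝ}
  {m B L R r : ℝ} {z₀ : (Fin d → ℝ) × (Fin q → ℝ)} (H : IsRegularDensity S g m B L R r z₀)
  {δ : ℝ}
include H

theorem integrable : Integrable g := by
  have h1 : Integrable (S.indicator fun _ => B) :=
    (integrable_indicator_iff H.compact.measurableSet).2
      (integrableOn_const H.compact.measure_lt_top.ne)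
  refine h1.mono' H.measurable.aestronglyMeasurable (Eventually.of_forall fun z => ?_)
  rw [Real.norm_of_nonneg (H.nonneg z)]
  by_cases hz : z ∈ S
  · rw [indicator_of_mem hz]
    exact H.le_on z hz
  · rw [indicator_of_notMem hz, H.eq_zero z hz]

theorem integrable_prod_condDensity :
    Integrable fun z : (Fin d → ℝ) × (Fin q → ℝ) => condDensity g z.1 z.2 := by
  refine ⟨H.measurable_condDensity.aestronglyMeasurable, ?_⟩
  rw [hasFiniteIntegral_iff_ofReal (Eventually.of_forall fun z => H.condDensity_nonneg _ _),
    Measure.volume_eq_prod, lintegral_prod _ H.measurable_condDensity.ennreal_ofReal.aemeasurable]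
  have hx : ∀ x, ∫⁻ y, ENNReal.ofReal (condDensity g x y) ≤
      (Prod.fst '' S).indicator (fun _ => 1) x := by
    intro x
    rw [← ofReal_integral_eq_lintegral_ofReal (H.integrable_condDensity x)
      (Eventually.of_forall fun y => H.condDensity_nonneg x y)]
    rcases (H.marginal_nonneg x).eq_or_lt with h0 | hx
    · simp [condDensity_eq, ← h0]
    · rw [integral_condDensity_eq_one hx, indicator_of_mem, ENNReal.ofReal_one]
      by_contra hxS
      exact hx.ne' (H.marginal_eq_zero hxS)
  refine (lintegral_mono hx).trans_lt ?_
  rw [lintegral_indicator_const H.isCompact_fst.measurableSet, one_mul]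
  exact H.isCompact_fst.measure_lt_top

theorem integrable_mul_log_condDensity (hδ : 0 < δ) (hδ1 : δ ≤ 1) :
    Integrable fun z => g z * Real.log (δ + condDensity g z.1 z.2) := by
  have h1 : Integrable fun z => |Real.log δ| * g z + B * condDensity g z.1 z.2 :=
    (H.integrable.const_mul _).add (H.integrable_prod_condDensity.const_mul _)
  refine h1.mono' (H.measurable.mul (Real.measurable_log.comp
    (measurable_const.add H.measurable_condDensity))).aestronglyMeasurable
    (Eventually.of_forall fun z => ?_)
  have hp := H.condDensity_nonneg z.1 z.2
  rw [norm_mul, Real.norm_of_nonneg (H.nonneg z), Real.norm_eq_abs]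
  calc g z * |Real.log (δ + condDensity g z.1 z.2)|
      ≤ g z * (|Real.log δ| + condDensity g z.1 z.2) :=
        mul_le_mul_of_nonneg_left (abs_log_add_le hδ hδ1 hp le_rfl) (H.nonneg z)
    _ ≤ _ := by
        rw [mul_add, mul_comm (g z) |_|]
        gcongr
        exact H.le z

theorem integrable_mul_log {G : (Fin d → ℝ) → (Fin q → ℝ) → ℝ}
    (hG : Measurable (Function.uncurry G)) (hG0 : ∀ x y, 0 ≤ G x y) {b : ℝ}
    (hGb : ∀ x y, G x y ≤ b) (hδ : 0 < δ) (hδ1 : δ ≤ 1) :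
    Integrable fun z => g z * Real.log (δ + G z.1 z.2) :=
  H.integrable.mul_bdd (c := |Real.log δ| + b)
    (Real.measurable_log.comp (measurable_const.add hG)).aestronglyMeasurable
    (Eventually.of_forall fun _ => abs_log_add_le hδ hδ1 (hG0 _ _) (hGb _ _))

theorem integrable_mul_log_ratio {G : (Fin d → ℝ) → (Fin q → ℝ) → ℝ}
    (hG : Measurable (Function.uncurry G)) (hG0 : ∀ x y, 0 ≤ G x y) {b : ℝ}
    (hGb : ∀ x y, G x y ≤ b) (hδ : 0 < δ) (hδ1 : δ ≤ 1) :
    Integrable fun z => g z * Real.log ((δ + condDensity g z.1 z.2) / (δ + G z.1 z.2)) := by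
  refine ((H.integrable_mul_log_condDensity hδ hδ1).sub
    (H.integrable_mul_log hG hG0 hGb hδ hδ1)).congr (Eventually.of_forall fun z => ?_)
  have hp := H.condDensity_nonneg z.1 z.2
  have hg := hG0 z.1 z.2
  simp only [Pi.sub_apply]
  rw [Real.log_div (by positivity) (by positivity)]
  ring

/-- The lower bound of the conditional density on its support. -/
def condLowerBound (_ : IsRegularDensity S g m B L R r z₀) : ℝ :=
  m / (B * volume.real (Metric.closedBall (0 : Fin q → ℝ) R) + 1)

theorem condLowerBound_pos : 0 < H.condLowerBound := by
  have := H.m_pos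
  have := H.B_pos
  unfold condLowerBound
  positivity

theorem condDensity_eq_zero_or (x : Fin d → ℝ) (hx : 0 < marginal g x) (y : Fin q → ℝ) :
    condDensity g x y = 0 ∨ H.condLowerBound ≤ condDensity g x y := by
  by_cases hS : (x, y) ∈ S
  · right
    refine div_le_div₀ (H.nonneg _) (H.ge_on _ hS) hx ?_
    exact (H.marginal_le x).trans (le_add_of_nonneg_right zero_le_one)
  · left
    rw [condDensity_eq, H.eq_zero _ hS, zero_div]

/-- The constant in `lintegral_sq_le`. -/
def errorConst (H : IsRegularDensity S g m B L R r z₀) : ℝ :=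
  4 * (1 + volume.real (Prod.snd '' S)) * ((H.condLowerBound + 1) / H.condLowerBound)

theorem errorConst_pos : 0 < H.errorConst := by
  have := H.condLowerBound_pos
  unfold errorConst
  positivity

/-- The Pinsker-type inequality at a fixed `x`. Multiplying by the marginal turns `p log` into `g
log`, which is integrable in `x` as well. -/
theorem sq_integral_abs_sub_condDensity_le {G : (Fin d → ℝ) → (Fin q → ℝ) → ℝ}
    (hG : Measurable (Function.uncurry G)) (hG0 : ∀ x y, 0 ≤ G x y) {b : ℝ}
    (hGb : ∀ x y, G x y ≤ b) (hG1 : ∀ x, ∫ y in Prod.snd '' S, G x y ≤ 1)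
    (hδ : 0 < δ) (hδ1 : δ ≤ 1) {x : Fin d → ℝ} (hx : 0 < marginal g x) :
    IntegrableOn (fun y => |condDensity g x y - G x y|) (Prod.snd '' S) ∧
    marginal g x * (∫ y in Prod.snd '' S, |condDensity g x y - G x y|) ^ 2 ≤ H.errorConst *
      ((∫ y, g (x, y) * Real.log ((δ + condDensity g x y) / (δ + G x y))) +
        δ * volume.real (Prod.snd '' S) * marginal g x) := by
  set 𝒴 : Set (Fin q → ℝ) := Prod.snd '' S with h𝒴
  have h𝒴c : IsCompact 𝒴 := H.compact.image continuous_snd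
  have : IsFiniteMeasure (volume.restrict 𝒴) := ⟨by simpa using h𝒴c.measure_lt_top⟩
  have hpm : Measurable (condDensity g x) := H.measurable_condDensity.comp measurable_prodMk_left
  have hGm : Measurable (G x) := hG.comp measurable_prodMk_left
  have hpi : Integrable (condDensity g x) (volume.restrict 𝒴) :=
    (H.integrable_condDensity x).integrableOn
  have hGi : Integrable (G x) (volume.restrict 𝒴) :=
    Integrable.of_bound hGm.aestronglyMeasurable b
      (Eventually.of_forall fun y => by rw [Real.norm_of_nonneg (hG0 x y)]; exact hGb x y)
  have hzero : ∀ y, y ∉ 𝒴 → g (x, y) = 0 := fun y hy => H.eq_zero _ fun h => hy ⟨_, h, rfl⟩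
  have hp1 : ∫ y in 𝒴, condDensity g x y = 1 := by
    rw [setIntegral_eq_integral_of_forall_compl_eq_zero fun y hy => by
      rw [condDensity_eq, hzero y hy, zero_div]]
    exact integral_condDensity_eq_one hx
  have hlogm : Measurable fun y => Real.log ((δ + condDensity g x y) / (δ + G x y)) :=
    Real.measurable_log.comp ((measurable_const.add hpm).div (measurable_const.add hGm))
  have hlogb : ∀ y, |Real.log ((δ + condDensity g x y) / (δ + G x y))| ≤
      (|Real.log δ| + B / marginal g x) + (|Real.log δ| + b) := by
    intro y
    have hp := H.condDensity_nonneg x y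
    have hg := hG0 x y
    rw [Real.log_div (by positivity) (by positivity)]
    exact (abs_sub _ _).trans (add_le_add (abs_log_add_le hδ hδ1 hp (H.condDensity_le x y))
      (abs_log_add_le hδ hδ1 hg (hGb x y)))
  have hlog : Integrable (fun y => condDensity g x y *
      Real.log ((δ + condDensity g x y) / (δ + G x y))) (volume.restrict 𝒴) :=
    hpi.mul_bdd hlogm.aestronglyMeasurable (Eventually.of_forall hlogb)
  have key := sq_integral_abs_sub_le hpm hGm hpi hGi (H.condDensity_nonneg x) (hG0 x)
    H.condLowerBound_pos (H.condDensity_eq_zero_or x hx) hp1 (hG1 x) hδ hδ1 hlog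
  refine ⟨(hpi.sub hGi).abs, ?_⟩
  have hV : (volume.restrict 𝒴).real univ = volume.real 𝒴 := by simp
  rw [hV] at key
  have hK : marginal g x * ∫ y in 𝒴, condDensity g x y *
      Real.log ((δ + condDensity g x y) / (δ + G x y)) =
      ∫ y, g (x, y) * Real.log ((δ + condDensity g x y) / (δ + G x y)) := by
    have h0 : ∀ y, y ∉ 𝒴 →
        g (x, y) * Real.log ((δ + condDensity g x y) / (δ + G x y)) = 0 := fun y hy => by
      rw [hzero y hy, zero_mul]
    rw [← integral_const_mul, ← setIntegral_eq_integral_of_forall_compl_eq_zero h0]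
    refine integral_congr_ae (Eventually.of_forall fun y => ?_)
    simp only [condDensity_eq]
    field_simp
  calc marginal g x * (∫ y in 𝒴, |condDensity g x y - G x y|) ^ 2
      ≤ marginal g x * (H.errorConst * ((∫ y in 𝒴, condDensity g x y *
        Real.log ((δ + condDensity g x y) / (δ + G x y))) + δ * volume.real 𝒴)) :=
        mul_le_mul_of_nonneg_left key hx.le
    _ = H.errorConst * (marginal g x * (∫ y in 𝒴, condDensity g x y *
        Real.log ((δ + condDensity g x y) / (δ + G x y))) +
        δ * volume.real 𝒴 * marginal g x) := by ring
    _ = _ := by rw [hK]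

theorem lintegral_sq_le {G : (Fin d → ℝ) → (Fin q → ℝ) → ℝ}
    (hG : Measurable (Function.uncurry G)) (hG0 : ∀ x y, 0 ≤ G x y) {b : ℝ}
    (hGb : ∀ x y, G x y ≤ b) (hG1 : ∀ x, ∫ y in Prod.snd '' S, G x y ≤ 1)
    (hδ : 0 < δ) (hδ1 : δ ≤ 1) :
    ∫⁻ x, ENNReal.ofReal (marginal g x) *
        (∫⁻ y in Prod.snd '' S, ENNReal.ofReal |condDensity g x y - G x y|) ^ 2 ≤
      ENNReal.ofReal (H.errorConst *
        ((∫ z, g z * Real.log ((δ + condDensity g z.1 z.2) / (δ + G z.1 z.2))) +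
          δ * volume.real (Prod.snd '' S) * ∫ z, g z)) := by
  set 𝒴 : Set (Fin q → ℝ) := Prod.snd '' S with h𝒴
  let Φ : (Fin d → ℝ) → ℝ := fun x => H.errorConst *
      ((∫ y, g (x, y) * Real.log ((δ + condDensity g x y) / (δ + G x y))) +
        δ * volume.real 𝒴 * marginal g x)
  have hint := H.integrable_mul_log_ratio hG hG0 hGb hδ hδ1
  have hgi := H.integrable
  rw [Measure.volume_eq_prod] at hint hgi
  have i1 : Integrable fun x =>
      ∫ y, g (x, y) * Real.log ((δ + condDensity g x y) / (δ + G x y)) := hint.integral_prod_left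
  have i2 : Integrable (marginal g) := hgi.integral_prod_left
  have hΦi : Integrable Φ := (i1.add (i2.const_mul _)).const_mul _
  have hpt : ∀ x, 0 ≤ Φ x ∧ ENNReal.ofReal (marginal g x) *
      (∫⁻ y in 𝒴, ENNReal.ofReal |condDensity g x y - G x y|) ^ 2 ≤ ENNReal.ofReal (Φ x) := by
    intro x
    rcases (H.marginal_nonneg x).eq_or_lt with h0 | hx
    · have hae : (fun y => g (x, y)) =ᵐ[volume] 0 :=
        (integral_eq_zero_iff_of_nonneg (fun y => H.nonneg _) (H.integrable_right x)).1 h0.symm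
      have h1 : ∫ y, g (x, y) * Real.log ((δ + condDensity g x y) / (δ + G x y)) = 0 := by
        refine integral_eq_zero_of_ae ?_
        filter_upwards [hae] with y hy
        simp only [Pi.zero_apply] at hy ⊢
        rw [hy, zero_mul]
      simp [Φ, h1, ← h0]
    · obtain ⟨hi, hle⟩ := H.sq_integral_abs_sub_condDensity_le hG hG0 hGb hG1 hδ hδ1 hx
      refine ⟨le_trans (by positivity) hle, ?_⟩
      rw [← ofReal_integral_eq_lintegral_ofReal hi (Eventually.of_forall fun y => abs_nonneg _),
        ← ENNReal.ofReal_pow (integral_nonneg fun y => abs_nonneg _), ← ENNReal.ofReal_mul hx.le]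
      exact ENNReal.ofReal_le_ofReal hle
  calc _ ≤ ∫⁻ x, ENNReal.ofReal (Φ x) := lintegral_mono fun x => (hpt x).2
    _ = ENNReal.ofReal (∫ x, Φ x) := (ofReal_integral_eq_lintegral_ofReal hΦi
        (Eventually.of_forall fun x => (hpt x).1)).symm
    _ = _ := by
        congr 1
        rw [integral_const_mul, integral_add i1 (i2.const_mul _), integral_const_mul,
          Measure.volume_eq_prod,
          integral_prod _ hint, integral_prod _ hgi]
        rfl

end IsRegularDensity

/-! ### Regularity of generated densities -/

section GenDensity

variable {d q : ℕ} {κ : (Fin q → ℝ) → ℝ} {ε : ℝ} {φ ψ : (Fin d → ℝ) → (Fin q → ℝ) → (Fin q → ℝ)}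

theorem measurable_genDensity (hκ : IsKernel κ) (hφ : Measurable (Function.uncurry φ)) :
    Measurable (Function.uncurry (genDensity κ ε φ)) := by
  have h : Measurable fun p : ((Fin d → ℝ) × (Fin q → ℝ)) × (Fin q → ℝ) =>
      scaledKernel κ ε (p.1.2 - φ p.1.1 p.2) :=
    (continuous_scaledKernel hκ).measurable.comp ((measurable_snd.comp measurable_fst).sub
      (hφ.comp ((measurable_fst.comp measurable_fst).prodMk measurable_snd)))
  exact (h.stronglyMeasurable.integral_prod_right
    (f := fun (z : (Fin d → ℝ) × (Fin q → ℝ)) u => scaledKernel κ ε (z.2 - φ z.1 u))).measurable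

theorem genDensity_nonneg (hκ : IsKernel κ) (hε : 0 < ε) (x : Fin d → ℝ) (y : Fin q → ℝ) :
    0 ≤ genDensity κ ε φ x y :=
  integral_nonneg fun _ => scaledKernel_nonneg hκ hε _

theorem measurable_scaledKernel_comp (hκ : IsKernel κ) {x : Fin d → ℝ} (hφ : Measurable (φ x))
    (y : Fin q → ℝ) : Measurable fun u => scaledKernel κ ε (y - φ x u) :=
  (continuous_scaledKernel hκ).measurable.comp (measurable_const.sub hφ)

theorem integrable_scaledKernel_comp (hκ : IsKernel κ) (hε : 0 < ε) {x : Fin d → ℝ}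
    (hφ : Measurable (φ x)) (y : Fin q → ℝ) :
    Integrable (fun u => scaledKernel κ ε (y - φ x u)) (volume.restrict (cube q)) := by
  obtain ⟨C, -, hC, -⟩ := exists_bound_scaledKernel hκ hε
  refine Integrable.of_bound (measurable_scaledKernel_comp hκ hφ y).aestronglyMeasurable C
    (Eventually.of_forall fun u => ?_)
  rw [Real.norm_of_nonneg (scaledKernel_nonneg hκ hε _)]
  exact hC _

theorem genDensity_le (hκ : IsKernel κ) (hε : 0 < ε) {x : Fin d → ℝ} (hφ : Measurable (φ x)) {C : ℝ}
    (hC : ∀ v, scaledKernel κ ε v ≤ C) (y : Fin q → ℝ) : genDensity κ ε φ x y ≤ C := by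
  refine (integral_mono (integrable_scaledKernel_comp hκ hε hφ y) (integrable_const C)
    fun u => hC _).trans ?_
  simp

theorem integral_genDensity_le (hκ : IsKernel κ) (hε : 0 < ε)
    (hφ : Measurable (Function.uncurry φ)) (s : Set (Fin q → ℝ)) (x : Fin d → ℝ) :
    ∫ y in s, genDensity κ ε φ x y ≤ 1 := by
  have hφx : Measurable (φ x) := hφ.comp measurable_prodMk_left
  have hm : Measurable fun y => genDensity κ ε φ x y :=
    (measurable_genDensity hκ hφ).comp measurable_prodMk_left
  have h1 : ∫⁻ y, ENNReal.ofReal (genDensity κ ε φ x y) = 1 := by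
    have hpt : ∀ y, ENNReal.ofReal (genDensity κ ε φ x y) =
        ∫⁻ u in cube q, ENNReal.ofReal (scaledKernel κ ε (y - φ x u)) := fun y =>
      ofReal_integral_eq_lintegral_ofReal (integrable_scaledKernel_comp hκ hε hφx y)
        (Eventually.of_forall fun u => scaledKernel_nonneg hκ hε _)
    simp_rw [hpt]
    rw [lintegral_lintegral_swap]
    · have : ∀ u, ∫⁻ y, ENNReal.ofReal (scaledKernel κ ε (y - φ x u)) = 1 := fun u => by
        rw [lintegral_sub_right_eq_self (fun y => ENNReal.ofReal (scaledKernel κ ε y)) (φ x u),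
          lintegral_scaledKernel hκ hε]
      simp [this]
    · exact ((continuous_scaledKernel hκ).measurable.comp
        (measurable_fst.sub (hφx.comp measurable_snd))).ennreal_ofReal.aemeasurable
  rw [integral_eq_lintegral_of_nonneg_ae
    (Eventually.of_forall fun y => genDensity_nonneg hκ hε x y) hm.aestronglyMeasurable]
  refine ENNReal.toReal_le_of_le_ofReal zero_le_one ?_
  rw [ENNReal.ofReal_one, ← h1]
  exact setLIntegral_le_lintegral _ _

/-- Allowing both the points and the generators to differ covers two uses: the Lipschitz bound of a
single `φ`, and the comparison of a network with the ideal generator. -/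
theorem abs_genDensity_sub_le (hκ : IsKernel κ) (hε : 0 < ε) {x x' : Fin d → ℝ}
    (hφ : Measurable (φ x)) (hψ : Measurable (ψ x')) {C : ℝ} (hC0 : 0 ≤ C)
    (hC : ∀ v w, |scaledKernel κ ε v - scaledKernel κ ε w| ≤ C * ‖v - w‖) (y y' : Fin q → ℝ)
    (hint : Integrable (fun u => φ x u - ψ x' u) (volume.restrict (cube q))) :
    |genDensity κ ε φ x y - genDensity κ ε ψ x' y'| ≤
      C * (‖y - y'‖ + ∫ u in cube q, ‖φ x u - ψ x' u‖) := by
  have h1 := integrable_scaledKernel_comp hκ hε hφ y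
  have h2 := integrable_scaledKernel_comp hκ hε hψ y'
  rw [genDensity, genDensity, ← integral_sub h1 h2]
  refine (abs_integral_le_integral_abs).trans ?_
  have h3 : Integrable (fun u => C * (‖y - y'‖ + ‖φ x u - ψ x' u‖)) (volume.restrict (cube q)) :=
    ((integrable_const _).add hint.norm).const_mul C
  refine (integral_mono (h1.sub h2).abs h3 fun u => ?_).trans (le_of_eq ?_)
  · refine (hC _ _).trans (mul_le_mul_of_nonneg_left ?_ hC0)
    rw [sub_sub_sub_comm]
    exact norm_sub_le _ _
  · rw [integral_const_mul, integral_add (integrable_const _) hint.norm]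
    simp

variable {ρ : ℝ → ℝ} {k : ℕ}

/-- The equi-Lipschitz property behind the uniform law: the constant involves `φ` only through `M`.
A bound averaged over `u` is enough because the generated density is itself such an average. -/
theorem abs_genDensity_sub_le_of_mem_hypClass (hκ : IsKernel κ) (hε : 0 < ε) (hk : 2 ≤ k)
    (hρ : ContDiff ℝ k ρ) {K : Set (Fin d → ℝ)} (hKc : Convex ℝ K) (hKi : (interior K).Nonempty)
    {M : ℝ} (hM : 0 ≤ M) (hφ : φ ∈ hypClass ρ k K M) {C : ℝ} (hC0 : 0 ≤ C)
    (hC : ∀ v w, |scaledKernel κ ε v - scaledKernel κ ε w| ≤ C * ‖v - w‖)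
    {z z' : (Fin d → ℝ) × (Fin q → ℝ)} (hz : z.1 ∈ K) (hz' : z'.1 ∈ K) :
    |genDensity κ ε φ z.1 z.2 - genDensity κ ε φ z'.1 z'.2| ≤ C * (1 + d * M) * dist z z' := by
  have hcont : Continuous (Function.uncurry φ) := hφ.1.continuous hρ.continuous
  have hmeas : ∀ x, Measurable (φ x) := fun x => (hcont.comp (by fun_prop : Continuous
    fun u : Fin q → ℝ => (x, u))).measurable
  have hle := lintegral_edist_le_of_mem_hypClass hk hρ hKc hKi hφ hz hz'
  have henorm : ∀ u, edist (φ z.1 u) (φ z'.1 u) = ENNReal.ofReal ‖φ z.1 u - φ z'.1 u‖ := fun u => by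
    rw [edist_dist, dist_eq_norm]
  simp_rw [henorm] at hle
  have hrhs : (d : ℝ≥0∞) * ENNReal.ofReal M * edist z.1 z'.1 =
      ENNReal.ofReal (d * M * dist z.1 z'.1) := by
    rw [edist_dist, ENNReal.ofReal_mul (by positivity), ENNReal.ofReal_mul (by positivity),
      ENNReal.ofReal_natCast]
  rw [hrhs] at hle
  have hint : Integrable (fun u => φ z.1 u - φ z'.1 u) (volume.restrict (cube q)) := by
    refine ⟨((hmeas _).sub (hmeas _)).aestronglyMeasurable, ?_⟩
    rw [hasFiniteIntegral_iff_norm]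
    exact hle.trans_lt ENNReal.ofReal_lt_top
  have hI : ∫ u in cube q, ‖φ z.1 u - φ z'.1 u‖ ≤ d * M * dist z.1 z'.1 := by
    rw [integral_eq_lintegral_of_nonneg_ae (Eventually.of_forall fun u => norm_nonneg _)
      hint.norm.aestronglyMeasurable]
    exact ENNReal.toReal_le_of_le_ofReal (by positivity) hle
  refine (abs_genDensity_sub_le hκ hε (hmeas _) (hmeas _) hC0 hC _ _ hint).trans ?_
  rw [mul_assoc]
  refine mul_le_mul_of_nonneg_left ?_ hC0
  have h1 : dist z.1 z'.1 ≤ dist z z' := le_max_left _ _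
  have h2 : ‖z.2 - z'.2‖ ≤ dist z z' := by
    rw [← dist_eq_norm]
    exact le_max_right _ _
  have h3 : (d : ℝ) * M * dist z.1 z'.1 ≤ d * M * dist z z' := by gcongr
  linarith

end GenDensity

/-! ### A generator of the conditional distribution -/

theorem map_projIcc_eval_volume_cube {q : ℕ} (i : Fin q) :
    (volume.restrict (cube q)).map (fun u => projIcc (0 : ℝ) 1 zero_le_one (u i)) =
      (volume : Measure unitInterval) := by
  have h1 : volume.restrict (cube q) =
      Measure.pi fun _ : Fin q => volume.restrict (Icc (0 : ℝ) 1) := by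
    rw [← Measure.restrict_pi_pi, cube, ← pi_univ_Icc]
    rfl
  have hprob : IsProbabilityMeasure (volume.restrict (Icc (0 : ℝ) 1)) := ⟨by simp⟩
  have h2 : (Measure.pi fun _ : Fin q => volume.restrict (Icc (0 : ℝ) 1)).map
      (fun u : Fin q → ℝ => u i) = volume.restrict (Icc (0 : ℝ) 1) :=
    (measurePreserving_eval (fun _ : Fin q => volume.restrict (Icc (0 : ℝ) 1)) i).map_eq
  have hproj : Measurable (projIcc (0 : ℝ) 1 zero_le_one) := continuous_projIcc.measurable
  have hi : Measurable fun u : Fin q → ℝ => u i := measurable_pi_apply i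
  rw [h1, ← Function.comp_def (projIcc (0 : ℝ) 1 zero_le_one) fun u : Fin q → ℝ => u i,
    ← Measure.map_map hproj hi, h2, ← map_comap_subtype_coe measurableSet_Icc,
    Measure.map_map hproj measurable_subtype_coe]
  have : projIcc (0 : ℝ) 1 zero_le_one ∘ Subtype.val = id := funext fun t => projIcc_val _ t
  rw [this, Measure.map_id]
  rfl

namespace IsRegularDensity

variable {d q : ℕ} {S : Set ((Fin d → ℝ) × (Fin q → ℝ))} {g : (Fin d → ℝ) × (Fin q → ℝ) → ℝ}
  {m B L R r : ℝ} {z₀ : (Fin d → ℝ) × (Fin q → ℝ)} (H : IsRegularDensity S g m B L R r z₀)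
include H

/-- The conditional distribution is the law of `T(x, U)` for a bounded measurable map `T`. -/
theorem exists_generator (hq : 1 ≤ q) :
    ∃ T : (Fin d → ℝ) → (Fin q → ℝ) → (Fin q → ℝ), Measurable (Function.uncurry T) ∧
      (∀ x u, ‖T x u‖ ≤ R) ∧ ∀ (κ : (Fin q → ℝ) → ℝ) (ε : ℝ), IsKernel κ →
        ∀ x, 0 < marginal g x → ∀ y, genDensity κ ε T x y = smoothedDensity κ ε g x y := by
  classical
  have hpm : Measurable (Function.uncurry fun x y => ENNReal.ofReal (condDensity g x y)) :=
    H.measurable_condDensity.ennreal_ofReal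
  let K₁ : Kernel (Fin d → ℝ) (Fin q → ℝ) :=
    (Kernel.const _ volume).withDensity fun x y => ENNReal.ofReal (condDensity g x y)
  have hK₁ : ∀ x, K₁ x = volume.withDensity fun y => ENNReal.ofReal (condDensity g x y) :=
      fun x => by
    rw [Kernel.withDensity_apply _ hpm, Kernel.const_apply]
  have hA : MeasurableSet {x | 0 < marginal g x} := measurableSet_lt measurable_const
    H.measurable_marginal
  -- The Dirac mass where the marginal vanishes makes the kernel Markov everywhere.
  let K : Kernel (Fin d → ℝ) (Fin q → ℝ) :=
    Kernel.piecewise hA K₁ (Kernel.const _ (Measure.dirac 0))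
  have hK : ∀ x, 0 < marginal g x →
      K x = volume.withDensity fun y => ENNReal.ofReal (condDensity g x y) := fun x hx => by
    rw [Kernel.piecewise_apply, if_pos (show x ∈ {x | 0 < marginal g x} from hx), hK₁]
  have hKm : IsMarkovKernel K := by
    refine ⟨fun x => ⟨?_⟩⟩
    by_cases hx : 0 < marginal g x
    · rw [hK x hx, withDensity_apply _ MeasurableSet.univ, setLIntegral_univ,
        ← ofReal_integral_eq_lintegral_ofReal (H.integrable_condDensity x)
          (Eventually.of_forall (H.condDensity_nonneg x)), integral_condDensity_eq_one hx,
        ENNReal.ofReal_one]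
    · rw [Kernel.piecewise_apply, if_neg (show x ∉ {x | 0 < marginal g x} from hx),
        Kernel.const_apply]
      simp
  -- Every such kernel is the image of the uniform law on `[0, 1]` under a jointly measurable map,
  -- so one coordinate of `U` suffices.
  obtain ⟨f, hfm, hf⟩ := Kernel.exists_measurable_map_eq_unitInterval K
  let i₀ : Fin q := ⟨0, hq⟩
  -- Truncation bounds the generator at every point and leaves the law unchanged where the marginal
  -- is positive, as `p(x, ·)` vanishes outside this ball.
  let c : (Fin q → ℝ) → (Fin q → ℝ) := (Metric.closedBall 0 R).indicator id
  have hc : Measurable c := measurable_id.indicator measurableSet_closedBall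
  let π : (Fin q → ℝ) → unitInterval := fun u => projIcc (0 : ℝ) 1 zero_le_one (u i₀)
  have hπ : Measurable π := continuous_projIcc.measurable.comp (measurable_pi_apply i₀)
  refine ⟨fun x u => c (f x (π u)), ?_, fun x u => ?_, fun κ ε hκ x hx y => ?_⟩
  · exact hc.comp (hfm.comp (measurable_fst.prodMk (hπ.comp measurable_snd)))
  · by_cases h : f x (π u) ∈ Metric.closedBall 0 R
    · simpa [c, indicator_of_mem h] using h
    · simpa [c, indicator_of_notMem h] using H.R_nonneg
  · have hkc : Continuous (scaledKernel κ ε) := continuous_scaledKernel hκ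
    have hfx : Measurable (f x) := hfm.comp measurable_prodMk_left
    have hs : Measurable fun w => scaledKernel κ ε (y - c w) :=
      hkc.measurable.comp (measurable_const.sub hc)
    calc genDensity κ ε (fun x u => c (f x (π u))) x y
        = ∫ t, scaledKernel κ ε (y - c (f x t)) ∂((volume.restrict (cube q)).map π) :=
          (integral_map hπ.aemeasurable (hs.comp hfx).aestronglyMeasurable).symm
      _ = ∫ t : unitInterval, scaledKernel κ ε (y - c (f x t)) := by
          rw [map_projIcc_eval_volume_cube]
      _ = ∫ w, scaledKernel κ ε (y - c w) ∂(Measure.map (f x) volume) :=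
          (integral_map hfx.aemeasurable hs.aestronglyMeasurable).symm
      _ = ∫ w, condDensity g x w * scaledKernel κ ε (y - c w) := by
          have hpx : Measurable fun w => ENNReal.ofReal (condDensity g x w) :=
            (H.measurable_condDensity.comp measurable_prodMk_left).ennreal_ofReal
          rw [hf x, hK x hx, integral_withDensity_eq_integral_toReal_smul hpx
            (Eventually.of_forall fun _ => ENNReal.ofReal_lt_top)]
          refine integral_congr_ae (Eventually.of_forall fun w => ?_)
          simp only [smul_eq_mul]
          rw [ENNReal.toReal_ofReal (H.condDensity_nonneg x w)]
      _ = ∫ w, condDensity g x w * scaledKernel κ ε (y - w) := by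
          refine integral_congr_ae (Eventually.of_forall fun w => ?_)
          by_cases hw : w ∈ Metric.closedBall (0 : Fin q → ℝ) R
          · simp [c, indicator_of_mem hw]
          · have : g (x, w) = 0 := H.eq_zero _ fun h => hw (H.section_subset x h)
            simp [condDensity_eq, this]
      _ = ∫ v, condDensity g x (y - v) * scaledKernel κ ε v := by
          rw [← integral_sub_left_eq_self _ volume y]
          simp
      _ = smoothedDensity κ ε g x y := by
          simp only [smoothedDensity, mul_comm]

end IsRegularDensity

/-! ### The law of the sample -/

/-- Compactness makes the image closed; a closed set of full measure contains the support. It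
identifies the marginal supports with the projections of `S`. -/
theorem support_map_eq_image {E F : Type*} [TopologicalSpace E] [MeasurableSpace E] [BorelSpace E]
    [HereditarilyLindelofSpace E] [TopologicalSpace F] [MeasurableSpace F] [BorelSpace F]
    [T2Space F]
    {μ : Measure E} (hμ : IsCompact μ.support) {φ : E → F} (hφ : Continuous φ) :
    (μ.map φ).support = φ '' μ.support := by
  apply Subset.antisymm
  · have hc : IsClosed (φ '' μ.support) := (hμ.image hφ).isClosed
    refine Measure.support_subset_of_isClosed hc ?_
    rw [mem_ae_iff, Measure.map_apply hφ.measurable hc.measurableSet.compl]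
    refine measure_mono_null (fun z hz hz' => hz ⟨z, hz', rfl⟩)
      (Measure.measure_compl_support (μ := μ))
  · rintro _ ⟨z, hz, rfl⟩
    rw [Measure.mem_support_iff_forall] at hz ⊢
    intro U hU
    exact (hz _ (hφ.continuousAt hU)).trans_le (Measure.le_map_apply hφ.aemeasurable U)

/-- A density may be nonzero on a null set outside the support; this permits replacing it by the
version that vanishes there. -/
theorem ae_eq_indicator_support {E : Type*} [TopologicalSpace E] [MeasurableSpace E] [BorelSpace E]
    [HereditarilyLindelofSpace E] {ν : Measure E} {f : E → ℝ} (hf : Measurable f)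
    (hf0 : ∀ z, 0 ≤ f z) :
    f =ᵐ[ν] ((ν.withDensity fun z => ENNReal.ofReal (f z)).support).indicator f := by
  set S := (ν.withDensity fun z => ENNReal.ofReal (f z)).support
  have h0 : (ν.withDensity fun z => ENNReal.ofReal (f z)) Sᶜ = 0 := Measure.measure_compl_support
  have hS : MeasurableSet Sᶜ := Measure.isClosed_support.measurableSet.compl
  rw [withDensity_apply _ hS, lintegral_eq_zero_iff hf.ennreal_ofReal, EventuallyEq,
    ae_restrict_iff' hS] at h0
  filter_upwards [h0] with z hz
  by_cases h : z ∈ S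
  · rw [indicator_of_mem h]
  · rw [indicator_of_notMem h]
    exact le_antisymm (ENNReal.ofReal_eq_zero.1 (hz h)) (hf0 z)

theorem condDensity_ae_congr {d q : ℕ} {f g : (Fin d → ℝ) × (Fin q → ℝ) → ℝ} (h : f =ᵐ[volume] g) :
    ∀ᵐ x : Fin d → ℝ, condDensity f x =ᵐ[volume] condDensity g x := by
  rw [Measure.volume_eq_prod] at h
  filter_upwards [Measure.ae_ae_of_ae_prod h] with x hx
  have : ∫ y, f (x, y) = ∫ y, g (x, y) := integral_congr_ae hx
  filter_upwards [hx] with y hy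
  simp only [condDensity, this, hy]

theorem l1Error_congr {d q : ℕ} {μX : Measure (Fin d → ℝ)} (hμ : μX ≪ volume)
    {f g : (Fin d → ℝ) × (Fin q → ℝ) → ℝ} (h : f =ᵐ[volume] g) (s : Set (Fin q → ℝ))
    (G : (Fin d → ℝ) → (Fin q → ℝ) → ℝ) : l1Error μX s f G = l1Error μX s g G := by
  unfold l1Error
  congr 1
  refine lintegral_congr_ae ?_
  filter_upwards [hμ.ae_le (condDensity_ae_congr h)] with x hx
  congr 1
  refine lintegral_congr_ae (ae_restrict_of_ae ?_)
  filter_upwards [hx] with y hy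
  rw [hy]

/-- `ℝ^{d+q} ≅ ℝ^d × ℝ^q` as a homeomorphism. -/
def splitHomeo (d q : ℕ) : (Fin d ⊕ Fin q → ℝ) ≃ₜ (Fin d → ℝ) × (Fin q → ℝ) where
  toFun := splitCoords
  invFun z := Sum.elim z.1 z.2
  left_inv z := by
    ext i
    cases i <;> rfl
  right_inv _ := rfl
  continuous_toFun := by
    unfold splitCoords
    fun_prop
  continuous_invFun := by
    refine continuous_pi fun i => ?_
    cases i
    · exact (continuous_apply _).comp continuous_fst
    · exact (continuous_apply _).comp continuous_snd

theorem dist_splitHomeo_symm_le {d q : ℕ} (z z' : (Fin d → ℝ) × (Fin q → ℝ)) :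
    dist ((splitHomeo d q).symm z) ((splitHomeo d q).symm z') ≤ dist z z' := by
  rw [dist_pi_le_iff dist_nonneg]
  intro i
  cases i with
  | inl i => exact (dist_le_pi_dist z.1 z'.1 i).trans (le_max_left _ _)
  | inr i => exact (dist_le_pi_dist z.2 z'.2 i).trans (le_max_right _ _)

/-- A positive `C^k` density on a convex body is regular. -/
theorem exists_isRegularDensity {d q k : ℕ} (hk : 2 ≤ k) {S : Set ((Fin d → ℝ) × (Fin q → ℝ))}
    (hS : IsCompact S) (hSc : Convex ℝ S) (hSi : (interior S).Nonempty)
    {f : (Fin d → ℝ) × (Fin q → ℝ) → ℝ} (hfm : Measurable f)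
    (hf : IsCk k (splitCoords ⁻¹' S) fun z => f (splitCoords z)) (hpos : ∀ z ∈ S, 0 < f z) :
    ∃ m B L R r z₀, IsRegularDensity S (S.indicator f) m B L R r z₀ := by
  let e := splitHomeo d q
  have hes : ∀ z, splitCoords (e.symm z) = z := fun z => e.apply_symm_apply z
  have hfc : ContinuousOn f S := by
    have := hf.1.comp (s := S) e.symm.continuous.continuousOn fun z hz => by
      rw [mem_preimage, hes]
      exact hz
    exact this.congr fun z _ => by simp only [Function.comp, hes]
  obtain ⟨z₀, hz₀⟩ := hSi
  obtain ⟨r, hr, hrS⟩ := Metric.nhds_basis_closedBall.mem_iff.1 (mem_interior_iff_mem_nhds.1 hz₀)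
  obtain ⟨R, hR⟩ := hS.isBounded.subset_closedBall 0
  have hne : S.Nonempty := ⟨z₀, interior_subset hz₀⟩
  obtain ⟨a, ha, hamin⟩ := hS.exists_isMinOn hne hfc
  obtain ⟨b, hb, hbmax⟩ := hS.exists_isMaxOn hne hfc
  have hKc : Convex ℝ (splitCoords ⁻¹' S : Set (Fin d ⊕ Fin q → ℝ)) := by
    intro u hu v hv s t hs ht hst
    exact hSc hu hv hs ht hst
  have hKi : (interior (splitCoords ⁻¹' S : Set (Fin d ⊕ Fin q → ℝ))).Nonempty := by
    have : splitCoords ⁻¹' (interior S) = interior (splitCoords ⁻¹' S) := e.preimage_interior S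
    rw [← this]
    exact ⟨e.symm z₀, by rw [mem_preimage, hes]; exact hz₀⟩
  set N := (Fintype.card (Fin d ⊕ Fin q) : ℝ≥0∞) *
    ckNorm k (splitCoords ⁻¹' S) fun z => f (splitCoords z) with hN
  have hNt : N ≠ ⊤ := ENNReal.mul_ne_top (ENNReal.natCast_ne_top _) hf.2.2.ne
  have hfd : DifferentiableOn ℝ (fun z => f (splitCoords z))
      (interior (splitCoords ⁻¹' S : Set (Fin d ⊕ Fin q → ℝ))) :=
    hf.2.1.differentiableOn (by exact_mod_cast (by omega : k - 1 ≠ 0))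
  refine ⟨f a, f b, N.toReal, R, r, z₀, ?_⟩
  exact
    { compact := hS
      convex := hSc
      ball_subset := hrS
      subset_ball := hR
      r_pos := hr
      m_pos := hpos a ha
      measurable := hfm.indicator hS.measurableSet
      ge_on := fun z hz => by
        rw [indicator_of_mem hz]
        exact hamin hz
      le_on := fun z hz => by
        rw [indicator_of_mem hz]
        exact hbmax hz
      eq_zero := fun z hz => indicator_of_notMem hz _
      L_nonneg := ENNReal.toReal_nonneg
      lipschitz := fun z hz z' hz' => by
        rw [indicator_of_mem hz, indicator_of_mem hz']
        have h1 := edist_le_ckNorm_mul hk hKc hKi hf.1 hfd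
          (show e.symm z ∈ splitCoords ⁻¹' S by rw [mem_preimage, hes]; exact hz)
          (show e.symm z' ∈ splitCoords ⁻¹' S by rw [mem_preimage, hes]; exact hz')
        rw [hes, hes, ← hN] at h1
        have h2 := ENNReal.toReal_mono (ENNReal.mul_ne_top hNt (edist_ne_top _ _)) h1
        rw [ENNReal.toReal_mul, ← dist_edist, ← dist_edist, Real.dist_eq] at h2
        exact h2.trans (mul_le_mul_of_nonneg_left (dist_splitHomeo_symm_le z z')
          ENNReal.toReal_nonneg) }

namespace IsRegularDensity

variable {d q : ℕ} {S : Set ((Fin d → ℝ) × (Fin q → ℝ))} {g : (Fin d → ℝ) × (Fin q → ℝ) → ℝ}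
  {m B L R r : ℝ} {z₀ : (Fin d → ℝ) × (Fin q → ℝ)} (H : IsRegularDensity S g m B L R r z₀)
include H

theorem integral_withDensity (l : (Fin d → ℝ) × (Fin q → ℝ) → ℝ) :
    ∫ z, l z ∂(volume.withDensity fun z => ENNReal.ofReal (g z)) = ∫ z, g z * l z := by
  rw [integral_withDensity_eq_integral_toReal_smul H.measurable.ennreal_ofReal
    (Eventually.of_forall fun _ => ENNReal.ofReal_lt_top)]
  refine integral_congr_ae (Eventually.of_forall fun z => ?_)
  simp only [smul_eq_mul]
  rw [ENNReal.toReal_ofReal (H.nonneg z)]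

theorem map_fst_withDensity :
    (volume.withDensity fun z => ENNReal.ofReal (g z)).map Prod.fst =
      volume.withDensity fun x => ENNReal.ofReal (marginal g x) := by
  ext s hs
  rw [Measure.map_apply measurable_fst hs, withDensity_apply _ (measurable_fst hs),
    withDensity_apply _ hs, ← lintegral_indicator (measurable_fst hs), Measure.volume_eq_prod,
    lintegral_prod _ ((H.measurable.ennreal_ofReal.indicator (measurable_fst hs)).aemeasurable),
    ← lintegral_indicator hs]
  refine lintegral_congr fun x => ?_
  by_cases hx : x ∈ s
  · rw [indicator_of_mem hx, marginal, ofReal_integral_eq_lintegral_ofReal (H.integrable_right x)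
      (Eventually.of_forall fun y => H.nonneg _)]
    exact lintegral_congr fun y => indicator_of_mem (show (x, y) ∈ Prod.fst ⁻¹' s from hx) _
  · rw [indicator_of_notMem hx]
    refine (lintegral_congr fun y => ?_).trans lintegral_zero
    exact indicator_of_notMem (show (x, y) ∉ Prod.fst ⁻¹' s from hx) _

/-- The error of a bounded subprobability density in terms of the regularized relative entropy. -/
theorem l1Error_le {G : (Fin d → ℝ) → (Fin q → ℝ) → ℝ} {b δ : ℝ}
    (hG : Measurable (Function.uncurry G)) (hG0 : ∀ x y, 0 ≤ G x y)
    (hGb : ∀ x y, G x y ≤ b) (hG1 : ∀ x, ∫ y in Prod.snd '' S, G x y ≤ 1)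
    (hδ : 0 < δ) (hδ1 : δ ≤ 1) :
    l1Error (volume.withDensity fun x => ENNReal.ofReal (marginal g x)) (Prod.snd '' S) g G ≤
      ENNReal.ofReal (√(H.errorConst *
        ((∫ z, g z * Real.log ((δ + condDensity g z.1 z.2) / (δ + G z.1 z.2))) +
          δ * volume.real (Prod.snd '' S) * ∫ z, g z))) := by
  set A := H.errorConst *
        ((∫ z, g z * Real.log ((δ + condDensity g z.1 z.2) / (δ + G z.1 z.2))) +
          δ * volume.real (Prod.snd '' S) * ∫ z, g z)
  unfold l1Error
  have h1 : ∫⁻ x, (∫⁻ y in Prod.snd '' S, ENNReal.ofReal |condDensity g x y - G x y|) ^ 2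
      ∂(volume.withDensity fun x => ENNReal.ofReal (marginal g x)) ≤ ENNReal.ofReal A :=
    (lintegral_withDensity_le_lintegral_mul _ H.measurable_marginal.ennreal_ofReal _).trans
      (H.lintegral_sq_le hG hG0 hGb hG1 hδ hδ1)
  refine (ENNReal.rpow_le_rpow h1 (by norm_num)).trans ?_
  rcases le_total 0 A with hA | hA
  · rw [ENNReal.ofReal_rpow_of_nonneg hA (by norm_num), Real.sqrt_eq_rpow]
  · rw [ENNReal.ofReal_eq_zero.2 hA, ENNReal.zero_rpow_of_pos (by norm_num)]
    exact zero_le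

end IsRegularDensity

/-! ### Networks with small relative entropy -/

theorem abs_log_add_sub_log_add_le {δ s t : ℝ} (hδ : 0 < δ) (hs : 0 ≤ s) (ht : 0 ≤ t) :
    |Real.log (δ + s) - Real.log (δ + t)| ≤ |s - t| / δ := by
  have key : ∀ s t : ℝ, 0 ≤ s → 0 ≤ t → Real.log (δ + s) - Real.log (δ + t) ≤ |s - t| / δ := by
    intro s t hs ht
    rw [← Real.log_div (by positivity) (by positivity)]
    refine (Real.log_le_sub_one_of_pos (by positivity)).trans ?_
    rw [div_sub_one (by positivity : δ + t ≠ 0), add_sub_add_left_eq_sub]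
    calc (s - t) / (δ + t) ≤ |s - t| / (δ + t) := by gcongr; exact le_abs_self _
      _ ≤ |s - t| / δ := by gcongr; linarith
  rw [abs_sub_le_iff]
  exact ⟨key s t hs ht, abs_sub_comm s t ▸ key t s ht hs⟩

theorem integral_log_sub_log_le {E : Type*} [MeasurableSpace E] {μ : Measure E} {a b : E → ℝ}
    {δ : ℝ} (hδ : 0 < δ) (ha : ∀ z, 0 ≤ a z) (hb : ∀ z, 0 ≤ b z)
    (hi : Integrable (fun z => Real.log (δ + a z) - Real.log (δ + b z)) μ)
    (hd : Integrable (fun z => a z - b z) μ) :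
    ∫ z, (Real.log (δ + a z) - Real.log (δ + b z)) ∂μ ≤ (∫ z, |a z - b z| ∂μ) / δ := by
  rw [← integral_div]
  refine integral_mono hi (hd.abs.div_const _) fun z => ?_
  exact (le_abs_self _).trans (abs_log_add_sub_log_add_le hδ (ha z) (hb z))

theorem integral_le_of_lintegral_ofReal_le {E : Type*} [MeasurableSpace E] {μ : Measure E}
    {h : E → ℝ} (hi : Integrable h μ) {c : ℝ} (hc : 0 ≤ c)
    (hle : ∫⁻ z, ENNReal.ofReal (h z) ∂μ ≤ ENNReal.ofReal c) : ∫ z, h z ∂μ ≤ c := by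
  rw [integral_eq_lintegral_pos_part_sub_lintegral_neg_part hi]
  exact (sub_le_self _ ENNReal.toReal_nonneg).trans (ENNReal.toReal_le_of_le_ofReal hc hle)

namespace IsRegularDensity

variable {d q : ℕ} {S : Set ((Fin d → ℝ) × (Fin q → ℝ))} {g : (Fin d → ℝ) × (Fin q → ℝ) → ℝ}
  {m B L R r : ℝ} {z₀ : (Fin d → ℝ) × (Fin q → ℝ)} (H : IsRegularDensity S g m B L R r z₀)
  {ρ : ℝ → ℝ}
include H

theorem isFiniteMeasure_withDensity :
    IsFiniteMeasure (volume.withDensity fun z => ENNReal.ofReal (g z)) :=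
  isFiniteMeasure_withDensity_ofReal H.integrable.2

theorem isFiniteMeasure_withDensity_marginal :
    IsFiniteMeasure (volume.withDensity fun x => ENNReal.ofReal (marginal g x)) := by
  have := H.isFiniteMeasure_withDensity
  rw [← H.map_fst_withDensity]
  infer_instance

theorem ae_withDensity_mem_fst :
    ∀ᵐ x ∂(volume.withDensity fun x => ENNReal.ofReal (marginal g x)), x ∈ Prod.fst '' S := by
  rw [ae_withDensity_iff H.measurable_marginal.ennreal_ofReal]
  refine Eventually.of_forall fun x hx => ?_
  by_contra h
  simp [H.marginal_eq_zero h] at hx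

theorem ae_marginal_pos :
    ∀ᵐ z ∂(volume.withDensity fun z => ENNReal.ofReal (g z)), 0 < marginal g z.1 := by
  have h : ∀ᵐ x ∂(volume.withDensity fun x => ENNReal.ofReal (marginal g x)), 0 < marginal g x := by
    rw [ae_withDensity_iff H.measurable_marginal.ennreal_ofReal]
    exact Eventually.of_forall fun x hx => by simpa using hx
  rw [← H.map_fst_withDensity] at h
  exact ae_of_ae_map measurable_fst.aemeasurable h

/-- Bounded generators are approximated by networks. -/
theorem exists_isCPFN_integral_norm_sub_le (hρ : Continuous ρ)
    (hnp : ¬ ∃ p : Polynomial ℝ, ∀ t, ρ t = p.eval t)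
    {T : (Fin d → ℝ) → (Fin q → ℝ) → (Fin q → ℝ)} (hT : Measurable (Function.uncurry T))
    (hTR : ∀ x u, ‖T x u‖ ≤ R) {η : ℝ} (hη : 0 < η) :
    ∃ φ, IsCPFN ρ φ ∧
      Integrable (fun z : (Fin d → ℝ) × (Fin q → ℝ) => T z.1 z.2 - φ z.1 z.2)
        ((volume.withDensity fun x => ENNReal.ofReal (marginal g x)).prod
          (volume.restrict (cube q))) ∧
      ∫ z, ‖T z.1 z.2 - φ z.1 z.2‖ ∂((volume.withDensity fun x =>
        ENNReal.ofReal (marginal g x)).prod (volume.restrict (cube q))) ≤ η := by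
  have := H.isFiniteMeasure_withDensity_marginal
  set μX := volume.withDensity fun x => ENNReal.ofReal (marginal g x)
  set μ := μX.prod (volume.restrict (cube q))
  have hTj : ∀ j, Integrable (fun z : (Fin d → ℝ) × (Fin q → ℝ) => T z.1 z.2 j) μ := fun j =>
    Integrable.of_bound ((measurable_pi_apply j).comp hT).aestronglyMeasurable R
      (Eventually.of_forall fun z => (norm_le_pi_norm _ j).trans (hTR _ _))
  have hsupp : ∀ᵐ z ∂μ, z ∈ (Prod.fst '' S) ×ˢ cube q := by
    have h1 : ∀ᵐ z ∂μ, z.1 ∈ Prod.fst '' S :=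
      Measure.quasiMeasurePreserving_fst.ae H.ae_withDensity_mem_fst
    have h2 : ∀ᵐ z ∂μ, z.2 ∈ cube q :=
      Measure.quasiMeasurePreserving_snd.ae (ae_restrict_mem measurableSet_Icc)
    filter_upwards [h1, h2] with z hz1 hz2
    exact ⟨hz1, hz2⟩
  obtain ⟨φ, hφ, h⟩ := exists_isCPFN_integral_abs_sub_le hρ hnp
    (H.isCompact_fst.prod (isCompact_Icc : IsCompact (cube q))) μ hsupp
    (T := fun z => T z.1 z.2) hTj
    (η := η / (q + 1)) (by positivity)
  have hd : ∀ j, Integrable (fun z : (Fin d → ℝ) × (Fin q → ℝ) =>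
      T z.1 z.2 j - φ z.1 z.2 j) μ := fun j => (hTj j).sub (h j).1
  have hint : Integrable (fun z : (Fin d → ℝ) × (Fin q → ℝ) => T z.1 z.2 - φ z.1 z.2) μ :=
    Integrable.of_eval hd
  refine ⟨φ, hφ, hint, ?_⟩
  calc ∫ z, ‖T z.1 z.2 - φ z.1 z.2‖ ∂μ
      ≤ ∫ z, ∑ j, |T z.1 z.2 j - φ z.1 z.2 j| ∂μ := by
        refine integral_mono hint.norm (integrable_finsetSum _ fun j _ => (hd j).abs) fun z => ?_
        refine (pi_norm_le_iff_of_nonneg (Finset.sum_nonneg fun j _ => abs_nonneg _)).2 fun j => ?_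
        exact Finset.single_le_sum (f := fun j => |T z.1 z.2 j - φ z.1 z.2 j|)
          (fun _ _ => abs_nonneg _) (Finset.mem_univ j)
    _ = ∑ j, ∫ z, |T z.1 z.2 j - φ z.1 z.2 j| ∂μ :=
        integral_finsetSum _ fun j _ => (hd j).abs
    _ ≤ ∑ _j : Fin q, η / (q + 1) := Finset.sum_le_sum fun j _ => (h j).2
    _ ≤ η := by
        rw [Finset.sum_const, Finset.card_univ, Fintype.card_fin, nsmul_eq_mul,
          mul_div_assoc', div_le_iff₀ (by positivity)]
        nlinarith

/-- The pointwise bound depends on `x` only, so the joint law may be replaced by that of its first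
component. -/
theorem integral_abs_genDensity_sub_le {κ : (Fin q → ℝ) → ℝ} {ε C : ℝ} (hκ : IsKernel κ)
    (hε : 0 < ε) (hC0 : 0 ≤ C)
    (hC : ∀ v w, |scaledKernel κ ε v - scaledKernel κ ε w| ≤ C * ‖v - w‖)
    {φ ψ : (Fin d → ℝ) → (Fin q → ℝ) → (Fin q → ℝ)} (hφ : Measurable (Function.uncurry φ))
    (hψ : Measurable (Function.uncurry ψ))
    (hint : Integrable (fun z : (Fin d → ℝ) × (Fin q → ℝ) => φ z.1 z.2 - ψ z.1 z.2)
      ((volume.withDensity fun x => ENNReal.ofReal (marginal g x)).prod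
        (volume.restrict (cube q)))) :
    ∫ z, |genDensity κ ε φ z.1 z.2 - genDensity κ ε ψ z.1 z.2|
        ∂(volume.withDensity fun z => ENNReal.ofReal (g z)) ≤
      C * ∫ z, ‖φ z.1 z.2 - ψ z.1 z.2‖ ∂((volume.withDensity fun x =>
        ENNReal.ofReal (marginal g x)).prod (volume.restrict (cube q))) := by
  have := H.isFiniteMeasure_withDensity
  have := H.isFiniteMeasure_withDensity_marginal
  set μX := volume.withDensity fun x => ENNReal.ofReal (marginal g x)
  set μ := volume.withDensity fun z => ENNReal.ofReal (g z)
  have hmap : μ.map Prod.fst = μX := H.map_fst_withDensity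
  set h : (Fin d → ℝ) → ℝ := fun x => ∫ u in cube q, ‖φ x u - ψ x u‖
  have hh : Integrable h μX := hint.norm.integral_prod_left
  have hh' : Integrable (fun z : (Fin d → ℝ) × (Fin q → ℝ) => h z.1) μ := by
    rw [← hmap] at hh
    exact hh.comp_measurable measurable_fst
  have hsec : ∀ᵐ z ∂μ, Integrable (fun u => φ z.1 u - ψ z.1 u) (volume.restrict (cube q)) := by
    have := hint.prod_right_ae
    rw [← hmap] at this
    exact ae_of_ae_map measurable_fst.aemeasurable this
  calc ∫ z, |genDensity κ ε φ z.1 z.2 - genDensity κ ε ψ z.1 z.2| ∂μ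
      ≤ ∫ z, C * h z.1 ∂μ := by
        refine integral_mono_of_nonneg (Eventually.of_forall fun z => abs_nonneg _)
          (hh'.const_mul C) ?_
        filter_upwards [hsec] with z hz
        refine (abs_genDensity_sub_le hκ hε (hφ.comp measurable_prodMk_left)
          (hψ.comp measurable_prodMk_left) hC0 hC z.2 z.2 hz).trans (le_of_eq ?_)
        simp [h]
    _ = C * ∫ x, h x ∂μX := by
        rw [integral_const_mul, ← hmap, integral_map measurable_fst.aemeasurable]
        rw [hmap]
        exact hh.aestronglyMeasurable
    _ = _ := by
        rw [integral_prod _ hint.norm]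

/-- Some network attains a regularized relative entropy of order `ε / δ`. -/
theorem exists_isCPFN_entropy_le (hq : 1 ≤ q) (hρ : Continuous ρ)
    (hnp : ¬ ∃ p : Polynomial ℝ, ∀ t, ρ t = p.eval t) :
    ∃ C, 0 ≤ C ∧ ∀ (κ : (Fin q → ℝ) → ℝ) (ε δ : ℝ), IsKernel κ → 0 < ε → ε ≤ 1 → 0 < δ → δ ≤ 1 →
      ∃ φ, IsCPFN ρ φ ∧ ∫ z, g z * Real.log ((δ + condDensity g z.1 z.2) /
        (δ + genDensity κ ε φ z.1 z.2)) ≤ C * (ε / δ) := by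
  obtain ⟨C, hC0, hC⟩ := H.exists_lintegral_log_ratio_smoothedDensity_le
  obtain ⟨T, hTm, hTR, hT⟩ := H.exists_generator hq
  refine ⟨C + 1, by positivity, fun κ ε δ hκ hε hε1 hδ hδ1 => ?_⟩
  obtain ⟨K, hK0, hKb, hKL⟩ := exists_bound_scaledKernel hκ hε
  -- The tolerance compensates the Lipschitz constant `K` of the scaled kernel, which depends on
  -- `ε`, so replacing `T` by the network costs at most `ε / δ` in entropy. This is the `+ 1` in the
  -- constant.
  obtain ⟨φ, hφ, hint, hle⟩ := H.exists_isCPFN_integral_norm_sub_le hρ hnp hTm hTR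
    (η := ε / (K + 1)) (by positivity)
  refine ⟨φ, hφ, ?_⟩
  have hfin := H.isFiniteMeasure_withDensity
  have hφm : Measurable (Function.uncurry φ) := (hφ.continuous hρ).measurable
  have hGT := measurable_genDensity (ε := ε) hκ hTm
  have hGφ := measurable_genDensity (ε := ε) hκ hφm
  have hT0 : ∀ x y, 0 ≤ genDensity κ ε T x y := genDensity_nonneg hκ hε
  have hφ0 : ∀ x y, 0 ≤ genDensity κ ε φ x y := genDensity_nonneg hκ hε
  have hTK : ∀ x y, genDensity κ ε T x y ≤ K := fun x y =>
    genDensity_le hκ hε (hTm.comp measurable_prodMk_left) hKb y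
  have hφK : ∀ x y, genDensity κ ε φ x y ≤ K := fun x y =>
    genDensity_le hκ hε (hφm.comp measurable_prodMk_left) hKb y
  set μ := volume.withDensity fun z => ENNReal.ofReal (g z)
  have h1 : ∫ z, g z * Real.log ((δ + condDensity g z.1 z.2) / (δ + genDensity κ ε T z.1 z.2)) ≤
      C * (ε / δ) := by
    refine integral_le_of_lintegral_ofReal_le (H.integrable_mul_log_ratio hGT hT0 hTK hδ hδ1)
      (by positivity) ((lintegral_congr_ae ?_).trans_le (hC κ ε δ hκ hε hε1 hδ hδ1))
    -- The density generated by `T` is the smoothed one only where the marginal is positive, which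
    -- is almost everywhere under the joint law.
    have h := H.ae_marginal_pos
    rw [ae_withDensity_iff H.measurable.ennreal_ofReal] at h
    filter_upwards [h] with z hz
    rcases (H.nonneg z).eq_or_lt with h0 | h0
    · rw [← h0, zero_mul, zero_mul]
    · rw [hT κ ε hκ z.1 (hz (by simpa using h0))]
  have h2 : ∫ z, (Real.log (δ + genDensity κ ε T z.1 z.2) -
      Real.log (δ + genDensity κ ε φ z.1 z.2)) ∂μ ≤ ε / δ := by
    have hb : ∀ G : (Fin d → ℝ) → (Fin q → ℝ) → ℝ, Measurable (Function.uncurry G) →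
        (∀ x y, 0 ≤ G x y) → (∀ x y, G x y ≤ K) →
        Integrable (fun z : (Fin d → ℝ) × (Fin q → ℝ) => G z.1 z.2) μ ∧
        Integrable (fun z : (Fin d → ℝ) × (Fin q → ℝ) => Real.log (δ + G z.1 z.2)) μ := by
      intro G hG hG0 hGK
      constructor
      · exact Integrable.of_bound hG.aestronglyMeasurable K (Eventually.of_forall fun z => by
          rw [Real.norm_of_nonneg (hG0 _ _)]
          exact hGK _ _)
      · exact Integrable.of_bound
          (Real.measurable_log.comp (measurable_const.add hG)).aestronglyMeasurable
          (|Real.log δ| + K) (Eventually.of_forall fun z => abs_log_add_le hδ hδ1 (hG0 _ _)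
            (hGK _ _))
    obtain ⟨hT1, hT2⟩ := hb _ hGT hT0 hTK
    obtain ⟨hφ1, hφ2⟩ := hb _ hGφ hφ0 hφK
    refine (integral_log_sub_log_le hδ (fun z => hT0 _ _) (fun z => hφ0 _ _) (hT2.sub hφ2)
      (hT1.sub hφ1)).trans ?_
    refine div_le_div_of_nonneg_right ?_ hδ.le
    refine (H.integral_abs_genDensity_sub_le hκ hε hK0 hKL hTm hφm hint).trans
      ((mul_le_mul_of_nonneg_left hle hK0).trans ?_)
    rw [mul_div_assoc', div_le_iff₀ (by positivity)]
    nlinarith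
  rw [H.integral_withDensity] at h2
  have h3 := H.integrable_mul_log_ratio hGT hT0 hTK hδ hδ1
  have h4 : Integrable fun z : (Fin d → ℝ) × (Fin q → ℝ) => g z *
      (Real.log (δ + genDensity κ ε T z.1 z.2) - Real.log (δ + genDensity κ ε φ z.1 z.2)) := by
    simp only [mul_sub]
    exact (H.integrable_mul_log hGT hT0 hTK hδ hδ1).sub (H.integrable_mul_log hGφ hφ0 hφK hδ hδ1)
  calc ∫ z, g z * Real.log ((δ + condDensity g z.1 z.2) / (δ + genDensity κ ε φ z.1 z.2))
      = (∫ z, g z * Real.log ((δ + condDensity g z.1 z.2) / (δ + genDensity κ ε T z.1 z.2))) +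
        ∫ z, g z * (Real.log (δ + genDensity κ ε T z.1 z.2) -
          Real.log (δ + genDensity κ ε φ z.1 z.2)) := by
        rw [← integral_add h3 h4]
        refine integral_congr_ae (Eventually.of_forall fun z => ?_)
        have a1 : δ + condDensity g z.1 z.2 ≠ 0 := by
          have := H.condDensity_nonneg z.1 z.2
          positivity
        have a2 : δ + genDensity κ ε T z.1 z.2 ≠ 0 := by
          have := hT0 z.1 z.2
          positivity
        have a3 : δ + genDensity κ ε φ z.1 z.2 ≠ 0 := by
          have := hφ0 z.1 z.2
          positivity
        change g z * Real.log _ = g z * Real.log _ + g z * _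
        rw [Real.log_div a1 a3, Real.log_div a1 a2]
        ring
    _ ≤ C * (ε / δ) + ε / δ := add_le_add h1 h2
    _ = (C + 1) * (ε / δ) := by ring

end IsRegularDensity

/-! ### Quasi-minimizers of the empirical loss -/

theorem sqrt_add_le_sqrt_add_sqrt {a b : ℝ} (ha : 0 ≤ a) (hb : 0 ≤ b) : √(a + b) ≤ √a + √b := by
  rw [Real.sqrt_le_left (by positivity)]
  nlinarith [Real.sq_sqrt ha, Real.sq_sqrt hb, mul_nonneg (Real.sqrt_nonneg a) (Real.sqrt_nonneg b)]

namespace IsRegularDensity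

variable {d q : ℕ} {S : Set ((Fin d → ℝ) × (Fin q → ℝ))} {g : (Fin d → ℝ) × (Fin q → ℝ) → ℝ}
  {m B L R r : ℝ} {z₀ : (Fin d → ℝ) × (Fin q → ℝ)} (H : IsRegularDensity S g m B L R r z₀)
include H

theorem integral_mul_log_ratio_eq {G : (Fin d → ℝ) → (Fin q → ℝ) → ℝ} {b δ : ℝ}
    (hG : Measurable (Function.uncurry G)) (hG0 : ∀ x y, 0 ≤ G x y)
    (hGb : ∀ x y, G x y ≤ b) (hδ : 0 < δ) (hδ1 : δ ≤ 1) :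
    ∫ z, g z * Real.log ((δ + condDensity g z.1 z.2) / (δ + G z.1 z.2)) =
      (∫ z, g z * Real.log (δ + condDensity g z.1 z.2)) -
        ∫ z, g z * Real.log (δ + G z.1 z.2) := by
  rw [← integral_sub (H.integrable_mul_log_condDensity hδ hδ1)
    (H.integrable_mul_log hG hG0 hGb hδ hδ1)]
  refine integral_congr_ae (Eventually.of_forall fun z => ?_)
  have hp := H.condDensity_nonneg z.1 z.2
  have hg := hG0 z.1 z.2
  change g z * Real.log _ = _
  rw [Real.log_div (by positivity) (by positivity), mul_sub]

/-- The entropy excess `δ` joins the term `δ |𝒴|`, and subadditivity of the square root separates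
the two rates. -/
theorem l1Error_le_of_entropy_le (hg : ∫ z, g z = 1) {G : (Fin d → ℝ) → (Fin q → ℝ) → ℝ}
    {b δ ε C : ℝ} (hG : Measurable (Function.uncurry G)) (hG0 : ∀ x y, 0 ≤ G x y)
    (hGb : ∀ x y, G x y ≤ b) (hG1 : ∀ x, ∫ y in Prod.snd '' S, G x y ≤ 1)
    (hε : 0 < ε) (hδ : 0 < δ) (hδ1 : δ ≤ 1) (hC : 0 ≤ C)
    (hle : ∫ z, g z * Real.log ((δ + condDensity g z.1 z.2) / (δ + G z.1 z.2)) ≤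
      C * (ε / δ) + δ) :
    l1Error (volume.withDensity fun x => ENNReal.ofReal (marginal g x)) (Prod.snd '' S) g G ≤
      ENNReal.ofReal (√(H.errorConst * (1 + volume.real (Prod.snd '' S))) * √δ +
        √(H.errorConst * C) * √(ε / δ)) := by
  refine (H.l1Error_le hG hG0 hGb hG1 hδ hδ1).trans (ENNReal.ofReal_le_ofReal ?_)
  have h0 := H.errorConst_pos.le
  rw [← Real.sqrt_mul (by positivity), ← Real.sqrt_mul (by positivity)]
  refine (Real.sqrt_le_sqrt ?_).trans (sqrt_add_le_sqrt_add_sqrt (by positivity) (by positivity))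
  rw [hg, mul_one]
  refine (mul_le_mul_of_nonneg_left (add_le_add_left hle _) h0).trans (le_of_eq ?_)
  ring

/-- Quasi-minimizers of the empirical loss asymptotically have relative entropy of order
`ε / δ + δ`. -/
theorem ae_eventually_entropy_le {Ω : Type*} [MeasurableSpace Ω] {P : Measure Ω}
    [IsProbabilityMeasure P] {W : Ω → (Fin d → ℝ) × (Fin q → ℝ)}
    {z : ℕ → Ω → (Fin d → ℝ) × (Fin q → ℝ)} (hW : Measurable W) (hindep : iIndepFun z P)
    (hident : ∀ i, IdentDistrib (z i) W P P)
    (hlaw : P.map W = volume.withDensity fun z => ENNReal.ofReal (g z)) {k : ℕ} (hk : 2 ≤ k)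
    {ρ : ℝ → ℝ} (hρ : ContDiff ℝ k ρ) {κ : (Fin q → ℝ) → ℝ} (hκ : IsKernel κ) {ε δ M c : ℝ}
    (hε : 0 < ε) (hδ : 0 < δ) (hδ1 : δ ≤ 1) (hM : 0 ≤ M)
    {φ₀ : (Fin d → ℝ) → (Fin q → ℝ) → (Fin q → ℝ)} (hφ₀ : φ₀ ∈ hypClass ρ k (Prod.fst '' S) M)
    (hc : ∫ z, g z * Real.log ((δ + condDensity g z.1 z.2) /
        (δ + genDensity κ ε φ₀ z.1 z.2)) ≤ c) :
    ∀ᵐ ω ∂P, ∀ φ : ℕ → (Fin d → ℝ) → (Fin q → ℝ) → (Fin q → ℝ),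
      (∀ n : ℕ, 1 ≤ n → IsQuasiMin (empLoss κ ε δ n (fun i => (z i ω).1) fun i => (z i ω).2)
        (hypClass ρ k (Prod.fst '' S) M) (1 / (n : ℝ)) (φ n)) →
      ∀ᶠ n in atTop, ∫ z, g z * Real.log ((δ + condDensity g z.1 z.2) /
        (δ + genDensity κ ε (φ n) z.1 z.2)) ≤ c + δ := by
  obtain ⟨K, hK0, hKb, hKL⟩ := exists_bound_scaledKernel hκ hε
  have hWS : ∀ᵐ w ∂(P.map W), w ∈ S := by
    rw [hlaw, ae_withDensity_iff H.measurable.ennreal_ofReal]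
    refine Eventually.of_forall fun w hw => ?_
    by_contra h
    simp [H.eq_zero w h] at hw
  have hKi : (interior (Prod.fst '' S)).Nonempty :=
    ⟨z₀.1, isOpenMap_fst.image_interior_subset S ⟨z₀, mem_interior_iff_mem_nhds.2
      (Filter.mem_of_superset (Metric.closedBall_mem_nhds z₀ H.r_pos) H.ball_subset), rfl⟩⟩
  filter_upwards [uniform_law_of_large_numbers hW hindep hident H.compact hWS] with ω hω φ hφ
  -- Lipschitz constant and bound shared by the whole class. The deviation `δ / 4` is spent twice,
  -- at the quasi-minimizer and at `φ₀`; with `1 / n ≤ δ / 2` the total excess is `δ`.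
  obtain ⟨N, hN⟩ := hω (K * (1 + d * M) / δ) (|Real.log δ| + K) (δ / 4) (by positivity)
  have hmeas : ∀ ψ ∈ hypClass ρ (q := q) k (Prod.fst '' S) M, Measurable (Function.uncurry ψ) :=
    fun ψ hψ => by
      have h : Continuous (Function.uncurry ψ) := hψ.1.continuous hρ.continuous
      exact h.measurable
  have hb : ∀ ψ ∈ hypClass ρ (q := q) k (Prod.fst '' S) M, ∀ x y, genDensity κ ε ψ x y ≤ K :=
    fun ψ hψ x y => genDensity_le hκ hε ((hmeas ψ hψ).comp measurable_prodMk_left) hKb y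
  have h0 : ∀ (ψ : (Fin d → ℝ) → (Fin q → ℝ) → (Fin q → ℝ)) x y, 0 ≤ genDensity κ ε ψ x y :=
    fun ψ => genDensity_nonneg (φ := ψ) hκ hε
  have hdev : ∀ n ≥ N, ∀ ψ ∈ hypClass ρ (q := q) k (Prod.fst '' S) M,
      |-empLoss κ ε δ n (fun i => (z i ω).1) (fun i => (z i ω).2) ψ -
        ∫ z, g z * Real.log (δ + genDensity κ ε ψ z.1 z.2)| ≤ δ / 4 := by
    intro n hn ψ hψ
    have h := hN n hn (fun z => Real.log (δ + genDensity κ ε ψ z.1 z.2))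
      (Real.measurable_log.comp (measurable_const.add (measurable_genDensity hκ (hmeas ψ hψ))))
      (fun w _ => abs_log_add_le hδ hδ1 (h0 _ _ _) (hb ψ hψ _ _)) (fun w hw w' hw' => by
        refine (abs_log_add_sub_log_add_le hδ (h0 _ _ _) (h0 _ _ _)).trans ?_
        rw [div_mul_eq_mul_div]
        exact div_le_div_of_nonneg_right (abs_genDensity_sub_le_of_mem_hypClass hκ hε hk hρ
          H.convex_fst hKi hM hψ hK0 hKL ⟨w, hw, rfl⟩ ⟨w', hw', rfl⟩) hδ.le)
    rw [hlaw, H.integral_withDensity] at h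
    unfold empLoss
    rw [neg_mul, neg_neg]
    exact h
  filter_upwards [eventually_ge_atTop N, eventually_ge_atTop 1,
    eventually_ge_atTop ⌈2 / δ⌉₊] with n hnN hn1 hnδ
  obtain ⟨hmem, hmin⟩ := hφ n hn1
  have hn : 1 / (n : ℝ) ≤ δ / 2 := by
    have h1 : 2 / δ ≤ n := (Nat.le_ceil _).trans (by exact_mod_cast hnδ)
    have hn0 : (0 : ℝ) < n := by exact_mod_cast hn1
    rw [div_le_iff₀ hδ] at h1
    rw [div_le_div_iff₀ hn0 two_pos]
    linarith
  have h1 := abs_le.1 (hdev n hnN _ hmem)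
  have h2 := abs_le.1 (hdev n hnN _ hφ₀)
  have h3 := hmin φ₀ hφ₀
  rw [H.integral_mul_log_ratio_eq (measurable_genDensity hκ (hmeas _ hφ₀)) (h0 _) (hb _ hφ₀) hδ hδ1]
    at hc
  rw [H.integral_mul_log_ratio_eq (measurable_genDensity hκ (hmeas _ hmem)) (h0 _) (hb _ hmem)
    hδ hδ1]
  linarith [h1.1, h1.2, h2.1, h2.2]

end IsRegularDensity

end CPFN

end

/-! ### Proof of near asymptotic consistency. -/

theorem theorem1
    {Ω : Type*} [MeasurableSpace Ω] (P : Measure Ω) [IsProbabilityMeasure P]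
    {d q k : ℕ} (hd : 1 ≤ d) (hq : 1 ≤ q) (hk : ((d : ℝ) + q) / 2 < k)
    -- the pair `(X, Y)`, its joint support `S` and its joint density `f`
    (X : Ω → (Fin d → ℝ)) (Y : Ω → (Fin q → ℝ)) (hX : Measurable X) (hY : Measurable Y)
    (S : Set ((Fin d → ℝ) × (Fin q → ℝ)))
    (hS : S = (P.map (fun ω => (X ω, Y ω))).support)
    (hS_compact : IsCompact S) (hS_convex : Convex ℝ S) (hS_int : (interior S).Nonempty)
    (f : (Fin d → ℝ) × (Fin q → ℝ) → ℝ) (hf : CPFN.IsJointDensity P X Y f)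
    (hf_Ck : CPFN.IsCk k (CPFN.splitCoords ⁻¹' S) (fun z => f (CPFN.splitCoords z)))
    (hf_pos : ∀ z ∈ S, 0 < f z)
    -- the kernel and the activation
    (κ : (Fin q → ℝ) → ℝ) (hκ : CPFN.IsKernel κ)
    (ρ : ℝ → ℝ) (hρ : ContDiff ℝ k ρ) (hρ_nonpoly : ¬ ∃ p : Polynomial ℝ, ∀ t, ρ t = p.eval t)
    -- the iid sample
    (x : ℕ → Ω → (Fin d → ℝ)) (y : ℕ → Ω → (Fin q → ℝ))
    (hxy_indep : iIndepFun (fun i ω => (x i ω, y i ω)) P)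
    (hxy_ident : ∀ i, IdentDistrib (fun ω => (x i ω, y i ω)) (fun ω => (X ω, Y ω)) P P) :
    ∃ c₁ c₂ : ℝ, 0 < c₁ ∧ 0 < c₂ ∧
      ∀ ε ∈ Ioo (0 : ℝ) 1, ∀ δ ∈ Ioo (0 : ℝ) 1,
        ∃ M₀ : ℝ, 1 ≤ M₀ ∧ ∀ M : ℝ, M₀ ≤ M →
          ∀ᵐ ω ∂P, ∀ φhat : ℕ → (Fin d → ℝ) → (Fin q → ℝ) → (Fin q → ℝ),
            (∀ n : ℕ, 1 ≤ n →
              CPFN.IsQuasiMin (CPFN.empLoss κ ε δ n (fun i => x i ω) (fun i => y i ω))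
                (CPFN.hypClass ρ k (P.map X).support M) (1 / (n : ℝ)) (φhat n)) →
            Filter.limsup
                (fun n => CPFN.l1Error (P.map X) (P.map Y).support f
                  (CPFN.genDensity κ ε (φhat n)))
                Filter.atTop
              < ENNReal.ofReal (c₁ * Real.sqrt δ + c₂ * Real.sqrt (ε / δ)) := by
  -- From `k > (d + q) / 2 ≥ 1`; with `k ≥ 2` the `C^k` norm controls first derivatives.
  have hk2 : 2 ≤ k := by
    have h1 : (1 : ℝ) ≤ d := by exact_mod_cast hd
    have h2 : (1 : ℝ) ≤ q := by exact_mod_cast hq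
    have h3 : (1 : ℝ) < k := by linarith
    exact_mod_cast h3
  have hXY : Measurable fun ω => (X ω, Y ω) := hX.prodMk hY
  obtain ⟨hfm, hf0, hlawf⟩ := hf
  obtain ⟨m, B, L, R, r, z₀, H⟩ := CPFN.exists_isRegularDensity hk2 hS_compact hS_convex hS_int hfm
    hf_Ck hf_pos
  have hfg : f =ᵐ[volume] S.indicator f := by
    have h := CPFN.ae_eq_indicator_support (ν := volume) hfm hf0
    rwa [← hlawf, ← hS] at h
  set g := S.indicator f with hg
  have hlaw : P.map (fun ω => (X ω, Y ω)) = volume.withDensity fun z => ENNReal.ofReal (g z) := by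
    rw [hlawf]
    exact withDensity_congr_ae (hfg.fun_comp ENNReal.ofReal)
  have hlawX : P.map X = volume.withDensity fun x => ENNReal.ofReal (CPFN.marginal g x) := by
    rw [← H.map_fst_withDensity, ← hlaw, Measure.map_map measurable_fst hXY]
    rfl
  have hsX : (P.map X).support = Prod.fst '' S := by
    rw [hS, ← CPFN.support_map_eq_image (hS ▸ hS_compact) continuous_fst,
      Measure.map_map measurable_fst hXY]
    rfl
  have hsY : (P.map Y).support = Prod.snd '' S := by
    rw [hS, ← CPFN.support_map_eq_image (hS ▸ hS_compact) continuous_snd,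
      Measure.map_map measurable_snd hXY]
    rfl
  have hg1 : ∫ z, g z = 1 := by
    have : IsProbabilityMeasure (P.map fun ω => (X ω, Y ω)) :=
      Measure.isProbabilityMeasure_map hXY.aemeasurable
    have h := H.integral_withDensity fun _ => 1
    rw [← hlaw] at h
    simpa using h.symm
  have hac : P.map X ≪ volume := hlawX ▸ withDensity_absolutelyContinuous _ _
  obtain ⟨C, hC0, hC⟩ := H.exists_isCPFN_entropy_le hq hρ.continuous hρ_nonpoly
  set a := √(H.errorConst * (1 + volume.real (Prod.snd '' S)))
  set b := √(H.errorConst * C)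
  -- The error is eventually at most `a √δ + b √(ε / δ)`; the added ones make the constants positive
  -- and the final inequality strict.
  refine ⟨a + 1, b + 1, by positivity, by positivity, fun ε hε δ hδ => ?_⟩
  obtain ⟨φ₀, hφ₀, hle⟩ := hC κ ε δ hκ hε.1 hε.2.le hδ.1 hδ.2.le
  have hN := hφ₀.lintegral_ckNormVec_lt_top (by omega : 1 ≤ k) hρ H.isCompact_fst H.convex_fst
  set N := ∫⁻ u in CPFN.cube q, CPFN.ckNormVec k (Prod.fst '' S) fun x => φ₀ x u
  -- `M` must exceed the norm of the comparison network `φ₀`, which depends on `ε` and `δ`.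
  refine ⟨N.toReal + 1, le_add_of_nonneg_left ENNReal.toReal_nonneg, fun M hM => ?_⟩
  have hM0 : 0 ≤ M := by
    have := ENNReal.toReal_nonneg (a := N)
    linarith
  have hmem : φ₀ ∈ CPFN.hypClass ρ k (Prod.fst '' S) M :=
    ⟨hφ₀, (ENNReal.lt_ofReal_iff_toReal_lt hN.ne).2 (by linarith)⟩
  filter_upwards [H.ae_eventually_entropy_le hXY hxy_indep hxy_ident hlaw hk2 hρ hκ hε.1 hδ.1
    hδ.2.le hM0 hmem hle] with ω hω φ hφ
  rw [hsX] at hφ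
  obtain ⟨K, -, hKb, -⟩ := CPFN.exists_bound_scaledKernel hκ hε.1
  have hev : ∀ᶠ n in Filter.atTop, CPFN.l1Error (P.map X) (P.map Y).support f
      (CPFN.genDensity κ ε (φ n)) ≤ ENNReal.ofReal (a * √δ + b * √(ε / δ)) := by
    filter_upwards [hω φ hφ, Filter.eventually_ge_atTop 1] with n hn hn1
    have hφm : Measurable (Function.uncurry (φ n)) :=
      ((hφ n hn1).1.1.continuous hρ.continuous).measurable
    rw [CPFN.l1Error_congr hac hfg, hlawX, hsY]
    exact H.l1Error_le_of_entropy_le hg1 (CPFN.measurable_genDensity hκ hφm)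
      (CPFN.genDensity_nonneg hκ hε.1)
      (fun x _ => CPFN.genDensity_le hκ hε.1 (hφm.comp measurable_prodMk_left) hKb _)
      (fun x => CPFN.integral_genDensity_le hκ hε.1 hφm _ x) hε.1 hδ.1 hδ.2.le hC0 hn
  refine (Filter.limsup_le_of_le (h := hev)).trans_lt ?_
  have h1 : 0 < √δ := Real.sqrt_pos.2 hδ.1
  have h2 : 0 < √(ε / δ) := Real.sqrt_pos.2 (div_pos hε.1 hδ.1)
  have h3 : 0 ≤ a := Real.sqrt_nonneg _
  have h4 : 0 ≤ b := Real.sqrt_nonneg _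
  rw [ENNReal.ofReal_lt_ofReal_iff (by positivity)]
  linarith
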